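/- **Setting.** Let $G=(V,E,w)$ be an undirected graph on $V=\{0,\dots,n-1\}$ with $m$ edges and integer edge weights in $[1,M]$, $M\ge 1$, and let $s\in V$ be a source. For an edge $e$ (a vertex $v\ne s$) let $d(s,t,e)$ (resp. $d(s,t,v)$) be the distance, possibly $\infty$, from $s$ to $t$ in $G-e$ (resp. $G-v$). A shortest-path tree of a graph $H$ rooted in $s$ is a rooted tree (given by a parent pointer for each of its vertices other than $s$) that spans exactly the vertices reachable from $s$ in $H$ and all of whose root-to-vertex paths are shortest paths in $H$. Time and space refer to a deterministic word RAM with words of $W\ge c\log_2(n+M)$ bits for a suitable constant $c$ (hence words of $O(\log n)$ bits suffice if $M=\mathrm{poly}(n)$); time counts instructions and space counts machine words. All programs and constants below are absolute. **Lemma (edge failures).** There is a preprocessing algorithm that, given $n$, $m$, $M$, $s$, the list of the weighted edges of $G$, a shortest-path tree $T_s$ of $G$ rooted in $s$, and a table with constant-time access to all replacement distances $d(s,t,e)$, $t\in V$, $e\in E(T_s)$, computes in time $$O\bigl(\min\{m\sqrt{Mn},\,mn\}+n^2\bigr)$$ a data structure of $$O\bigl(\min\{M^{1/2}n^{3/2},\,n^2\}\bigr)$$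 words. There is a query algorithm with access only to that data structure which, given the endpoints of any edge $e\in E$, returns in time $O(n)$ a shortest-path tree of $G-e$ rooted in $s$ (as the array of the parents of all vertices). **Lemma (vertex failures).** The same holds, with the same bounds, for vertex failures: the preprocessing is given the values $d(s,t,v)$, $t,v\in V$, $v\ne s$, instead of the values $d(s,t,e)$, and, given any vertex $v\in V\setminus\{s\}$, the query algorithm returns in time $O(n)$ a shortest-path tree of $G-v$ rooted in $s$. -/

import Mathlib

/-! ## The machine model: a uniform-cost word RAM

The memory consists of registers `0, 1, 2, …` and of arrays `0, 1, 2, …`. Register and array names are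
constants of the program, so a program touches only a constant number of them; array cells are
addressed indirectly. Every register and every cell holds one machine word of `W` bits. -/

/-- The arithmetic and comparison operations of the machine. -/
inductive WordOp where
  | add | sub | mul | div | lt | eq

/-- Semantics of the operations on words of `W` bits: addition and multiplication are modulo `2 ^ W`,
subtraction is truncated at `0`, division rounds down, comparisons return `1` or `0`. -/
def WordOp.apply (W : ℕ) : WordOp → ℕ → ℕ → ℕ
  | .add, a, b => (a + b) % 2 ^ W
  | .sub, a, b => a - b
  | .mul, a, b => (a * b) % 2 ^ W
  | .div, a, b => a / b
  | .lt, a, b => if a < b then 1 else 0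
  | .eq, a, b => if a = b then 1 else 0

/-- Expressions: constants, registers, the cell of array `a` at a computed address, and operations. -/
inductive WordExpr where
  | const (c : ℕ)
  | reg (x : ℕ)
  | load (a : ℕ) (i : WordExpr)
  | op (o : WordOp) (e₁ e₂ : WordExpr)

/-- Programs, with structured control flow. A value is true iff it is nonzero. -/
inductive WordCmd where
  | skip
  | assign (x : ℕ) (e : WordExpr)
  | store (a : ℕ) (i e : WordExpr)
  | seq (c₁ c₂ : WordCmd)
  | branch (e : WordExpr) (c₁ c₂ : WordCmd)
  | loop (e : WordExpr) (c : WordCmd)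

/-- The contents of the registers and of the arrays. -/
structure WordState where
  reg : ℕ → ℕ
  mem : ℕ → ℕ → ℕ

/-- The initial state: `args` in the first registers, `mem` in the arrays, all other registers `0`. -/
def WordState.start (args : List ℕ) (mem : ℕ → ℕ → ℕ) : WordState where
  reg x := args.getD x 0
  mem := mem

def WordState.setReg (σ : WordState) (x v : ℕ) : WordState where
  reg := Function.update σ.reg x v
  mem := σ.mem

def WordState.setMem (σ : WordState) (a i v : ℕ) : WordState where
  reg := σ.reg
  mem := Function.update σ.mem a (Function.update (σ.mem a) i v)

/-- The value of an expression, on a machine with words of `W` bits. -/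
def WordExpr.eval (W : ℕ) (σ : WordState) : WordExpr → ℕ
  | .const c => c % 2 ^ W
  | .reg x => σ.reg x
  | .load a i => σ.mem a (i.eval W σ)
  | .op o e₁ e₂ => o.apply W (e₁.eval W σ) (e₂.eval W σ)

/-- The time to evaluate an expression: one step for every constant, register access, memory access
and operation. -/
def WordExpr.cost : WordExpr → ℕ
  | .const _ => 1
  | .reg _ => 1
  | .load _ i => i.cost + 1
  | .op _ e₁ e₂ => e₁.cost + e₂.cost + 1

/-- `WordRun W c σ τ T`: on a machine with words of `W` bits, the program `c` started in state `σ` halts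
in state `τ` after exactly `T` steps. -/
inductive WordRun (W : ℕ) : WordCmd → WordState → WordState → ℕ → Prop where
  | skip (σ : WordState) : WordRun W .skip σ σ 1
  | assign (σ : WordState) (x : ℕ) (e : WordExpr) :
      WordRun W (.assign x e) σ (σ.setReg x (e.eval W σ)) (e.cost + 1)
  | store (σ : WordState) (a : ℕ) (i e : WordExpr) :
      WordRun W (.store a i e) σ (σ.setMem a (i.eval W σ) (e.eval W σ)) (i.cost + e.cost + 1)
  | seq {c₁ c₂ : WordCmd} {σ ρ τ : WordState} {T₁ T₂ : ℕ} :
      WordRun W c₁ σ ρ T₁ → WordRun W c₂ ρ τ T₂ → WordRun W (.seq c₁ c₂) σ τ (T₁ + T₂)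
  | branch_true {e : WordExpr} {c₁ c₂ : WordCmd} {σ τ : WordState} {T : ℕ} :
      e.eval W σ ≠ 0 → WordRun W c₁ σ τ T → WordRun W (.branch e c₁ c₂) σ τ (e.cost + 1 + T)
  | branch_false {e : WordExpr} {c₁ c₂ : WordCmd} {σ τ : WordState} {T : ℕ} :
      e.eval W σ = 0 → WordRun W c₂ σ τ T → WordRun W (.branch e c₁ c₂) σ τ (e.cost + 1 + T)
  | loop_true {e : WordExpr} {c : WordCmd} {σ ρ τ : WordState} {T₁ T₂ : ℕ} :
      e.eval W σ ≠ 0 → WordRun W c σ ρ T₁ → WordRun W (.loop e c) ρ τ T₂ →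
      WordRun W (.loop e c) σ τ (e.cost + 1 + T₁ + T₂)
  | loop_false {e : WordExpr} {c : WordCmd} {σ : WordState} :
      e.eval W σ = 0 → WordRun W (.loop e c) σ σ (e.cost + 1)

/-! ## Weighted distances and shortest-path trees -/

/-- The weighted distance of `u` and `v` in `H`: the minimum weight of a walk from `u` to `v` (for
nonnegative weights this is the minimum weight of a path), and `⊤` if there is none. -/
noncomputable def wdist {V : Type*} (H : SimpleGraph V) (w : Sym2 V → ℕ) (u v : V) : ℕ∞ :=
  ⨅ p : H.Walk u v, (((p.edges.map w).sum : ℕ) : ℕ∞)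

/-- `ParentPath H w par s t d`: following the parent pointers `par` from `t` one arrives at `s`, along
edges of `H`, and the path traversed has weight `d`. -/
inductive ParentPath {V : Type*} (H : SimpleGraph V) (w : Sym2 V → ℕ) (par : V → Option V) (s : V) :
    V → ℕ → Prop where
  | root : ParentPath H w par s s 0
  | step {t y : V} {d : ℕ} : par t = some y → H.Adj y t → ParentPath H w par s y d →
      ParentPath H w par s t (d + w s(y, t))

/-- The parent pointers `par` form a shortest-path tree of `H` rooted in `s`: the tree spans exactly the
vertices that are reachable from `s` in `H`, and each tree path from `s` to `t` is a shortest path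
in `H`. Vertices outside of the tree, and the root, have no parent. -/
structure IsShortestPathTree {V : Type*} (H : SimpleGraph V) (w : Sym2 V → ℕ) (s : V)
    (par : V → Option V) : Prop where
  root : par s = none
  reachable : ∀ t, H.Reachable s t → ∃ d : ℕ, ParentPath H w par s t d ∧ (d : ℕ∞) = wdist H w s t
  unreachable : ∀ t, ¬ H.Reachable s t → par t = none

/-! ## The input -/

/-- An undirected graph on the vertices `0, …, n - 1` with integer edge weights in `[1, M]` and a source,
together with a list of its edges (each edge once, in arbitrary order and orientation) and a
shortest-path tree rooted in the source. -/
structure SourcedGraph (n M : ℕ) where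
  graph : SimpleGraph (Fin n)
  weight : Sym2 (Fin n) → ℕ
  one_le_weight : ∀ e ∈ graph.edgeSet, 1 ≤ weight e
  weight_le : ∀ e ∈ graph.edgeSet, weight e ≤ M
  source : Fin n
  edges : List (Fin n × Fin n)
  edges_nodup : (edges.map fun p => s(p.1, p.2)).Nodup
  mem_edges : ∀ e, (e ∈ edges.map fun p => s(p.1, p.2)) ↔ e ∈ graph.edgeSet
  tree : Fin n → Option (Fin n)
  isTree : IsShortestPathTree graph weight source tree

/-- The number of edges. -/
noncomputable def SourcedGraph.numEdges {n M : ℕ} (I : SourcedGraph n M) : ℕ :=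
  I.graph.edgeSet.ncard

/-- The graph `G - e`. -/
def SourcedGraph.deleteEdge {n M : ℕ} (I : SourcedGraph n M) (e : Sym2 (Fin n)) :
    SimpleGraph (Fin n) :=
  I.graph.deleteEdges {e}

/-- The graph `G - v`: all edges at `v` are removed. The vertex `v` stays as an isolated vertex, which is
immaterial for distances from, and shortest-path trees rooted in, a vertex other than `v`. -/
def SourcedGraph.deleteVertex {n M : ℕ} (I : SourcedGraph n M) (v : Fin n) :
    SimpleGraph (Fin n) :=
  I.graph.deleteIncidenceSet v

/-- A vertex or its absence as a word. -/
def vertexCode {n : ℕ} : Option (Fin n) → ℕ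
  | none => 0
  | some v => v + 1

/-- A distance as a word, with `0` for an infinite distance. -/
noncomputable def distCode (d : ℕ∞) : ℕ := if d = ⊤ then 0 else d.toNat + 1

/-- An array that holds the values of `f`, followed by zeros. -/
def cells {k : ℕ} (f : Fin k → ℕ) (i : ℕ) : ℕ := if h : i < k then f ⟨i, h⟩ else 0

/-- The replacement distances for edge failures: `d(s, t, e)` where `e` is the edge of the given
shortest-path tree between `v` and the parent of `v`; there is no such edge (entry `0`) if `v` has no
parent. -/
noncomputable def SourcedGraph.edgeReplacement {n M : ℕ} (I : SourcedGraph n M) (t v : Fin n) : ℕ :=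
  match I.tree v with
  | none => 0
  | some p => distCode (wdist (I.deleteEdge s(p, v)) I.weight I.source t)

/-- The replacement distances for vertex failures: `d(s, t, v)` for `v ≠ s`. -/
noncomputable def SourcedGraph.vertexReplacement {n M : ℕ} (I : SourcedGraph n M) (t v : Fin n) : ℕ :=
  if v = I.source then 0 else distCode (wdist (I.deleteVertex v) I.weight I.source t)

/-- The initial state of the preprocessing. Registers `0, …, 3` hold `n`, `m`, `M`, `s`; arrays `0`, `1`,
`2` hold the first endpoints, the second endpoints and the weights of the edges; array `3` holds the
parents of the vertices in the given shortest-path tree; array `4` holds the given table of replacement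
distances, the entry for `(t, v)` in cell `t * n + v`. -/
noncomputable def SourcedGraph.input {n M : ℕ} (I : SourcedGraph n M) (table : Fin n → Fin n → ℕ) :
    WordState :=
  WordState.start [n, I.edges.length, M, I.source] fun a =>
    match a with
    | 0 => cells fun i : Fin I.edges.length => (I.edges.get i).1
    | 1 => cells fun i : Fin I.edges.length => (I.edges.get i).2
    | 2 => cells fun i : Fin I.edges.length => I.weight s((I.edges.get i).1, (I.edges.get i).2)
    | 3 => cells fun v => vertexCode (I.tree v)
    | 4 => cells fun k : Fin (n * n) => table k.divNat k.modNat
    | _ => fun _ => 0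

/-! ## The data structure that a preprocessing leaves behind

In its final state `σ`, the preprocessing announces in the registers `j < K` how many words of
array `j` belong to the data structure; everything else is discarded. -/

/-- The size of the data structure, in machine words. -/
def structureWords (K : ℕ) (σ : WordState) : ℕ := ∑ j ∈ Finset.range K, σ.reg j

/-- The memory that contains the data structure and nothing else. -/
def structureMem (K : ℕ) (σ : WordState) (j i : ℕ) : ℕ :=
  if j < K ∧ i < σ.reg j then σ.mem j i else 0

/-- Started with `args` in its first registers on the data structure (and nothing else), the query
program halts within `T` steps, leaves the data structure intact, and writes into array `K` the parents
of the vertices in some shortest-path tree of `H` rooted in `s`. -/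
def AnswersTree {n : ℕ} (W K : ℕ) (query : WordCmd) (args : List ℕ) (σ : WordState)
    (H : SimpleGraph (Fin n)) (w : Sym2 (Fin n) → ℕ) (s : Fin n) (T : ℕ) : Prop :=
  ∃ (τ : WordState) (T' : ℕ), WordRun W query (WordState.start args (structureMem K σ)) τ T' ∧
    T' ≤ T ∧ (∀ j < K, τ.mem j = structureMem K σ j) ∧
    ∃ par : Fin n → Option (Fin n), IsShortestPathTree H w s par ∧
      ∀ t : Fin n, τ.mem K t = vertexCode (par t)

/-! A failure is a vertex `v` other than the source, or the tree edge above `v`. Only vertices below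
`v` in the tree are affected. Write d for distances in the intact graph and d_v for distances after
the failure. Let `t` lie strictly below `v`, with tree parent `p`. Either the tree edge from `p`
still attains d_v(t), or `t` is `Exceptional`: d_v(t) < d_v(p) + w(p, t). In the exceptional case a
shortest replacement path meets no vertex of the tree path from `v` to `p`, since from such a vertex
the surviving tree path through `p` would be as good (`Exceptional.notMem_support`). The path
therefore also survives every failure between `v` and `p`, and its last edge remains a candidate
with a valid upper bound for the distance (`Exceptional.transfer`).

So it suffices to treat the failures from the root downwards and to log, for each `t`, a last edge
and its distance when `v = t`, or when `t` is exceptional and the distance differs from the one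
logged last. For any failure above `t`, the better of the tree edge and the latest logged candidate
is then a correct last edge (`Chain.good`, `Good.last`), and vertices processed parents first have
the distance of `p` at hand.

The heart is the count of log entries (`exceptional_chain_bound`). Let v_0, ..., v_(k-1) be the
exceptional failures logged for `t`. Their distances D_i strictly decrease, so D_i ≥ d(t) + (k-1-i).
Cut each replacement path at its last vertex a_i on the tree path to `p`; the rest is a detour Q_i,
of weight at least D_i - d(t). For i in the first half, Q_i thus has at least k/(4M) edges. If
detours of two such failures, with a further one between them, met within the first k/(4M) steps of
the later one, then exchanging their ends would give D_j < d(t) + k/2 (`Detour.lt_of_meet`), which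
is false. About k/4 detours have disjoint beginnings of k/(4M) vertices, so k² = O(Mn); trivially k
≤ n.

The log is one time-ordered list of entries. A snapshot of the current entry numbers is taken
whenever n entries have accumulated, so snapshots cost no more cells than the log, apart from the
initial one, and a query restores its state from one snapshot and at most 2n entries. Preprocessing
spends constant time per pair of vertices and one scan of the neighbours of `t` per entry for `t`.
The latter sums to O(min(√(Mn), n) · (n + m)). -/

set_option linter.unusedSimpArgs false

/-! ## Weighted walks and distances -/

section Distances

variable {V : Type*} {H H' : SimpleGraph V} {w : Sym2 V → ℕ}

/-- The weight of a walk. -/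
def walkWeight (w : Sym2 V → ℕ) {u v : V} (p : H.Walk u v) : ℕ := (p.edges.map w).sum

@[simp] theorem walkWeight_nil {u : V} : walkWeight w (SimpleGraph.Walk.nil : H.Walk u u) = 0 := rfl

@[simp] theorem walkWeight_cons {u v x : V} (h : H.Adj u v) (p : H.Walk v x) :
    walkWeight w (SimpleGraph.Walk.cons h p) = w s(u, v) + walkWeight w p := by
  simp [walkWeight]

theorem walkWeight_append {u v x : V} (p : H.Walk u v) (q : H.Walk v x) :
    walkWeight w (p.append q) = walkWeight w p + walkWeight w q := by
  simp [walkWeight, SimpleGraph.Walk.edges_append]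

theorem walkWeight_reverse {u v : V} (p : H.Walk u v) :
    walkWeight w p.reverse = walkWeight w p := by
  simp [walkWeight, SimpleGraph.Walk.edges_reverse]

theorem walkWeight_transfer {u v : V} (p : H.Walk u v) (h : ∀ e ∈ p.edges, e ∈ H'.edgeSet) :
    walkWeight w (p.transfer H' h) = walkWeight w p := by
  simp [walkWeight, SimpleGraph.Walk.edges_transfer]

theorem walkWeight_le_mul {M : ℕ} (hw : ∀ e ∈ H.edgeSet, w e ≤ M) {u v : V} (p : H.Walk u v) :
    walkWeight w p ≤ p.length * M := by
  induction p with
  | nil => simp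
  | cons h p ih =>
    have := hw s(_, _) ((H.mem_edgeSet).2 h)
    simp only [walkWeight_cons, SimpleGraph.Walk.length_cons, add_mul, one_mul]
    omega

theorem wdist_le {u v : V} (p : H.Walk u v) : wdist H w u v ≤ (walkWeight w p : ℕ) :=
  iInf_le (fun p : H.Walk u v => (((p.edges.map w).sum : ℕ) : ℕ∞)) p

theorem wdist_eq_top_iff {u v : V} : wdist H w u v = ⊤ ↔ ¬ H.Reachable u v := by
  unfold wdist
  rw [iInf_eq_top]
  constructor
  · rintro h ⟨p⟩
    exact ENat.natCast_ne_top _ (h p)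
  · intro h p
    exact absurd ⟨p⟩ h

/-- The infimum is attained because `ℕ∞` is well-ordered, and shortcutting a minimal walk to a path
only drops edges from its edge list. -/
theorem exists_walk_of_wdist_ne_top {u v : V} (h : wdist H w u v ≠ ⊤) :
    ∃ p : H.Walk u v, p.IsPath ∧ ((walkWeight w p : ℕ) : ℕ∞) = wdist H w u v := by
  classical
  rw [Ne, wdist_eq_top_iff, not_not] at h
  have : Nonempty (H.Walk u v) := h
  obtain ⟨p, hp⟩ := ciInf_mem (fun p : H.Walk u v => (((p.edges.map w).sum : ℕ) : ℕ∞))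
  have hp' : ((walkWeight w p : ℕ) : ℕ∞) = wdist H w u v := hp
  refine ⟨p.bypass, p.bypass_isPath, le_antisymm ?_ (wdist_le _)⟩
  rw [← hp', Nat.cast_le]
  have hsub : p.bypass.edges.Sublist p.edges := p.edges_bypass_sublist_edges
  exact (hsub.map w).sum_le_sum (by simp)

theorem wdist_self {u : V} : wdist H w u u = 0 := by
  simpa using wdist_le (w := w) (SimpleGraph.Walk.nil : H.Walk u u)

theorem wdist_mono (h : H ≤ H') (u v : V) : wdist H' w u v ≤ wdist H w u v := by
  refine le_iInf fun p => ?_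
  have hp : ∀ e ∈ p.edges, e ∈ H'.edgeSet := fun e he =>
    SimpleGraph.edgeSet_mono h (p.edges_subset_edgeSet he)
  have := wdist_le (w := w) (p.transfer H' hp)
  rwa [walkWeight_transfer] at this

theorem wdist_append_le {u v x : V} (p : H.Walk v x) :
    wdist H w u x ≤ wdist H w u v + (walkWeight w p : ℕ) := by
  by_cases h : wdist H w u v = ⊤
  · simp [h]
  · obtain ⟨q, -, hq⟩ := exists_walk_of_wdist_ne_top h
    rw [← hq, ← Nat.cast_add, ← walkWeight_append]
    exact wdist_le _

theorem wdist_adj_le {u v x : V} (h : H.Adj v x) :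
    wdist H w u x ≤ wdist H w u v + (w s(v, x) : ℕ) := by
  simpa using wdist_append_le (w := w) (u := u) (SimpleGraph.Walk.cons h .nil)

theorem exists_last_edge {u v : V} (h : wdist H w u v ≠ ⊤) (huv : v ≠ u) :
    ∃ x, H.Adj x v ∧ wdist H w u x + (w s(x, v) : ℕ) = wdist H w u v := by
  obtain ⟨p, -, hp⟩ := exists_walk_of_wdist_ne_top h
  obtain ⟨x, hx, q, hq⟩ : ∃ (x : V) (hx : H.Adj x v) (q : H.Walk u x),
      walkWeight w p = walkWeight w q + w s(x, v) := by
    cases hr : p.reverse with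
    | nil => exact absurd rfl huv
    | @cons _ x _ hvx q =>
      refine ⟨x, hvx.symm, q.reverse, ?_⟩
      rw [← walkWeight_reverse p, hr, walkWeight_cons, walkWeight_reverse, add_comm, Sym2.eq_swap]
  refine ⟨x, hx, le_antisymm ?_ (wdist_adj_le hx)⟩
  rw [← hp, hq, Nat.cast_add]
  gcongr
  exact wdist_le q

theorem wdist_le_card_mul [Fintype V] {M : ℕ} (hw : ∀ e ∈ H.edgeSet, w e ≤ M) {u v : V}
    (h : wdist H w u v ≠ ⊤) : wdist H w u v ≤ (Fintype.card V * M : ℕ) := by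
  obtain ⟨p, hp, hpw⟩ := exists_walk_of_wdist_ne_top h
  rw [← hpw, Nat.cast_le]
  exact (walkWeight_le_mul hw p).trans (Nat.mul_le_mul_right _ hp.length_lt.le)

/-- A walk that meets `S` and ends outside of `S` splits at its last vertex in `S`. -/
theorem exists_split_last (S : Set V) {x t : V} (p : H.Walk x t) (hx : ∃ y ∈ p.support, y ∈ S)
    (ht : t ∉ S) :
    ∃ (a : V) (q₁ : H.Walk x a) (q₂ : H.Walk a t), a ∈ S ∧ p = q₁.append q₂ ∧
      ∀ y ∈ q₂.support.tail, y ∉ S := by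
  induction p with
  | nil =>
    obtain ⟨y, hy, hyS⟩ := hx
    simp only [SimpleGraph.Walk.support_nil, List.mem_singleton] at hy
    exact absurd (hy ▸ hyS) ht
  | @cons u v _ h p ih =>
    by_cases hv : ∃ y ∈ p.support, y ∈ S
    · obtain ⟨a, q₁, q₂, ha, rfl, hq⟩ := ih hv ht
      exact ⟨a, .cons h q₁, q₂, ha, rfl, hq⟩
    · obtain ⟨y, hy, hyS⟩ := hx
      rw [SimpleGraph.Walk.support_cons, List.mem_cons] at hy
      rcases hy with rfl | hy
      · exact ⟨y, .nil, .cons h p, hyS, rfl, fun z hz hzS => hv ⟨z, by simpa using hz, hzS⟩⟩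
      · exact absurd ⟨y, hy, hyS⟩ hv

end Distances

/-! ## The shortest-path tree and replacement paths -/

namespace SourcedGraph

variable {n M : ℕ} (I : SourcedGraph n M)

/-- The distance from the source, with `0` for unreachable vertices. -/
noncomputable def treeDist (t : Fin n) : ℕ := (wdist I.graph I.weight I.source t).toNat

/-- `a` is an ancestor of `t` in the tree, or `t` itself. -/
def Below (a t : Fin n) : Prop := Relation.ReflTransGen (fun x y => I.tree y = some x) a t

variable {I}

theorem parentPath_unique {t : Fin n} {d d' : ℕ}
    (h : ParentPath I.graph I.weight I.tree I.source t d)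
    (h' : ParentPath I.graph I.weight I.tree I.source t d') : d = d' := by
  induction h generalizing d' with
  | root =>
    cases h' with
    | root => rfl
    | step h => simp [I.isTree.root] at h
  | step hp _ _ ih =>
    cases h' with
    | root => simp [I.isTree.root] at hp
    | step hp' _ h' =>
      obtain rfl := Option.some.inj (hp.symm.trans hp')
      rw [ih h']

/-- The parent path is unique, so removing its last edge leaves the parent path of `p`. Both paths
have shortest weight, which yields the additive relation between the distances. -/
theorem tree_spec {t p : Fin n} (h : I.tree t = some p) :
    I.graph.Adj p t ∧ I.graph.Reachable I.source p ∧ I.graph.Reachable I.source t ∧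
      I.treeDist t = I.treeDist p + I.weight s(p, t) := by
  have ht : I.graph.Reachable I.source t := by
    by_contra hc
    simp [I.isTree.unreachable t hc] at h
  obtain ⟨d, hd, hdw⟩ := I.isTree.reachable t ht
  cases hd with
  | root => simp [I.isTree.root] at h
  | @step _ y d hy hadj hd =>
    obtain rfl := Option.some.inj (hy.symm.trans h)
    have hyr : I.graph.Reachable I.source y := ht.trans hadj.symm.reachable
    obtain ⟨d', hd', hdw'⟩ := I.isTree.reachable y hyr
    obtain rfl := parentPath_unique hd hd'
    refine ⟨hadj, hyr, ht, ?_⟩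
    rw [treeDist, treeDist, ← hdw, ← hdw']
    rfl

theorem coe_treeDist {t : Fin n} (h : I.graph.Reachable I.source t) :
    ((I.treeDist t : ℕ) : ℕ∞) = wdist I.graph I.weight I.source t :=
  ENat.natCast_toNat (by simpa [wdist_eq_top_iff] using h)

theorem below_iff {a t : Fin n} : I.Below a t ↔ a = t ∨ ∃ p, I.tree t = some p ∧ I.Below a p := by
  rw [Below, Relation.ReflTransGen.cases_tail_iff]
  constructor
  · rintro (h | ⟨p, h, h'⟩)
    · exact .inl h.symm
    · exact .inr ⟨p, h', h⟩
  · rintro (h | ⟨p, h, h'⟩)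
    · exact .inl h.symm
    · exact .inr ⟨p, h', h⟩

theorem Below.refl (t : Fin n) : I.Below t t := Relation.ReflTransGen.refl

theorem Below.trans {a b c : Fin n} (h : I.Below a b) (h' : I.Below b c) : I.Below a c :=
  Relation.ReflTransGen.trans h h'

theorem Below.step {a p t : Fin n} (h : I.Below a p) (h' : I.tree t = some p) : I.Below a t :=
  Relation.ReflTransGen.tail h h'

theorem Below.of_ne {a p t : Fin n} (h : I.Below a t) (hne : a ≠ t) (hp : I.tree t = some p) :
    I.Below a p := by
  rcases below_iff.1 h with h | ⟨q, hq, h⟩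
  · exact absurd h hne
  · obtain rfl := Option.some.inj (hq.symm.trans hp)
    exact h

theorem Below.exists_parent {a t : Fin n} (h : I.Below a t) (hne : a ≠ t) :
    ∃ p, I.tree t = some p ∧ I.Below a p :=
  (below_iff.1 h).resolve_left hne

theorem weight_pos {x y : Fin n} (h : I.graph.Adj x y) : 1 ≤ I.weight s(x, y) :=
  I.one_le_weight _ ((I.graph.mem_edgeSet).2 h)

theorem Below.eq_or_lt {a t : Fin n} (h : I.Below a t) : a = t ∨ I.treeDist a < I.treeDist t := by
  induction h with
  | refl => exact .inl rfl
  | tail _ h ih =>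
    obtain ⟨hadj, -, -, hd⟩ := tree_spec h
    have := weight_pos hadj
    rcases ih with rfl | ih <;> right <;> omega

theorem Below.antisymm {a b : Fin n} (h : I.Below a b) (h' : I.Below b a) : a = b := by
  rcases h.eq_or_lt with h | h
  · exact h
  · rcases h'.eq_or_lt with h' | h'
    · exact h'.symm
    · omega

theorem not_below_parent {t p : Fin n} (h : I.tree t = some p) : ¬ I.Below t p := by
  intro h'
  have := h'.antisymm (Below.step (.refl p) h)
  subst this
  exact (tree_spec h).1.ne rfl

theorem Below.total {a b t : Fin n} (ha : I.Below a t) (hb : I.Below b t) :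
    I.Below a b ∨ I.Below b a := by
  induction ha with
  | refl => exact .inr hb
  | @tail p t ha hp ih =>
    rcases below_iff.1 hb with rfl | ⟨q, hq, hb⟩
    · exact .inl (Below.step ha hp)
    · obtain rfl := Option.some.inj (hp.symm.trans hq)
      exact ih hb

theorem exists_parent {t : Fin n} (h : I.graph.Reachable I.source t) (hne : t ≠ I.source) :
    ∃ p, I.tree t = some p := by
  obtain ⟨d, hd, -⟩ := I.isTree.reachable t h
  cases hd with
  | root => exact absurd rfl hne
  | step h => exact ⟨_, h⟩

theorem source_below {t : Fin n} (h : I.graph.Reachable I.source t) : I.Below I.source t := by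
  obtain ⟨d, hd, -⟩ := I.isTree.reachable t h
  clear h
  induction hd with
  | root => exact .refl _
  | step h _ _ ih => exact ih.step h

theorem ne_source_of_tree {t p : Fin n} (h : I.tree t = some p) : t ≠ I.source := by
  rintro rfl
  simp [I.isTree.root] at h

theorem treeDist_source : I.treeDist I.source = 0 := by
  simp [treeDist, wdist_self]

theorem Below.exists_walk {a t : Fin n} (h : I.Below a t) :
    ∃ p : I.graph.Walk a t, I.treeDist a + walkWeight I.weight p = I.treeDist t ∧
      ∀ y ∈ p.support, I.Below a y ∧ I.Below y t := by
  induction h with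
  | refl => exact ⟨.nil, by simp, by simp [Below.refl]⟩
  | @tail b c h hc ih =>
    obtain ⟨p, hp, hs⟩ := ih
    obtain ⟨hadj, -, -, hd⟩ := tree_spec hc
    refine ⟨p.append (.cons hadj .nil), ?_, ?_⟩
    · rw [walkWeight_append]
      simp
      omega
    · intro y hy
      rw [SimpleGraph.Walk.mem_support_append_iff] at hy
      rcases hy with hy | hy
      · exact ⟨(hs y hy).1, (hs y hy).2.step hc⟩
      · simp only [SimpleGraph.Walk.support_cons, SimpleGraph.Walk.support_nil, List.mem_cons,
          List.not_mem_nil, or_false] at hy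
        rcases hy with rfl | rfl
        · exact ⟨h, Below.step (.refl _) hc⟩
        · exact ⟨Below.step h hc, .refl _⟩

theorem treeDist_le_of_walk {a t : Fin n} (ha : I.graph.Reachable I.source a)
    (p : I.graph.Walk a t) : I.treeDist t ≤ I.treeDist a + walkWeight I.weight p := by
  have := wdist_append_le (w := I.weight) (u := I.source) p
  rw [← coe_treeDist ha, ← coe_treeDist (ha.trans p.reachable)] at this
  exact_mod_cast this

/-- `H` arises from the failure of the vertex `v`, or of the tree edge above it. -/
def IsFailure (I : SourcedGraph n M) (v : Fin n) (H : SimpleGraph (Fin n)) : Prop :=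
  (∀ x y, H.Adj x y ↔ I.graph.Adj x y ∧ ¬ (x = v ∧ I.tree v = some y) ∧
    ¬ (y = v ∧ I.tree v = some x)) ∨
  (∀ x y, H.Adj x y ↔ I.graph.Adj x y ∧ x ≠ v ∧ y ≠ v)

/-! ### Distances after a failure -/

section Failure

variable {v : Fin n} {H : SimpleGraph (Fin n)}

theorem IsFailure.le (hF : I.IsFailure v H) : H ≤ I.graph := by
  intro x y h
  rcases hF with hF | hF <;> exact ((hF x y).1 h).1

theorem IsFailure.adj_of_ne (hF : I.IsFailure v H) {x y : Fin n} (h : I.graph.Adj x y)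
    (hx : x ≠ v) (hy : y ≠ v) : H.Adj x y := by
  rcases hF with hF | hF
  · exact (hF x y).2 ⟨h, fun h => hx h.1, fun h => hy h.1⟩
  · exact (hF x y).2 ⟨h, hx, hy⟩

theorem IsFailure.exists_walk (hF : I.IsFailure v H) {x y : Fin n} (p : I.graph.Walk x y)
    (hv : v ∉ p.support) : ∃ q : H.Walk x y, walkWeight I.weight q = walkWeight I.weight p := by
  have h : ∀ e ∈ p.edges, e ∈ H.edgeSet := by
    intro e he
    induction e with
    | _ a b =>
      refine hF.adj_of_ne (p.adj_of_mem_edges he) ?_ ?_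
      · rintro rfl
        exact hv (p.fst_mem_support_of_mem_edges he)
      · rintro rfl
        exact hv (p.snd_mem_support_of_mem_edges he)
  exact ⟨p.transfer H h, walkWeight_transfer p h⟩

theorem IsFailure.wdist_le_add (hF : I.IsFailure v H) {x y : Fin n} (p : I.graph.Walk x y)
    (hv : v ∉ p.support) :
    wdist H I.weight I.source y ≤ wdist H I.weight I.source x + (walkWeight I.weight p : ℕ) := by
  obtain ⟨q, hq⟩ := hF.exists_walk p hv
  rw [← hq]
  exact wdist_append_le q

/-- The distance to a vertex that is not below the failure does not change. -/
theorem IsFailure.wdist_of_not_below (hF : I.IsFailure v H) {t : Fin n} (h : ¬ I.Below v t)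
    (ht : I.graph.Reachable I.source t) :
    wdist H I.weight I.source t = (I.treeDist t : ℕ) := by
  refine le_antisymm ?_ ?_
  · obtain ⟨p, hp, hs⟩ := (source_below ht).exists_walk
    have := hF.wdist_le_add p fun hv => h (hs v hv).2
    rw [treeDist_source, zero_add] at hp
    rwa [wdist_self, zero_add, hp] at this
  · rw [coe_treeDist ht]
    exact wdist_mono hF.le _ _

/-- An edge failure removes only the tree edge above `v`. A vertex failure removes further tree
edges, but those lead from `v` to its children, and `v` is then isolated. The second alternative is
harmless because it makes the distance of `b` infinite. -/
theorem IsFailure.adj_child (hF : I.IsFailure v H) {b c : Fin n} (hc : I.tree c = some b)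
    (hcv : c ≠ v) : H.Adj b c ∨ b = v ∧ ∀ x, ¬ H.Adj x v := by
  have hadj := (tree_spec hc).1
  rcases hF with hF | hF
  · refine .inl ((hF b c).2 ⟨hadj, ?_, fun h => hcv h.1⟩)
    rintro ⟨rfl, h⟩
    have h1 := Below.step (.refl _) h
    have h2 := Below.step (.refl _) hc
    exact hcv (h1.antisymm h2)
  · by_cases hb : b = v
    · exact .inr ⟨hb, fun x h => ((hF x v).1 h).2.2 rfl⟩
    · exact .inl ((hF b c).2 ⟨hadj, hb, hcv⟩)

theorem wdist_eq_top_of_isolated (hs : v ≠ I.source) (h : ∀ x, ¬ H.Adj x v) :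
    wdist H I.weight I.source v = ⊤ := by
  by_contra hc
  obtain ⟨x, hx, -⟩ := exists_last_edge hc hs
  exact h x hx

/-- Below the failure, tree paths survive. -/
theorem IsFailure.wdist_descend (hF : I.IsFailure v H) (hs : v ≠ I.source) {a t : Fin n}
    (hva : I.Below v a) (hat : I.Below a t) :
    wdist H I.weight I.source t + (I.treeDist a : ℕ) ≤
      wdist H I.weight I.source a + (I.treeDist t : ℕ) := by
  induction hat with
  | refl => exact le_rfl
  | @tail b c hab hc ih =>
    have hcv : c ≠ v := by
      rintro rfl
      exact not_below_parent hc (hva.trans hab)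
    have hd := (tree_spec hc).2.2.2
    by_cases htop : wdist H I.weight I.source a = ⊤
    · simp [htop]
    have hb : wdist H I.weight I.source b ≠ ⊤ := by
      intro hb
      rw [hb, top_add, top_le_iff] at ih
      exact (WithTop.add_ne_top.2 ⟨htop, ENat.natCast_ne_top _⟩) ih
    rcases hF.adj_child hc hcv with hadj | ⟨rfl, hiso⟩
    · calc wdist H I.weight I.source c + (I.treeDist a : ℕ)
          ≤ wdist H I.weight I.source b + (I.weight s(b, c) : ℕ) + (I.treeDist a : ℕ) := by
            gcongr; exact wdist_adj_le hadj
        _ = wdist H I.weight I.source b + (I.treeDist a : ℕ) + (I.weight s(b, c) : ℕ) :=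
            add_right_comm _ _ _
        _ ≤ wdist H I.weight I.source a + (I.treeDist b : ℕ) + (I.weight s(b, c) : ℕ) := by
            gcongr
        _ = _ := by rw [hd, Nat.cast_add, add_assoc]
    · exact absurd (wdist_eq_top_of_isolated hs hiso) hb

end Failure

/-- After the failure, `t` is strictly closer than its tree parent admits. -/
structure Exceptional (I : SourcedGraph n M) (H : SimpleGraph (Fin n)) (v t : Fin n) : Prop where
  below : I.Below v t
  ne : v ≠ t
  lt : ∀ p, I.tree t = some p → wdist H I.weight I.source t <
    wdist H I.weight I.source p + (I.weight s(p, t) : ℕ)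

/-! ### Exceptional vertices and their detours -/

section Exceptional

variable {v t p : Fin n} {H : SimpleGraph (Fin n)}

theorem Exceptional.ne_top (hE : I.Exceptional H v t) : wdist H I.weight I.source t ≠ ⊤ := by
  obtain ⟨p, hp, -⟩ := hE.below.exists_parent hE.ne
  exact (lt_of_lt_of_le (hE.lt p hp) le_top).ne

/-- The replacement path of an exceptional vertex avoids the tree path below the failure. -/
theorem Exceptional.notMem_support (hE : I.Exceptional H v t) (hF : I.IsFailure v H)
    (hs : v ≠ I.source) (hp : I.tree t = some p) (R : H.Walk I.source t)
    (hR : ((walkWeight I.weight R : ℕ) : ℕ∞) = wdist H I.weight I.source t) {y : Fin n}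
    (hvy : I.Below v y) (hyp : I.Below y p) : y ∉ R.support := by
  classical
  intro hy
  have hsplit : walkWeight I.weight R =
      walkWeight I.weight (R.takeUntil y hy) + walkWeight I.weight (R.dropUntil y hy) := by
    rw [← walkWeight_append, R.take_spec]
  have h1 : wdist H I.weight I.source y ≤ _ := wdist_le (R.takeUntil y hy)
  have hyr : I.graph.Reachable I.source y :=
    ((R.takeUntil y hy).mapLe hF.le).reachable
  have h2 := treeDist_le_of_walk hyr ((R.dropUntil y hy).mapLe hF.le)
  have h3 : walkWeight I.weight ((R.dropUntil y hy).mapLe hF.le) =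
      walkWeight I.weight (R.dropUntil y hy) := by
    simp [walkWeight]
  -- If `y` were on the path, its part behind `y` would weigh at least d(t) - d(y). The surviving
  -- tree path from `y` to `p`, extended by the tree edge, has exactly this weight, so `t` would not
  -- be exceptional.
  have h4 := hF.wdist_descend hs hvy hyp
  have h5 := hE.lt p hp
  have h6 := (tree_spec hp).2.2.2
  have hpt : wdist H I.weight I.source p ≠ ⊤ := by
    intro hc
    rw [hc, top_add, top_le_iff] at h4
    refine WithTop.add_ne_top.2 ⟨?_, ENat.natCast_ne_top _⟩ h4
    exact (lt_of_le_of_lt h1 (ENat.natCast_lt_top _)).ne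
  have hyt : wdist H I.weight I.source y ≠ ⊤ := (lt_of_le_of_lt h1 (ENat.natCast_lt_top _)).ne
  rw [h3] at h2
  rw [← hR] at h5
  lift wdist H I.weight I.source p to ℕ using hpt with dp
  lift wdist H I.weight I.source y to ℕ using hyt with dy
  norm_cast at h1 h4 h5
  omega

/-- The last edge of a replacement path for an exceptional vertex remains available when the failure
moves down. -/
theorem Exceptional.transfer (hE : I.Exceptional H v t) (hF : I.IsFailure v H)
    (hs : v ≠ I.source) (hp : I.tree t = some p) {v' : Fin n} {H' : SimpleGraph (Fin n)}
    (hF' : I.IsFailure v' H') (hvv' : I.Below v v') (hv'p : I.Below v' p) {x : Fin n}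
    (hx : H.Adj x t)
    (hd : wdist H I.weight I.source x + (I.weight s(x, t) : ℕ) = wdist H I.weight I.source t) :
    H'.Adj x t ∧ wdist H' I.weight I.source x ≤ wdist H I.weight I.source x := by
  have hxt : wdist H I.weight I.source x ≠ ⊤ := by
    intro hc
    rw [hc, top_add] at hd
    exact hE.ne_top hd.symm
  obtain ⟨R, -, hR⟩ := exists_walk_of_wdist_ne_top hxt
  have hRx := hE.notMem_support hF hs hp (R.append (.cons hx .nil)) (by
    rw [walkWeight_append, ← hd, ← hR]; simp) hvv' hv'p
  have htv : t ≠ v' := by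
    rintro rfl
    exact not_below_parent hp hv'p
  rw [SimpleGraph.Walk.mem_support_append_iff, not_or] at hRx
  have hxv : x ≠ v' := by
    rintro rfl
    exact hRx.1 R.end_mem_support
  refine ⟨hF'.adj_of_ne (hF.le hx) hxv htv, ?_⟩
  have hm : walkWeight I.weight (R.mapLe hF.le) = walkWeight I.weight R := by
    simp [walkWeight]
  have := hF'.wdist_le_add (R.mapLe hF.le) (by simpa using hRx.1)
  rwa [wdist_self, zero_add, hm, hR] at this

/-- The old replacement path avoids the lower failure as well. Hence distances cannot increase from
a logged failure to a lower one. -/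
theorem Exceptional.wdist_le (hE : I.Exceptional H v t) (hF : I.IsFailure v H)
    (hs : v ≠ I.source) (hp : I.tree t = some p) {v' : Fin n} {H' : SimpleGraph (Fin n)}
    (hF' : I.IsFailure v' H') (hvv' : I.Below v v') (hv'p : I.Below v' p) :
    wdist H' I.weight I.source t ≤ wdist H I.weight I.source t := by
  obtain ⟨x, hx, hd⟩ := exists_last_edge hE.ne_top (ne_source_of_tree hp)
  obtain ⟨hadj, hle⟩ := hE.transfer hF hs hp hF' hvv' hv'p hx hd
  rw [← hd]
  exact (wdist_adj_le hadj).trans (by gcongr)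

/-- The part of a replacement path behind its last vertex on the tree path to `p`. -/
structure Detour (I : SourcedGraph n M) (H : SimpleGraph (Fin n)) (v t p a : Fin n)
    (Q : I.graph.Walk a t) : Prop where
  below : I.Below a v
  ne : a ≠ v
  isPath : Q.IsPath
  avoid : ∀ y ∈ Q.support.tail, ¬ I.Below y p
  weight : ((I.treeDist a + walkWeight I.weight Q : ℕ) : ℕ∞) = wdist H I.weight I.source t

/-- Split the replacement path at its last vertex `a` on the tree path to `p`. By
`Exceptional.notMem_support` this vertex lies strictly above `v`, so its distance is unaffected by
the failure and the part before it weighs d(a). -/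
theorem Exceptional.exists_detour (hE : I.Exceptional H v t) (hF : I.IsFailure v H)
    (hs : v ≠ I.source) (hp : I.tree t = some p) :
    ∃ (a : Fin n) (Q : I.graph.Walk a t), I.Detour H v t p a Q := by
  obtain ⟨R, hRp, hR⟩ := exists_walk_of_wdist_ne_top hE.ne_top
  have hspec := tree_spec hp
  have htS : t ∉ {y | I.Below y p} := not_below_parent hp
  obtain ⟨a, R₁, R₂, ha, rfl, hav⟩ := exists_split_last {y | I.Below y p} R
    ⟨_, R.start_mem_support, source_below hspec.2.1⟩ htS
  have hva : ¬ I.Below v a := fun h =>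
    hE.notMem_support hF hs hp _ hR h ha (by simp [SimpleGraph.Walk.mem_support_append_iff])
  have hvp : I.Below v p := hE.below.of_ne hE.ne hp
  have hne : a ≠ v := by
    rintro rfl
    exact hva (.refl _)
  have hm (x y : Fin n) (W : H.Walk x y) :
      walkWeight I.weight (W.mapLe hF.le) = walkWeight I.weight W := by
    simp [walkWeight]
  have har : I.graph.Reachable I.source a := (R₁.mapLe hF.le).reachable
  have hav' : v ∉ R₂.support := by
    rw [← R₂.cons_tail_support, List.mem_cons, not_or]
    exact ⟨hne.symm, fun h => hav v h hvp⟩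
  refine ⟨a, R₂.mapLe hF.le, (ha.total hvp).resolve_right hva, hne, ?_, by simpa using hav, ?_⟩
  · rw [SimpleGraph.Walk.isPath_mapLe]
    exact hRp.of_append_right
  · have h1 := hF.wdist_le_add (R₂.mapLe hF.le) (by simpa using hav')
    have h2 := treeDist_le_of_walk SimpleGraph.Reachable.rfl (R₁.mapLe hF.le)
    rw [hF.wdist_of_not_below hva har] at h1
    rw [walkWeight_append] at hR
    rw [hm, treeDist_source] at h2
    rw [hm, ← hR] at h1
    rw [hm, ← hR]
    norm_cast at h1 ⊢
    omega

theorem Detour.notMem_support {a : Fin n} {Q : I.graph.Walk a t} (hD : I.Detour H v t p a Q)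
    {y : Fin n} (hy : I.Below y p) (hya : y ≠ a) : y ∉ Q.support := by
  rw [← Q.cons_tail_support, List.mem_cons, not_or]
  exact ⟨hya, fun h => hD.avoid y h hy⟩

/-- Detours for failures at different places meet only far from where they begin. -/
theorem Detour.lt_of_meet (hp : I.tree t = some p)
    (hE : I.Exceptional H v t) (hF : I.IsFailure v H) (hs : v ≠ I.source)
    {a : Fin n} {Q : I.graph.Walk a t} (hD : I.Detour H v t p a Q)
    {v' : Fin n} {H' : SimpleGraph (Fin n)} (hF' : I.IsFailure v' H')
    (hv' : I.Below v' p) {a' : Fin n}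
    {Q' : I.graph.Walk a' t} (hD' : I.Detour H' v' t p a' Q') (hva : I.Below v a') (hne : a' ≠ v)
    {z : Fin n} {P₁ : I.graph.Walk a z} {P₂ : I.graph.Walk z t} (hQ : Q = P₁.append P₂)
    {P₁' : I.graph.Walk a' z} {P₂' : I.graph.Walk z t} (hQ' : Q' = P₁'.append P₂')
    (hz : ¬ I.Below z p) :
    wdist H' I.weight I.source t < (2 * walkWeight I.weight P₁' + I.treeDist t : ℕ) := by
  have hvp : I.Below v p := hE.below.of_ne hE.ne hp
  have hpr := (tree_spec hp).2.1
  have hw := (tree_spec hp).2.2.2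
  have har : ∀ {b c : Fin n}, I.Below b c → I.graph.Reachable I.source c →
      I.graph.Reachable I.source b := fun h hc => hc.trans h.exists_walk.choose.reachable.symm
  have hmem₁ : ∀ y ∈ P₁.support, y ∈ Q.support := fun y hy => by
    rw [hQ, SimpleGraph.Walk.mem_support_append_iff]; exact .inl hy
  have hmem₁' : ∀ y ∈ P₁'.support, y ∈ Q'.support := fun y hy => by
    rw [hQ', SimpleGraph.Walk.mem_support_append_iff]; exact .inl hy
  have hmem₂ : ∀ y ∈ P₂.support, ¬ I.Below y p := fun y hy => by
    rw [← P₂.cons_tail_support, List.mem_cons] at hy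
    rcases hy with rfl | hy
    · exact hz
    · refine hD.avoid y ?_
      rw [hQ, SimpleGraph.Walk.tail_support_append, List.mem_append]
      exact .inr hy
  have ha'v' : a' ≠ v' := hD'.ne
  have hnot' : ¬ I.Below v' a' := fun h => ha'v' (hD'.below.antisymm h)
  have hnot : ¬ I.Below v a := fun h => hD.ne (hD.below.antisymm h)
  -- first inequality: continue along the other detour
  have h1 := hF'.wdist_le_add (P₁'.append P₂) (by
    rw [SimpleGraph.Walk.mem_support_append_iff, not_or]
    exact ⟨fun h => hD'.notMem_support hv' ha'v'.symm (hmem₁' _ h), fun h => hmem₂ _ h hv'⟩)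
  rw [hF'.wdist_of_not_below hnot' (har (hD'.below.trans hv') hpr), walkWeight_append] at h1
  -- second inequality: return to the tree path
  have h2 := hF.wdist_le_add (P₁.append P₁'.reverse) (by
    rw [SimpleGraph.Walk.mem_support_append_iff, not_or, SimpleGraph.Walk.support_reverse,
      List.mem_reverse]
    exact ⟨fun h => hD.notMem_support hvp hD.ne.symm (hmem₁ _ h),
      fun h => hD'.notMem_support hvp hne.symm (hmem₁' _ h)⟩)
  rw [hF.wdist_of_not_below hnot (har (hD.below.trans hvp) hpr), walkWeight_append,
    walkWeight_reverse] at h2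
  have h3 := hF.wdist_descend hs hva (hD'.below.trans hv')
  have h4 := hE.lt p hp
  have h5 := hD.weight
  rw [hQ, walkWeight_append] at h5
  rw [← h5] at h4
  have hat : wdist H I.weight I.source a' ≠ ⊤ :=
    (lt_of_le_of_lt h2 (by exact_mod_cast ENat.natCast_lt_top _)).ne
  have hpt : wdist H I.weight I.source p ≠ ⊤ := by
    intro hc
    rw [hc, top_add, top_le_iff] at h3
    exact WithTop.add_ne_top.2 ⟨hat, ENat.natCast_ne_top _⟩ h3
  -- Returning along the later detour and descending the tree bounds the distance of `p`. Since `t`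
  -- is exceptional, this gives w(P₂) < w(P₁') + d(t) - d(a'). Inserting this into `h1` cancels
  -- d(a').
  refine lt_of_le_of_lt h1 ?_
  lift wdist H I.weight I.source p to ℕ using hpt with dp
  lift wdist H I.weight I.source a' to ℕ using hat with da
  norm_cast at h2 h3 h4 ⊢
  omega

end Exceptional

end SourcedGraph

/-! ## The number of exceptional failures per vertex -/

namespace SourcedGraph

variable {n M : ℕ} {I : SourcedGraph n M}

theorem exists_append_getVert {V : Type*} {G : SimpleGraph V} {a t : V} (Q : G.Walk a t) (l : ℕ)
    {z : V} (hz : Q.getVert l = z) :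
    ∃ (P₁ : G.Walk a z) (P₂ : G.Walk z t), Q = P₁.append P₂ ∧ P₁.length ≤ l := by
  subst hz
  exact ⟨Q.take l, Q.drop l, (Q.append_take_drop_eq l).symm, by simp⟩

/-- Only the starting vertex of a detour lies on the tree path to `p`; a path does not return to it,
so the steps of positive index stay away. -/
theorem Detour.getVert_not_below {H : SimpleGraph (Fin n)} {v t p a : Fin n}
    {Q : I.graph.Walk a t} (hD : I.Detour H v t p a Q) {l : ℕ} (hl : 0 < l) (hl' : l ≤ Q.length) :
    ¬ I.Below (Q.getVert l) p := by
  refine hD.avoid _ ?_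
  have h : Q.getVert l ∈ Q.support := Q.getVert_mem_support l
  rw [← Q.cons_tail_support, List.mem_cons] at h
  refine h.resolve_left fun h => ?_
  have := hD.isPath.getVert_injOn (x₁ := l) (x₂ := 0) hl' (Nat.zero_le _) (by simpa using h)
  omega

/-- A detour begins below every earlier failure that it does not improve upon. -/
theorem Detour.below_of_lt {H : SimpleGraph (Fin n)} {v t p a : Fin n} {Q : I.graph.Walk a t}
    (hD : I.Detour H v t p a Q) (hp : I.tree t = some p) (hvp : I.Below v p)
    {v' : Fin n} {H' : SimpleGraph (Fin n)} (hF' : I.IsFailure v' H') (hv'p : I.Below v' p)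
    (hlt : wdist H I.weight I.source t < wdist H' I.weight I.source t) : I.Below v' a := by
  -- If `a` were not below `v'`, the tree path to `a` followed by the detour would survive the
  -- failure at `v'`, contradicting the strict inequality.
  by_contra hc
  refine absurd hlt (not_lt.2 ?_)
  have hap := hD.below.trans hvp
  have har : I.graph.Reachable I.source a :=
    (tree_spec hp).2.1.trans hap.exists_walk.choose.reachable.symm
  have := hF'.wdist_le_add Q (hD.notMem_support hv'p (by rintro rfl; exact hc (.refl _)))
  rw [hF'.wdist_of_not_below hc har] at this
  rw [← hD.weight]
  exact_mod_cast this

/-- A packing argument: many long detours with pairwise disjoint beginnings must fit into `n`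
vertices. The bound `k ≤ n` holds because the failures are distinct. -/
theorem exceptional_chain_bound (hM : 1 ≤ M) {t p : Fin n} (hp : I.tree t = some p)
    {H : Fin n → SimpleGraph (Fin n)} {k : ℕ} {v : Fin k → Fin n}
    (hF : ∀ i, I.IsFailure (v i) (H (v i))) (hs : ∀ i, v i ≠ I.source)
    (hE : ∀ i, I.Exceptional (H (v i)) (v i) t)
    (hbelow : ∀ i j, i < j → I.Below (v i) (v j) ∧ v i ≠ v j)
    (hlt : ∀ i j, i < j → wdist (H (v j)) I.weight I.source t <
      wdist (H (v i)) I.weight I.source t) :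
    k ≤ n ∧ k * k ≤ 64 * (M * n) := by
  have hkn : k ≤ n := by
    have hinj : Function.Injective v := by
      intro i j hij
      by_contra hne
      rcases lt_or_gt_of_ne hne with h | h
      · exact (hbelow i j h).2 hij
      · exact (hbelow j i h).2 hij.symm
    simpa using Fintype.card_le_of_injective v hinj
  refine ⟨hkn, ?_⟩
  have hvp : ∀ i, I.Below (v i) p := fun i => (hE i).below.of_ne (hE i).ne hp
  have htr := (tree_spec hp).2.2.1
  -- the distances decrease by at least one in each step
  obtain ⟨D, hD⟩ : ∃ D : Fin k → ℕ, ∀ i, wdist (H (v i)) I.weight I.source t = (D i : ℕ) :=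
    ⟨fun i => (wdist (H (v i)) I.weight I.source t).toNat,
      fun i => (ENat.natCast_toNat (hE i).ne_top).symm⟩
  have hDlt : ∀ i j, i < j → D j < D i := fun i j h => by
    have := hlt i j h
    rw [hD, hD] at this
    exact_mod_cast this
  have hD0 : ∀ i, I.treeDist t ≤ D i := fun i => by
    have := wdist_mono (w := I.weight) (hF i).le I.source t
    rw [← coe_treeDist htr, hD] at this
    exact_mod_cast this
  -- Counting from the end of the chain, each of the `m` strict decreases contributes at least one.
  have hDge : ∀ (m : ℕ) (i : Fin k), i + m + 1 = k → I.treeDist t + m ≤ D i := by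
    intro m
    induction m with
    | zero => exact fun i _ => hD0 i
    | succ m ih =>
      intro i hi
      have h1 := ih ⟨i + 1, by omega⟩ (by simp; omega)
      have h2 := hDlt i ⟨i + 1, by omega⟩ (by simp [Fin.lt_def])
      omega
  choose a Q hQ using fun i => (hE i).exists_detour (hF i) (hs i) hp
  have hwt : ∀ i, I.treeDist (a i) + walkWeight I.weight (Q i) = D i := fun i => by
    have := (hQ i).weight
    rw [hD] at this
    exact_mod_cast this
  have had : ∀ i, I.treeDist (a i) ≤ I.treeDist t := fun i => by
    rcases (((hQ i).below.trans (hvp i)).step hp).eq_or_lt with h | h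
    · rw [h]
    · exact h.le
  have hML : 4 * (M * (k / (4 * M))) ≤ k := by
    have := Nat.mul_div_le k (4 * M)
    rwa [mul_assoc] at this
  -- In the first half the detour weighs at least `k - 1 - i`, more than `k / 2`, whereas fewer than
  -- `k / (4 * M)` edges would weigh at most `k / 4`.
  have hlen : ∀ i : Fin k, 2 * i + 4 ≤ k → k / (4 * M) ≤ (Q i).length := by
    intro i hi
    have h1 := hDge (k - 1 - i) i (by omega)
    have h2 := hwt i
    have h3 := had i
    have h4 : walkWeight I.weight (Q i) ≤ (Q i).length * M := walkWeight_le_mul I.weight_le (Q i)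
    by_contra hc
    push Not at hc
    have h5 : (Q i).length * M ≤ M * (k / (4 * M)) := by
      rw [mul_comm]
      exact Nat.mul_le_mul_left _ hc.le
    omega
  have hidx : ∀ r : Fin (k / 4), 2 * r.1 < k := fun r => by omega
  -- Only even indices in the first half are used, so that between any two of them another failure
  -- remains. The shift by one skips the starting vertex, which lies on the tree path.
  let f : Fin (k / 4) × Fin (k / (4 * M)) → Fin n := fun x =>
    (Q ⟨2 * x.1, hidx x.1⟩).getVert (x.2 + 1)
  have hcross : ∀ (r r' : Fin (k / 4)) (l l' : Fin (k / (4 * M))), r < r' →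
      f (r, l) ≠ f (r', l') := by
    intro r r' l l' hr heq
    set i : Fin k := ⟨2 * r, hidx r⟩ with hi
    set j : Fin k := ⟨2 * r', hidx r'⟩ with hj
    -- The failure just before `j` separates the two detours: the detour of `j` starts below it,
    -- since it is strictly better there, and therefore strictly below the failure `i`.
    set j' : Fin k := ⟨2 * r' - 1, by omega⟩ with hj'
    have hr' : r.1 < r'.1 := hr
    have hij' : i < j' := by simp only [hi, hj', Fin.mk_lt_mk]; omega
    have hj'j : j' < j := by simp only [hj, hj', Fin.mk_lt_mk]; omega
    have hba : I.Below (v j') (a j) :=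
      (hQ j).below_of_lt hp (hvp j) (hF j') (hvp j') (hlt _ _ hj'j)
    have hne : a j ≠ v i := by
      rintro h
      rw [h] at hba
      exact (hbelow _ _ hij').2 ((hbelow _ _ hij').1.antisymm hba)
    have hl' : l'.1 + 1 ≤ (Q j).length :=
      (Nat.succ_le_of_lt l'.2).trans (hlen j (by simp only [hj]; omega))
    obtain ⟨P₁, P₂, hP, -⟩ := exists_append_getVert (Q i) (l + 1) heq
    obtain ⟨P₁', P₂', hP', hlenP⟩ := exists_append_getVert (Q j) (l' + 1) (z := f (r', l')) rfl
    have key := (hQ i).lt_of_meet hp (hE i) (hF i) (hs i) (hF j) (hvp j) (hQ j)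
      ((hbelow _ _ hij').1.trans hba) hne hP hP' ((hQ j).getVert_not_below (Nat.succ_pos _) hl')
    rw [hD, Nat.cast_lt] at key
    have h1 := hDge (k - 1 - j) j (by omega)
    have h2 : walkWeight I.weight P₁' ≤ P₁'.length * M := walkWeight_le_mul I.weight_le P₁'
    have h3 : P₁'.length * M ≤ M * (k / (4 * M)) := by
      rw [mul_comm]
      exact Nat.mul_le_mul_left _ (hlenP.trans (Nat.succ_le_of_lt l'.2))
    -- The prefix weighs at most `k / 4`, so `key` gives D_j < d(t) + k/2, while `h1` gives D_j ≥
    -- d(t) + (k - 1 - j) with `j ≤ 2 * (k / 4) - 2`.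
    have h4 : j.1 = 2 * r' := rfl
    omega
  have hinj : Function.Injective f := by
    rintro ⟨r, l⟩ ⟨r', l'⟩ heq
    rcases lt_trichotomy r r' with h | rfl | h
    · exact absurd heq (hcross _ _ _ _ h)
    · have hle : ∀ l : Fin (k / (4 * M)), l.1 + 1 ≤ (Q ⟨2 * r, hidx r⟩).length := fun l =>
        (Nat.succ_le_of_lt l.2).trans (hlen ⟨2 * r, hidx r⟩ (by simp only; omega))
      have := (hQ ⟨2 * r, hidx r⟩).isPath.getVert_injOn (hle l) (hle l') heq
      rw [Prod.mk.injEq]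
      exact ⟨rfl, Fin.ext (by omega)⟩
    · exact absurd heq.symm (hcross _ _ _ _ h)
  have hcard : k / 4 * (k / (4 * M)) ≤ n := by
    simpa using Fintype.card_le_of_injective f hinj
  -- For small `k` the trivial bound `k ≤ n` suffices. Otherwise each of the rounded quotients loses
  -- at most a factor of two.
  by_cases h8 : k < 8 * M
  · calc k * k ≤ (8 * M) * n := Nat.mul_le_mul h8.le hkn
      _ ≤ 64 * (M * n) := by rw [mul_assoc]; exact Nat.mul_le_mul_right _ (by norm_num)
  · push Not at h8
    have h1 : k ≤ 8 * (k / 4) := by omega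
    have h2 : k ≤ 8 * (M * (k / (4 * M))) := by
      have h3 : 2 ≤ k / (4 * M) := by
        rw [Nat.le_div_iff_mul_le (by omega)]
        omega
      have h4 := Nat.lt_mul_div_succ k (show 0 < 4 * M by omega)
      nlinarith
    calc k * k ≤ (8 * (k / 4)) * (8 * (M * (k / (4 * M)))) := Nat.mul_le_mul h1 h2
      _ = 64 * (M * (k / 4 * (k / (4 * M)))) := by ring
      _ ≤ 64 * (M * n) := by gcongr

end SourcedGraph

/-! ## Reasoning about programs -/

/-- The contents of register `x`. -/
abbrev R (x : ℕ) : WordExpr := .reg x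

/-- The contents of the cell of array `a` at address `i`. -/
abbrev A (a : ℕ) (i : WordExpr) : WordExpr := .load a i

instance : Add WordExpr := ⟨.op .add⟩
instance : Sub WordExpr := ⟨.op .sub⟩
instance : Mul WordExpr := ⟨.op .mul⟩
instance (c : ℕ) : OfNat WordExpr c := ⟨.const c⟩

/-- Comparison of two expressions. -/
abbrev ltE (e₁ e₂ : WordExpr) : WordExpr := .op .lt e₁ e₂

/-- Equality test of two expressions. -/
abbrev eqE (e₁ e₂ : WordExpr) : WordExpr := .op .eq e₁ e₂

namespace WordExpr

variable {W : ℕ} {σ : WordState}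

@[simp] theorem eval_add (e₁ e₂ : WordExpr) :
    (e₁ + e₂).eval W σ = (e₁.eval W σ + e₂.eval W σ) % 2 ^ W := rfl
@[simp] theorem eval_sub (e₁ e₂ : WordExpr) :
    (e₁ - e₂).eval W σ = e₁.eval W σ - e₂.eval W σ := rfl
@[simp] theorem eval_mul (e₁ e₂ : WordExpr) :
    (e₁ * e₂).eval W σ = (e₁.eval W σ * e₂.eval W σ) % 2 ^ W := rfl
@[simp] theorem eval_lt (e₁ e₂ : WordExpr) :
    (op .lt e₁ e₂).eval W σ = if e₁.eval W σ < e₂.eval W σ then 1 else 0 := rfl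
@[simp] theorem eval_eq (e₁ e₂ : WordExpr) :
    (op .eq e₁ e₂).eval W σ = if e₁.eval W σ = e₂.eval W σ then 1 else 0 := rfl
@[simp] theorem eval_reg (x : ℕ) : (reg x).eval W σ = σ.reg x := rfl
@[simp] theorem eval_load (a : ℕ) (i : WordExpr) :
    (load a i).eval W σ = σ.mem a (i.eval W σ) := rfl
@[simp] theorem eval_zero : (0 : WordExpr).eval W σ = 0 := Nat.zero_mod _
theorem eval_one (h : 1 < 2 ^ W) : (1 : WordExpr).eval W σ = 1 := Nat.mod_eq_of_lt h

@[simp] theorem cost_add (e₁ e₂ : WordExpr) : (e₁ + e₂).cost = e₁.cost + e₂.cost + 1 := rfl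
@[simp] theorem cost_sub (e₁ e₂ : WordExpr) : (e₁ - e₂).cost = e₁.cost + e₂.cost + 1 := rfl
@[simp] theorem cost_mul (e₁ e₂ : WordExpr) : (e₁ * e₂).cost = e₁.cost + e₂.cost + 1 := rfl
@[simp] theorem cost_op (o : WordOp) (e₁ e₂ : WordExpr) :
    (op o e₁ e₂).cost = e₁.cost + e₂.cost + 1 := rfl
@[simp] theorem cost_reg (x : ℕ) : (reg x).cost = 1 := rfl
@[simp] theorem cost_load (a : ℕ) (i : WordExpr) : (load a i).cost = i.cost + 1 := rfl
@[simp] theorem cost_zero : (0 : WordExpr).cost = 1 := rfl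
@[simp] theorem cost_one : (1 : WordExpr).cost = 1 := rfl

end WordExpr

namespace WordState

@[simp] theorem setReg_reg (σ : WordState) (x v y : ℕ) :
    (σ.setReg x v).reg y = if y = x then v else σ.reg y := by
  simp [setReg, Function.update_apply]

@[simp] theorem setReg_mem (σ : WordState) (x v : ℕ) : (σ.setReg x v).mem = σ.mem := rfl

@[simp] theorem setMem_reg (σ : WordState) (a i v : ℕ) : (σ.setMem a i v).reg = σ.reg := rfl

@[simp] theorem setMem_mem (σ : WordState) (a i v b j : ℕ) :
    (σ.setMem a i v).mem b j = if b = a ∧ j = i then v else σ.mem b j := by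
  by_cases h : b = a
  · subst h; simp [setMem, Function.update_apply]
  · simp [setMem, h]

theorem setMem_mem_of_ne (σ : WordState) {a b : ℕ} (i v : ℕ) (h : b ≠ a) :
    (σ.setMem a i v).mem b = σ.mem b := by
  simp [setMem, h]

end WordState

namespace WordCmd

/-- The registers that a program may write. -/
def regs : WordCmd → List ℕ
  | skip => []
  | assign x _ => [x]
  | store _ _ _ => []
  | seq c₁ c₂ => c₁.regs ++ c₂.regs
  | branch _ c₁ c₂ => c₁.regs ++ c₂.regs
  | loop _ c => c.regs

/-- The arrays that a program may write. -/
def arrs : WordCmd → List ℕ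
  | skip => []
  | assign _ _ => []
  | store a _ _ => [a]
  | seq c₁ c₂ => c₁.arrs ++ c₂.arrs
  | branch _ c₁ c₂ => c₁.arrs ++ c₂.arrs
  | loop _ c => c.arrs

/-- Sequential composition of a list of programs. -/
def block : List WordCmd → WordCmd
  | [] => skip
  | c :: cs => seq c (block cs)

/-- Count register `i` up from `start` to the contents of register `lim`. -/
def forLoop (i : ℕ) (start : WordExpr) (lim : ℕ) (body : WordCmd) : WordCmd :=
  seq (assign i start) (loop (ltE (R i) (R lim)) (seq body (assign i (R i + 1))))

end WordCmd

open WordCmd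

/-- `τ` agrees with `σ` outside of the registers `rs` and the arrays `as`. -/
structure SameOutside (rs as : List ℕ) (σ τ : WordState) : Prop where
  reg : ∀ x, x ∉ rs → τ.reg x = σ.reg x
  mem : ∀ a, a ∉ as → τ.mem a = σ.mem a

theorem SameOutside.refl (rs as : List ℕ) (σ : WordState) : SameOutside rs as σ σ :=
  ⟨fun _ _ => rfl, fun _ _ => rfl⟩

theorem SameOutside.trans {rs as : List ℕ} {σ τ ρ : WordState} (h : SameOutside rs as σ τ)
    (h' : SameOutside rs as τ ρ) : SameOutside rs as σ ρ :=
  ⟨fun x hx => (h'.reg x hx).trans (h.reg x hx), fun a ha => (h'.mem a ha).trans (h.mem a ha)⟩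

theorem SameOutside.mono {rs rs' as as' : List ℕ} {σ τ : WordState} (h : SameOutside rs as σ τ)
    (hr : ∀ x ∈ rs, x ∈ rs') (ha : ∀ x ∈ as, x ∈ as') : SameOutside rs' as' σ τ :=
  ⟨fun x hx => h.reg x fun h => hx (hr x h), fun a hx => h.mem a fun h => hx (ha a h)⟩

/-- The frame rule: which cells may change is read off the program text. The side conditions on
registers and arrays then reduce to list membership, mostly settled by `decide`. -/
theorem WordRun.sameOutside {W : ℕ} {c : WordCmd} {σ τ : WordState} {T : ℕ}
    (h : WordRun W c σ τ T) : SameOutside c.regs c.arrs σ τ := by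
  induction h with
  | skip σ => exact .refl _ _ _
  | assign σ x e =>
    refine ⟨fun y hy => ?_, fun _ _ => rfl⟩
    simp [WordCmd.regs] at hy
    simp [hy]
  | store σ a i e =>
    refine ⟨fun _ _ => rfl, fun b hb => ?_⟩
    simp [WordCmd.arrs] at hb
    exact WordState.setMem_mem_of_ne _ _ _ hb
  | seq _ _ ih₁ ih₂ =>
    exact (ih₁.mono (by simp [WordCmd.regs]; tauto) (by simp [WordCmd.arrs]; tauto)).trans
      (ih₂.mono (by simp [WordCmd.regs]; tauto) (by simp [WordCmd.arrs]; tauto))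
  | branch_true _ _ ih =>
    exact ih.mono (by simp [WordCmd.regs]; tauto) (by simp [WordCmd.arrs]; tauto)
  | branch_false _ _ ih =>
    exact ih.mono (by simp [WordCmd.regs]; tauto) (by simp [WordCmd.arrs]; tauto)
  | loop_true _ _ _ ih₁ ih₂ => exact ih₁.trans ih₂
  | loop_false _ => exact .refl _ _ _

/-- Started in state `σ` at time `t`, the program halts in a state and at a time that satisfy `Q`. -/
def Wp (W : ℕ) (c : WordCmd) (σ : WordState) (t : ℕ) (Q : WordState → ℕ → Prop) : Prop :=
  ∃ τ T, WordRun W c σ τ T ∧ Q τ (t + T)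

section Wp

variable {W : ℕ} {c c₁ c₂ : WordCmd} {cs : List WordCmd} {σ : WordState} {t : ℕ}
  {Q Q' : WordState → ℕ → Prop}

theorem Wp.mono (h : Wp W c σ t Q) (hQ : ∀ τ t', Q τ t' → Q' τ t') : Wp W c σ t Q' := by
  obtain ⟨τ, T, hr, hq⟩ := h
  exact ⟨τ, T, hr, hQ _ _ hq⟩

theorem Wp.mono_frame (h : Wp W c σ t Q)
    (hQ : ∀ τ t', SameOutside c.regs c.arrs σ τ → Q τ t' → Q' τ t') : Wp W c σ t Q' := by
  obtain ⟨τ, T, hr, hq⟩ := h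
  exact ⟨τ, T, hr, hQ _ _ hr.sameOutside hq⟩

@[simp] theorem wp_skip : Wp W .skip σ t Q ↔ Q σ (t + 1) := by
  constructor
  · rintro ⟨_, _, ⟨⟩, h⟩; exact h
  · exact fun h => ⟨_, _, .skip σ, h⟩

@[simp] theorem wp_assign {x : ℕ} {e : WordExpr} :
    Wp W (.assign x e) σ t Q ↔ Q (σ.setReg x (e.eval W σ)) (t + (e.cost + 1)) := by
  constructor
  · rintro ⟨_, _, ⟨⟩, h⟩; exact h
  · exact fun h => ⟨_, _, .assign σ x e, h⟩

@[simp] theorem wp_store {a : ℕ} {i e : WordExpr} :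
    Wp W (.store a i e) σ t Q ↔
      Q (σ.setMem a (i.eval W σ) (e.eval W σ)) (t + (i.cost + e.cost + 1)) := by
  constructor
  · rintro ⟨_, _, ⟨⟩, h⟩; exact h
  · exact fun h => ⟨_, _, .store σ a i e, h⟩

@[simp] theorem wp_seq :
    Wp W (.seq c₁ c₂) σ t Q ↔ Wp W c₁ σ t fun τ t' => Wp W c₂ τ t' Q := by
  constructor
  · rintro ⟨_, _, h, hq⟩
    cases h with
    | seq h₁ h₂ => exact ⟨_, _, h₁, _, _, h₂, by rwa [add_assoc]⟩
  · rintro ⟨ρ, T₁, h₁, τ, T₂, h₂, h⟩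
    exact ⟨τ, T₁ + T₂, .seq h₁ h₂, by rwa [← add_assoc]⟩

@[simp] theorem wp_block_nil : Wp W (block []) σ t Q ↔ Q σ (t + 1) := wp_skip

@[simp] theorem wp_block_cons :
    Wp W (block (c :: cs)) σ t Q ↔ Wp W c σ t fun τ t' => Wp W (block cs) τ t' Q := wp_seq

@[simp] theorem wp_branch {e : WordExpr} :
    Wp W (.branch e c₁ c₂) σ t Q ↔ (e.eval W σ ≠ 0 → Wp W c₁ σ (t + (e.cost + 1)) Q) ∧
      (e.eval W σ = 0 → Wp W c₂ σ (t + (e.cost + 1)) Q) := by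
  constructor
  · rintro ⟨_, _, h, hq⟩
    cases h with
    | branch_true h₁ h₂ => exact ⟨fun _ => ⟨_, _, h₂, by rwa [add_assoc]⟩, fun h => absurd h h₁⟩
    | branch_false h₁ h₂ => exact ⟨fun h => absurd h₁ h, fun _ => ⟨_, _, h₂, by rwa [add_assoc]⟩⟩
  · rintro ⟨h₁, h₂⟩
    by_cases h : e.eval W σ = 0
    · obtain ⟨τ, T, hr, hq⟩ := h₂ h
      exact ⟨τ, _, .branch_false h hr, by rwa [← add_assoc]⟩
    · obtain ⟨τ, T, hr, hq⟩ := h₁ h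
      exact ⟨τ, _, .branch_true h hr, by rwa [← add_assoc]⟩

/-- The invariant includes the clock. Each iteration pays 4 steps for the test and 4 for the
increment, and the final failing test costs 4 more. The bound on `N` keeps the counter from wrapping
around. -/
theorem wp_forLoop {i : ℕ} {start : WordExpr} {lim : ℕ} {body : WordCmd} (a N : ℕ)
    (ha : start.eval W σ = a) (haN : a ≤ N) (hN : N < 2 ^ W) (hlim : σ.reg lim = N)
    (hi : i ∉ body.regs) (hl : lim ∉ i :: body.regs) (Inv : ℕ → WordState → ℕ → Prop)
    (h0 : Inv a (σ.setReg i a) (t + (start.cost + 1)))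
    (hstep : ∀ k τ t', a ≤ k → k < N → SameOutside (i :: body.regs) body.arrs σ τ →
      τ.reg i = k → τ.reg lim = N → Inv k τ t' →
      Wp W body τ (t' + 4) fun ρ t'' => Inv (k + 1) (ρ.setReg i (k + 1)) (t'' + 4))
    (hQ : ∀ τ t', SameOutside (i :: body.regs) body.arrs σ τ → τ.reg i = N → Inv N τ t' →
      Q τ (t' + 4)) :
    Wp W (forLoop i start lim body) σ t Q := by
  have hloop : ∀ (d k : ℕ) (τ : WordState) (t' : ℕ), k + d = N → a ≤ k →
      SameOutside (i :: body.regs) body.arrs σ τ → τ.reg i = k → Inv k τ t' →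
      Wp W (.loop (ltE (R i) (R lim)) (.seq body (.assign i (R i + 1)))) τ t' Q := by
    intro d
    induction d with
    | zero =>
      intro k τ t' hk _ hs hreg hinv
      obtain rfl : k = N := hk
      refine ⟨τ, _, .loop_false ?_, hQ τ t' hs hreg hinv⟩
      simp [hreg, hs.reg lim hl, hlim]
    | succ d ih =>
      intro k τ t' hk hak hs hreg hinv
      have hlimτ : τ.reg lim = N := (hs.reg lim hl).trans hlim
      obtain ⟨ρ, T₁, hr, hinv'⟩ := hstep k τ t' hak (by omega) hs hreg hlimτ hinv
      have hregρ : ρ.reg i = k := (hr.sameOutside.reg i hi).trans hreg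
      have hone : (1 : WordExpr).eval W ρ = 1 := WordExpr.eval_one (by omega)
      have hassign := WordRun.assign (W := W) ρ i (R i + 1)
      have heval : (R i + 1 : WordExpr).eval W ρ = k + 1 := by
        rw [WordExpr.eval_add, hone, WordExpr.eval_reg, hregρ]
        exact Nat.mod_eq_of_lt (by omega)
      rw [heval] at hassign
      have hs' : SameOutside (i :: body.regs) body.arrs σ (ρ.setReg i (k + 1)) := by
        refine (hs.trans (hr.sameOutside.mono (by simp +contextual) (by simp))).trans ⟨?_, ?_⟩
        · intro x hx
          simp only [List.mem_cons, not_or] at hx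
          simp [hx.1]
        · intro _ _; rfl
      obtain ⟨τ', T₂, hr', hq⟩ := ih (k + 1) _ _ (by omega) (by omega) hs' (by simp) hinv'
      refine ⟨τ', _, .loop_true (by simp [hreg, hlimτ]; omega) (.seq hr hassign) hr', ?_⟩
      have ht : t' + ((ltE (R i) (R lim)).cost + 1 + (T₁ + ((R i + 1 : WordExpr).cost + 1)) + T₂) =
          t' + 4 + T₁ + 4 + T₂ := by
        simp only [WordExpr.cost_op, WordExpr.cost_add, WordExpr.cost_reg, WordExpr.cost_one]
        omega
      rwa [ht]
  rw [forLoop, wp_seq, wp_assign, ha]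
  refine hloop (N - a) a _ _ (by omega) le_rfl ⟨?_, fun _ _ => rfl⟩ (by simp) h0
  intro x hx
  simp only [List.mem_cons, not_or] at hx
  simp [hx.1]

end Wp

/-! ## Preprocessing: adjacency arrays -/

/-- Append the arc from the vertex in register `a` to the vertex in register `b` to the adjacency
arrays. -/
def addArc (a b : ℕ) : WordCmd :=
  block [
    .assign 25 (R a * R 20 + A 15 (R a)),
    .store 16 (R 25) (R b),
    .store 17 (R 25) (R 24),
    .store 15 (R a) (A 15 (R a) + 1),
    .branch (eqE (A 3 (R a)) (R b + 1)) (.store 7 (R a) (R 24)) .skip]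

/-- Compute the adjacency arrays and the weights of the tree edges. -/
def buildAdjacency : WordCmd :=
  block [
    .assign 20 (R 1 + R 1),
    forLoop 21 0 1 (block [
      .assign 22 (A 0 (R 21)),
      .assign 23 (A 1 (R 21)),
      .assign 24 (A 2 (R 21)),
      addArc 22 23,
      addArc 23 22])]

namespace SourcedGraph

variable {n M : ℕ} {I : SourcedGraph n M}

/-- The adjacency arrays, with rows of length `S`, hold the arcs in `L`. -/
structure Adjacency (I : SourcedGraph n M) (S : ℕ) (L : List (Fin n × Fin n))
    (mem : ℕ → ℕ → ℕ) : Prop where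
  count : ∑ a : Fin n, mem 15 a = L.length
  sound : ∀ a : Fin n, ∀ j < mem 15 a, ∃ x : Fin n, mem 16 (a * S + j) = x ∧ I.graph.Adj x a ∧
    mem 17 (a * S + j) = I.weight s(x, a)
  complete : ∀ p ∈ L, ∃ j < mem 15 (p.1 : Fin n), mem 16 (p.1 * S + j) = (p.2 : Fin n)
  treeWeight : ∀ p ∈ L, I.tree p.1 = some p.2 → mem 7 (p.1 : Fin n) = I.weight s(p.2, p.1)

theorem Adjacency.mem_lt {S : ℕ} {L : List (Fin n × Fin n)} {mem : ℕ → ℕ → ℕ}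
    (h : I.Adjacency S L mem) (hS : L.length < S) (a : Fin n) : mem 15 a < S := by
  have := Finset.single_le_sum (f := fun a : Fin n => mem 15 a) (fun _ _ => Nat.zero_le _)
    (Finset.mem_univ a)
  have h := h.count
  omega

end SourcedGraph

theorem row_inj {S a b i j : ℕ} (hi : i < S) (hj : j < S) (h : a * S + i = b * S + j) :
    a = b ∧ i = j := by
  have ha : (a * S + i) / S = a := by
    rw [mul_comm, Nat.mul_add_div (by omega), Nat.div_eq_of_lt hi, add_zero]
  have hb : (b * S + j) / S = b := by
    rw [mul_comm, Nat.mul_add_div (by omega), Nat.div_eq_of_lt hj, add_zero]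
  have hab : a = b := by rw [← ha, h, hb]
  subst hab
  exact ⟨rfl, by omega⟩

theorem row_lt {n S : ℕ} {a : ℕ} (ha : a < n) {i : ℕ} (hi : i < S) : a * S + i < n * S := by
  calc a * S + i < a * S + S := by omega
    _ = (a + 1) * S := by ring
    _ ≤ n * S := Nat.mul_le_mul_right _ ha

namespace SourcedGraph

variable {n M : ℕ} {I : SourcedGraph n M}

theorem vertexCode_eq_succ {o : Option (Fin n)} {v : Fin n} :
    vertexCode o = v + 1 ↔ o = some v := by
  cases o with
  | none => simp [vertexCode]
  | some u => simp [vertexCode, Fin.ext_iff]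

/-- Rows have stride `S`, which exceeds the number of arcs inserted so far, so no row overflows into
the next. The sparse layout costs only addresses: the cells are discarded later and unused ones are
never initialized. -/
theorem wp_addArc {W S : ℕ} {L : List (Fin n × Fin n)} {σ : WordState} {t a b : ℕ}
    (hS : L.length < S) (hW : n * S < 2 ^ W) (hnW : n < 2 ^ W)
    {u v : Fin n} (hadj : I.graph.Adj v u)
    (ha : σ.reg a = u) (hb : σ.reg b = v) (ha' : a ≠ 25) (hb' : b ≠ 25) (h20 : σ.reg 20 = S)
    (h24 : σ.reg 24 = I.weight s(v, u)) (h3 : ∀ x : Fin n, σ.mem 3 x = vertexCode (I.tree x))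
    (hL : I.Adjacency S L σ.mem) :
    Wp W (addArc a b) σ t fun τ t' => I.Adjacency S ((u, v) :: L) τ.mem ∧ t' ≤ t + 40 := by
  have hc := hL.mem_lt hS u
  have hun := u.2
  have hvn := v.2
  have hidx := row_lt hun hc
  have hSn : S ≤ n * S := Nat.le_mul_of_pos_left _ (by omega)
  have h1 : (u * S % 2 ^ W + σ.mem 15 u) % 2 ^ W = u * S + σ.mem 15 u := by
    rw [Nat.mod_eq_of_lt (a := u * S) (by omega), Nat.mod_eq_of_lt (by omega)]
  have hone : ∀ ρ, (1 : WordExpr).eval W ρ = 1 := fun ρ => WordExpr.eval_one (by omega)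
  have h2 : (σ.mem 15 u + 1) % 2 ^ W = σ.mem 15 u + 1 := Nat.mod_eq_of_lt (by omega)
  have h3' : (v + 1) % 2 ^ W = (v + 1 : ℕ) := Nat.mod_eq_of_lt (by omega)
  have core : ∀ mem' : ℕ → ℕ → ℕ,
      (∀ x, mem' 15 x = if x = u then σ.mem 15 u + 1 else σ.mem 15 x) →
      (∀ x, mem' 16 x = if x = u * S + σ.mem 15 u then (v : ℕ) else σ.mem 16 x) →
      (∀ x, mem' 17 x = if x = u * S + σ.mem 15 u then I.weight s(v, u) else σ.mem 17 x) →
      (∀ x, x ≠ u → mem' 7 x = σ.mem 7 x) →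
      (I.tree u = some v → mem' 7 u = I.weight s(v, u)) →
      (I.tree u ≠ some v → mem' 7 u = σ.mem 7 u) →
      I.Adjacency S ((u, v) :: L) mem' := by
    intro mem' h15 h16 h17 h7 h7' h7''
    have hne : ∀ (a : Fin n) (j : ℕ), j < σ.mem 15 a → (a : ℕ) * S + j ≠ u * S + σ.mem 15 u := by
      intro a j hj heq
      have := row_inj (hj.trans (hL.mem_lt hS a)) hc heq
      rw [Fin.val_inj] at this
      obtain ⟨rfl, rfl⟩ := this
      omega
    constructor
    · rw [List.length_cons, ← hL.count,
        Finset.sum_congr rfl (g := fun x : Fin n => σ.mem 15 x + if x = u then 1 else 0),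
        Finset.sum_add_distrib, Finset.sum_ite_eq' Finset.univ u]
      · simp
      · intro x _
        rw [h15]
        by_cases h : x = u
        · simp [h]
        · simp [h, Fin.val_inj]
    · intro a j hj
      rw [h15] at hj
      rw [h16, h17]
      by_cases h : j < σ.mem 15 a
      · rw [if_neg (hne a j h), if_neg (hne a j h)]
        exact hL.sound a j h
      · by_cases hau : (a : ℕ) = u
        · rw [if_pos hau] at hj
          rw [hau] at h
          have : j = σ.mem 15 u := by omega
          rw [Fin.val_inj] at hau
          subst hau
          exact ⟨v, by simp [this], hadj, by simp [this]⟩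
        · rw [if_neg hau] at hj
          exact absurd hj h
    · intro p hp
      rw [List.mem_cons] at hp
      rcases hp with rfl | hp
      · exact ⟨σ.mem 15 u, by simp [h15], by simp [h16]⟩
      · obtain ⟨j, hj, hjp⟩ := hL.complete p hp
        refine ⟨j, ?_, by rw [h16, if_neg (hne p.1 j hj), hjp]⟩
        rw [h15]
        split_ifs with h
        · rw [h] at hj; omega
        · exact hj
    · intro p hp hpt
      by_cases hpu : p.1 = u
      · rcases List.mem_cons.1 hp with rfl | hp
        · exact h7' hpt
        · by_cases hut : I.tree u = some v
          · have : p.2 = v := by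
              rw [hpu, hut] at hpt
              exact (Option.some.inj hpt).symm
            rw [hpu, this]
            exact h7' hut
          · rw [hpu, h7'' hut, ← hpu]
            exact hL.treeWeight p hp hpt
      · rcases List.mem_cons.1 hp with rfl | hp
        · exact absurd rfl hpu
        · rw [h7 _ hpu]
          exact hL.treeWeight p hp hpt
  simp only [addArc, wp_block_cons, wp_block_nil, wp_assign, wp_store, wp_branch, wp_skip,
    WordExpr.eval_add, WordExpr.eval_mul, WordExpr.eval_reg, WordExpr.eval_load, WordExpr.eval_eq,
    WordState.setReg_reg, WordState.setMem_reg, WordState.setReg_mem, ha', hb', if_false, ha, hb,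
    h20, hone, h1, h24]
  refine ⟨fun h => ?_, fun h => ?_⟩
  · refine ⟨core _ ?_ ?_ ?_ ?_ ?_ ?_, by simp⟩ <;>
      simp [ha, hb, h20, h1, hone, h2, h3', h3, h24, ha', hb', vertexCode_eq_succ] at h ⊢
    · intro x hx h'; exact absurd (Fin.ext h') hx
    · intro h'; exact absurd h h'
  · refine ⟨core _ ?_ ?_ ?_ ?_ ?_ ?_, by simp⟩ <;>
      simp [ha, hb, h20, h1, hone, h2, h3', h3, h24, ha', hb', vertexCode_eq_succ] at h ⊢
    · intro h'; exact absurd h' h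

/-- The result of `buildAdjacency`. -/
structure AdjacencyArrays (I : SourcedGraph n M) (mem : ℕ → ℕ → ℕ) : Prop where
  count : ∑ a : Fin n, mem 15 a = 2 * I.edges.length
  sound : ∀ a : Fin n, ∀ j < mem 15 a, ∃ x : Fin n, mem 16 (a * (2 * I.edges.length) + j) = x ∧
    I.graph.Adj x a ∧ mem 17 (a * (2 * I.edges.length) + j) = I.weight s(x, a)
  complete : ∀ x a : Fin n, I.graph.Adj x a →
    ∃ j < mem 15 a, mem 16 (a * (2 * I.edges.length) + j) = x
  treeWeight : ∀ t p : Fin n, I.tree t = some p → mem 7 t = I.weight s(p, t)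

theorem mem_edges_iff {x a : Fin n} :
    I.graph.Adj x a ↔ (x, a) ∈ I.edges ∨ (a, x) ∈ I.edges := by
  rw [← I.graph.mem_edgeSet, ← I.mem_edges]
  simp only [List.mem_map, Prod.exists, Sym2.eq_iff]
  constructor
  · rintro ⟨b, c, h, ⟨rfl, rfl⟩ | ⟨rfl, rfl⟩⟩
    · exact .inl h
    · exact .inr h
  · rintro (h | h)
    · exact ⟨_, _, h, .inl ⟨rfl, rfl⟩⟩
    · exact ⟨_, _, h, .inr ⟨rfl, rfl⟩⟩

theorem wp_buildAdjacency {W : ℕ} {σ : WordState} {t : ℕ}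
    (hW : n * (2 * I.edges.length) < 2 ^ W) (hnW : n < 2 ^ W) (hmW : 2 * I.edges.length < 2 ^ W)
    (h1 : σ.reg 1 = I.edges.length)
    (h0m : ∀ i (hi : i < I.edges.length), σ.mem 0 i = (I.edges[i].1 : ℕ))
    (h1m : ∀ i (hi : i < I.edges.length), σ.mem 1 i = (I.edges[i].2 : ℕ))
    (h2m : ∀ i (hi : i < I.edges.length), σ.mem 2 i = I.weight s(I.edges[i].1, I.edges[i].2))
    (h3 : ∀ x : Fin n, σ.mem 3 x = vertexCode (I.tree x)) (h15 : ∀ i, σ.mem 15 i = 0) :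
    Wp W buildAdjacency σ t fun τ t' => I.AdjacencyArrays τ.mem ∧ τ.reg 20 = 2 * I.edges.length ∧
      t' ≤ t + 20 + 200 * I.edges.length := by
  have hS : (I.edges.length + I.edges.length) % 2 ^ W = 2 * I.edges.length := by
    rw [← two_mul, Nat.mod_eq_of_lt hmW]
  rw [buildAdjacency, wp_block_cons, wp_assign, wp_block_cons]
  simp only [WordExpr.eval_add, WordExpr.eval_reg, h1, hS]
  refine wp_forLoop 0 I.edges.length (by simp) (Nat.zero_le _) (by omega) (by simpa using h1)
    (by decide) (by decide)
    (fun k τ t' => (∃ L : List (Fin n × Fin n), L.length = 2 * k ∧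
      (∀ j (hj : j < I.edges.length), j < k → I.edges[j] ∈ L ∧ I.edges[j].swap ∈ L) ∧
      I.Adjacency (2 * I.edges.length) L τ.mem) ∧ t' ≤ t + 10 + 200 * k) ?_ ?_ ?_
  · refine ⟨⟨[], by simp, by simp, ?_⟩, by simp⟩
    constructor <;> simp [h15]
  · rintro k τ t' - hk hs hreg hlim ⟨⟨L, hLlen, hL, hadj⟩, ht⟩
    have e0 : τ.mem 0 = σ.mem 0 := by rw [hs.mem 0 (by decide)]; simp
    have e1 : τ.mem 1 = σ.mem 1 := by rw [hs.mem 1 (by decide)]; simp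
    have e2 : τ.mem 2 = σ.mem 2 := by rw [hs.mem 2 (by decide)]; simp
    have e3 : τ.mem 3 = σ.mem 3 := by rw [hs.mem 3 (by decide)]; simp
    have e20 : τ.reg 20 = 2 * I.edges.length := by rw [hs.reg 20 (by decide)]; simp
    have hG : I.graph.Adj I.edges[k].1 I.edges[k].2 := mem_edges_iff.2 (.inl (by simp))
    simp only [wp_block_cons, wp_assign]
    refine Wp.mono_frame (wp_addArc (S := 2 * I.edges.length) (L := L) (u := I.edges[k].1)
      (v := I.edges[k].2) (by omega) hW hnW hG.symm ?_ ?_ (by decide) (by decide) ?_ ?_ ?_ ?_) ?_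
    · simp [hreg, e0, h0m k hk]
    · simp [hreg, e1, h1m k hk]
    · simp [e20]
    · simp [hreg, e2, h2m k hk, Sym2.eq_swap]
    · simp [e3, h3]
    · simpa using hadj
    rintro ρ t₁ hsρ ⟨hadj₁, ht₁⟩
    refine Wp.mono (wp_addArc (S := 2 * I.edges.length) (L := _ :: L) (u := I.edges[k].2)
      (v := I.edges[k].1) (by simp; omega) hW hnW hG ?_ ?_ (by decide) (by decide) ?_ ?_ ?_
      hadj₁) ?_
    · rw [hsρ.reg 23 (by decide)]; simp [hreg, e1, h1m k hk]
    · rw [hsρ.reg 22 (by decide)]; simp [hreg, e0, h0m k hk]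
    · rw [hsρ.reg 20 (by decide)]; simp [e20]
    · rw [hsρ.reg 24 (by decide)]; simp [hreg, e2, h2m k hk]
    · intro x; rw [hsρ.mem 3 (by decide)]; simp [e3, h3]
    rintro ρ' t₂ ⟨hadj₂, ht₂⟩
    rw [wp_block_nil]
    refine ⟨⟨_, ?_, ?_, hadj₂⟩, ?_⟩
    · simp [hLlen]; omega
    · intro j hj hjk
      rcases Nat.lt_succ_iff_lt_or_eq.1 hjk with h | rfl
      · have := hL j hj h
        exact ⟨by simp [this.1], by simp [this.2]⟩
      · exact ⟨by simp, by simp [Prod.swap]⟩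
    · simp at ht₁
      omega
  · rintro τ t' hs hreg ⟨⟨L, hLlen, hL, hadj⟩, ht⟩
    rw [wp_block_nil]
    have hmem : ∀ x a : Fin n, I.graph.Adj x a → (a, x) ∈ L := by
      intro x a hxa
      rcases mem_edges_iff.1 hxa with h | h <;> obtain ⟨j, hj, hj'⟩ := List.getElem_of_mem h
      · have := (hL j hj hj).2
        rwa [hj'] at this
      · have := (hL j hj hj).1
        rwa [hj'] at this
    refine ⟨⟨by rw [hadj.count, hLlen], hadj.sound, ?_, ?_⟩, ?_, by omega⟩
    · intro x a hxa
      exact hadj.complete _ (hmem x a hxa)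
    · intro t p hp
      exact hadj.treeWeight _ (hmem p t (tree_spec hp).1) hp
    · rw [hs.reg 20 (by decide)]; simp

end SourcedGraph

/-! ## Preprocessing: a topological order of the tree -/

/-- Compute a queue with the codes of all vertices, behind the code `0`, such that every vertex comes
after its parent. -/
def buildOrder : WordCmd :=
  block [
    .assign 26 (R 0 + 1),
    .assign 30 0,
    forLoop 27 0 26 (block [
      .assign 28 (A 6 (R 27)),
      forLoop 29 0 0 (.branch (eqE (A 3 (R 29)) (R 28))
        (block [.assign 30 (R 30 + 1), .store 6 (R 30) (R 29 + 1)]) .skip)])]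

namespace SourcedGraph

variable {n M : ℕ} {I : SourcedGraph n M}

theorem vertexCode_inj {o o' : Option (Fin n)} : vertexCode o = vertexCode o' ↔ o = o' := by
  cases o' with
  | none => cases o <;> simp [vertexCode]
  | some v => exact vertexCode_eq_succ

/-- A queue of vertices in which every vertex comes after its parent; `P t` says which vertices have
been appended. -/
structure Queue (I : SourcedGraph n M) (q : List (Option (Fin n))) (P : Fin n → Prop) : Prop where
  zero : q[0]? = some none
  nodup : q.Nodup
  mem : ∀ t, some t ∈ q ↔ P t
  parent : ∀ (j : ℕ) (t : Fin n), q[j]? = some (some t) → ∃ j' < j, q[j']? = some (I.tree t)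

theorem Queue.length_le {q : List (Option (Fin n))} {P : Fin n → Prop} (h : I.Queue q P) :
    q.length ≤ n + 1 := by
  simpa using h.nodup.length_le_card

/-- A queue that is closed under taking children contains every vertex, by induction on the tree
distance. Vertices without parent, including the unreachable ones, count as children of the code
`0`. -/
theorem Queue.length_eq {q : List (Option (Fin n))} {P : Fin n → Prop} (h : I.Queue q P)
    (hP : ∀ t, I.tree t ∈ q → P t) : (∀ t, some t ∈ q) ∧ q.length = n + 1 := by
  have hnone : none ∈ q := List.mem_of_getElem? h.zero
  have hall : ∀ (d : ℕ) (t : Fin n), I.treeDist t = d → some t ∈ q := by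
    intro d
    induction d using Nat.strong_induction_on with
    | _ d ih =>
      intro t hd
      refine (h.mem t).2 (hP t ?_)
      cases hp : I.tree t with
      | none => exact hnone
      | some p =>
        obtain ⟨hadj, -, -, hw⟩ := tree_spec hp
        have := weight_pos hadj
        exact ih _ (by omega) p rfl
  refine ⟨fun t => hall _ t rfl, le_antisymm h.length_le ?_⟩
  have hsub : (Finset.univ : Finset (Option (Fin n))) ⊆ q.toFinset := by
    intro o _
    rw [List.mem_toFinset]
    cases o with
    | none => exact hnone
    | some t => exact hall _ t rfl
  have := (Finset.card_le_card hsub).trans q.toFinset_card_le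
  simpa using this

theorem Queue.append {q : List (Option (Fin n))} {P P' : Fin n → Prop} (h : I.Queue q P)
    {t : Fin n} (ht : I.tree t ∈ q) (hP : ¬ P t) (hP' : ∀ x, P' x ↔ P x ∨ x = t) :
    I.Queue (q ++ [some t]) P' := by
  constructor
  · rw [List.getElem?_append_left, h.zero]
    by_contra hc
    have := h.zero
    rw [List.getElem?_eq_none (by omega)] at this
    simp at this
  · rw [List.nodup_append]
    refine ⟨h.nodup, by simp, ?_⟩
    rintro o ho _ ho' rfl
    rw [List.mem_singleton.1 ho', h.mem] at ho
    exact hP ho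
  · intro x
    simp [hP', h.mem]
  · intro j x hj
    by_cases hjl : j < q.length
    · rw [List.getElem?_append_left hjl] at hj
      obtain ⟨j', hj', hx⟩ := h.parent j x hj
      exact ⟨j', hj', by rwa [List.getElem?_append_left (by omega)]⟩
    · have hj1 : j = q.length := by
        by_contra hc
        rw [List.getElem?_eq_none (by simp; omega)] at hj
        simp at hj
      subst hj1
      simp at hj
      subst hj
      obtain ⟨j', hj', hx⟩ := List.getElem_of_mem ht
      exact ⟨j', hj', by rw [List.getElem?_append_left hj', List.getElem?_eq_getElem hj', hx]⟩

/-- The array holds, from cell `1` on, the codes of all vertices, ordered by `pos`; parents come first. -/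
structure OrderArray (I : SourcedGraph n M) (pos : Fin n → ℕ) (q : ℕ → ℕ) : Prop where
  lt : ∀ t, pos t < n
  inj : ∀ t t', pos t = pos t' → t = t'
  get : ∀ k < n, ∃ t : Fin n, pos t = k ∧ q (k + 1) = t + 1
  parent : ∀ t p, I.tree t = some p → pos p < pos t

theorem Queue.exists_order {q : List (Option (Fin n))} {P : Fin n → Prop} (h : I.Queue q P)
    (hq : (∀ t, some t ∈ q) ∧ q.length = n + 1) {f : ℕ → ℕ}
    (hf : ∀ j (hj : j < q.length), f j = vertexCode q[j]) : ∃ pos, I.OrderArray pos f := by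
  have hex : ∀ t : Fin n, ∃ k, k < n ∧ q[k + 1]? = some (some t) := by
    intro t
    obtain ⟨j, hj, hjt⟩ := List.getElem_of_mem (hq.1 t)
    cases j with
    | zero =>
      have := h.zero
      rw [List.getElem?_eq_getElem hj, hjt] at this
      simp at this
    | succ k => exact ⟨k, by omega, by rw [List.getElem?_eq_getElem hj, hjt]⟩
  have huniq : ∀ {j j' : ℕ} {o : Option (Fin n)}, q[j]? = some o → q[j']? = some o → j = j' := by
    intro j j' o hj hj'
    obtain ⟨hl, hj⟩ := List.getElem?_eq_some_iff.1 hj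
    obtain ⟨hl', hj'⟩ := List.getElem?_eq_some_iff.1 hj'
    exact (h.nodup.getElem_inj_iff).1 (hj.trans hj'.symm)
  choose pos hlt hpos using hex
  refine ⟨pos, hlt, ?_, ?_, ?_⟩
  · intro t t' htt
    have h1 := hpos t
    rw [htt, hpos t'] at h1
    simpa using h1.symm
  · intro k hk
    have hk' : k + 1 < q.length := by omega
    cases ho : q[k + 1] with
    | none =>
      have := huniq h.zero (List.getElem?_eq_some_iff.2 ⟨hk', ho⟩)
      omega
    | some t =>
      refine ⟨t, ?_, by rw [hf _ hk', ho]; rfl⟩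
      have := huniq (hpos t) (List.getElem?_eq_some_iff.2 ⟨hk', ho⟩)
      omega
  · intro t p hp
    obtain ⟨j', hj', hx⟩ := h.parent _ t (hpos t)
    rw [hp] at hx
    have := huniq hx (hpos p)
    omega

/-- Each of the `n + 1` queue elements scans all vertices for its children. The quadratic time is
within the allowed additive `n ^ 2`. -/
theorem wp_buildOrder {W : ℕ} {σ : WordState} {t : ℕ} (hW : n + 1 < 2 ^ W)
    (h0 : σ.reg 0 = n) (h3 : ∀ x : Fin n, σ.mem 3 x = vertexCode (I.tree x))
    (h6 : σ.mem 6 0 = 0) :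
    Wp W buildOrder σ t fun τ t' => (∃ pos, I.OrderArray pos (τ.mem 6)) ∧
      t' ≤ t + 20 + (n + 1) * (20 + 30 * n) := by
  have hone : ∀ ρ, (1 : WordExpr).eval W ρ = 1 := fun ρ => WordExpr.eval_one (by omega)
  have hn1 : (n + 1) % 2 ^ W = n + 1 := Nat.mod_eq_of_lt hW
  rw [buildOrder, wp_block_cons, wp_assign, wp_block_cons, wp_assign, wp_block_cons]
  simp only [WordExpr.eval_add, WordExpr.eval_reg, h0, hone, hn1, WordExpr.eval_zero]
  refine wp_forLoop 0 (n + 1) (by simp) (Nat.zero_le _) hW (by simp) (by decide) (by decide)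
    (fun i τ t' => (∃ q : List (Option (Fin n)),
      I.Queue q (fun x => ∃ j < i, q[j]? = some (I.tree x)) ∧ q.length = τ.reg 30 + 1 ∧
      ∀ j (hj : j < q.length), τ.mem 6 j = vertexCode q[j]) ∧
      t' ≤ t + 10 + i * (20 + 30 * n)) ?_ ?_ ?_
  · refine ⟨⟨[none], ?_, by simp, ?_⟩, by simp⟩
    · constructor
      · rfl
      · simp
      · simp
      · intro j x hj
        cases j <;> simp at hj
    · intro j hj
      simp at hj
      subst hj
      simp [h6, vertexCode]
  · rintro i τ t' - hi hs hreg hlim ⟨⟨q, hQ, hlen, hmem⟩, ht⟩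
    have e3 : τ.mem 3 = σ.mem 3 := by rw [hs.mem 3 (by decide)]; simp
    have e0 : τ.reg 0 = n := by rw [hs.reg 0 (by decide)]; simp [h0]
    -- The queue cannot run dry: if every element had been expanded, the queue would already have
    -- all `n + 1` elements.
    have hiq : i < q.length := by
      by_contra hc
      have := hQ.length_eq (fun x hx => by
        obtain ⟨j, hj, hjx⟩ := List.getElem_of_mem hx
        exact ⟨j, by omega, by rw [List.getElem?_eq_getElem hj, hjx]⟩)
      omega
    rw [wp_block_cons, wp_assign, wp_block_cons]
    simp only [WordExpr.eval_load, WordExpr.eval_reg, hreg, hmem i hiq]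
    refine wp_forLoop 0 n (by simp) (Nat.zero_le _) (by omega) (by simpa using e0) (by decide)
      (by decide)
      (fun k ρ t'' => (∃ q' : List (Option (Fin n)),
        I.Queue q' (fun x => (∃ j < i, q'[j]? = some (I.tree x)) ∨ x < k ∧ q'[i]? = some (I.tree x)) ∧
        q'.length = ρ.reg 30 + 1 ∧ (∀ j (hj : j < q'.length), ρ.mem 6 j = vertexCode q'[j]) ∧
        q'[i]? = some q[i]) ∧ t'' ≤ t' + 10 + k * 30) ?_ ?_ ?_
    · refine ⟨⟨q, ?_, by simpa using hlen, ?_, by simp⟩, by simp⟩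
      · simpa using hQ
      · simpa using hmem
    · rintro k ρ t'' - hk hsρ hregρ hlimρ ⟨⟨q', hQ', hlen', hmem', hqi⟩, ht'⟩
      have e3ρ : ρ.mem 3 = σ.mem 3 := by rw [hsρ.mem 3 (by decide)]; simp [e3]
      have e28 : ρ.reg 28 = vertexCode q[i] := by rw [hsρ.reg 28 (by decide)]; simp
      have hk3 : σ.mem 3 k = vertexCode (I.tree ⟨k, hk⟩) := h3 ⟨k, hk⟩
      simp only [wp_branch, wp_block_cons, wp_block_nil, wp_assign, wp_store, wp_skip,
        WordExpr.eval_eq, WordExpr.eval_load, WordExpr.eval_reg, hregρ, e3ρ, e28, hk3,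
        vertexCode_inj, ne_eq, ite_eq_right_iff, one_ne_zero, imp_false, not_not]
      have hiq' : i < q'.length := by
        by_contra hc
        rw [List.getElem?_eq_none (by omega)] at hqi
        simp at hqi
      refine ⟨fun htree => ?_, fun htree => ?_⟩
      -- The parent code occurs only at position `i` of the queue, and the scan for this position
      -- has not yet passed `k`. Hence no vertex is appended twice.
      · have hnew : ¬ ((∃ j < i, q'[j]? = some (I.tree ⟨k, hk⟩)) ∨
            (⟨k, hk⟩ : Fin n) < k ∧ q'[i]? = some (I.tree ⟨k, hk⟩)) := by
          rintro (⟨j, hj, hjt⟩ | ⟨h, -⟩)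
          · rw [htree, ← hqi] at hjt
            have := (List.getElem?_inj (by omega) hQ'.nodup).1 hjt
            omega
          · simp at h
        have hQ'' := hQ'.append (t := ⟨k, hk⟩) (by
            rw [htree]; exact List.mem_of_getElem? hqi) hnew
            (P' := fun x => (∃ j < i, (q' ++ [some ⟨k, hk⟩])[j]? = some (I.tree x)) ∨
              x.1 < k + 1 ∧ (q' ++ [some ⟨k, hk⟩])[i]? = some (I.tree x)) (by
          intro x
          have h1 : (q' ++ [some ⟨k, hk⟩])[i]? = q'[i]? := List.getElem?_append_left hiq'
          have h2 : (∃ j < i, (q' ++ [some ⟨k, hk⟩])[j]? = some (I.tree x)) ↔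
              ∃ j < i, q'[j]? = some (I.tree x) := by
            refine exists_congr fun j => and_congr_right fun hj => ?_
            rw [List.getElem?_append_left (by omega)]
          rw [h1, h2, or_assoc]
          refine or_congr_right ?_
          constructor
          · rintro ⟨h, h'⟩
            rcases Nat.lt_succ_iff_lt_or_eq.1 h with h | h
            · exact .inl ⟨h, h'⟩
            · exact .inr (Fin.ext h)
          · rintro (⟨h, h'⟩ | rfl)
            · exact ⟨by omega, h'⟩
            · exact ⟨by simp, by rw [hqi, htree]⟩)
        have hle := hQ''.length_le
        simp at hle
        have h30 : (ρ.reg 30 + 1) % 2 ^ W = ρ.reg 30 + 1 := Nat.mod_eq_of_lt (by omega)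
        have hk1 : (k + 1) % 2 ^ W = k + 1 := Nat.mod_eq_of_lt (by omega)
        refine ⟨⟨_, hQ'', ?_, ?_, ?_⟩, ?_⟩
        · simp [hone, h30, hlen']
        · intro j hj
          simp [hone, h30, hregρ, hk1]
          simp at hj
          by_cases hjl : j < q'.length
          · rw [if_neg (by omega), hmem' j hjl, List.getElem_append_left hjl]
          · have : j = q'.length := by omega
            subst this
            simp [hlen', vertexCode]
        · rw [List.getElem?_append_left hiq', hqi]
        · simp
          omega
      · refine ⟨⟨q', ?_, by simpa using hlen', by simpa using hmem', hqi⟩, by simp; omega⟩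
        refine ⟨hQ'.zero, hQ'.nodup, fun x => (hQ'.mem x).trans (or_congr_right ?_), hQ'.parent⟩
        refine and_congr_left fun h => ⟨fun h' => by omega, fun h' => ?_⟩
        rcases Nat.lt_succ_iff_lt_or_eq.1 h' with h' | h'
        · exact h'
        · refine absurd ?_ htree
          rw [hqi] at h
          rw [Option.some.inj h]
          congr 1
          exact Fin.ext h'.symm
    · rintro ρ t'' hsρ hregρ ⟨⟨q', hQ', hlen', hmem', hqi⟩, ht'⟩
      rw [wp_block_nil]
      refine ⟨⟨q', ?_, by simpa using hlen', by simpa using hmem'⟩, ?_⟩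
      · refine ⟨hQ'.zero, hQ'.nodup, fun x => (hQ'.mem x).trans ?_, hQ'.parent⟩
        constructor
        · rintro (⟨j, hj, h⟩ | ⟨-, h⟩)
          · exact ⟨j, by omega, h⟩
          · exact ⟨i, by omega, h⟩
        · rintro ⟨j, hj, h⟩
          rcases Nat.lt_succ_iff_lt_or_eq.1 hj with hj | rfl
          · exact .inl ⟨j, hj, h⟩
          · exact .inr ⟨x.2, h⟩
      · have : (i + 1) * (20 + 30 * n) = i * (20 + 30 * n) + (20 + 30 * n) := by ring
        omega
  · rintro τ t' hs hreg ⟨⟨q, hQ, hlen, hmem⟩, ht⟩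
    rw [wp_block_nil]
    refine ⟨hQ.exists_order (hQ.length_eq fun x hx => ?_) hmem, by omega⟩
    obtain ⟨j, hj, hjx⟩ := List.getElem_of_mem hx
    have := hQ.length_le
    exact ⟨j, by omega, by rw [List.getElem?_eq_getElem hj, hjx]⟩

end SourcedGraph

/-! ## The meaning of the log of a vertex -/

theorem distCode_cases (d : ℕ∞) : d = ⊤ ∧ distCode d = 0 ∨ ∃ k : ℕ, d = k ∧ distCode d = k + 1 := by
  by_cases h : d = ⊤
  · exact .inl ⟨h, by simp [distCode, h]⟩
  · lift d to ℕ using h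
    exact .inr ⟨d, rfl, by simp [distCode]⟩

theorem distCode_eq_zero {d : ℕ∞} : distCode d = 0 ↔ d = ⊤ := by
  rcases distCode_cases d with ⟨h, h'⟩ | ⟨k, h, h'⟩ <;> rw [h', h] <;> simp

namespace SourcedGraph

variable {n M : ℕ} {I : SourcedGraph n M}

/-- The replacement distance. -/
noncomputable abbrev repl (I : SourcedGraph n M) (H : Fin n → SimpleGraph (Fin n)) (v t : Fin n) :
    ℕ∞ :=
  wdist (H v) I.weight I.source t

/-- A table of replacement distances for the failures at the tree vertices other than the source. -/
structure FailureTable (I : SourcedGraph n M) (H : Fin n → SimpleGraph (Fin n))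
    (table : Fin n → Fin n → ℕ) : Prop where
  fail : ∀ v p, I.tree v = some p → I.IsFailure v (H v)
  dist : ∀ t v p, I.tree v = some p → table t v = distCode (I.repl H v t)

/-- The neighbour with code `q` is a parent of `t` after the failure at `v`, for a bound on the distance
with code `D`; the bound is tight if `t` is exceptional. -/
structure Good (I : SourcedGraph n M) (H : Fin n → SimpleGraph (Fin n)) (v t : Fin n) (D q : ℕ) :
    Prop where
  zero : D = 0 → q = 0
  parent : D ≠ 0 → ∃ x : Fin n, q = x + 1 ∧ (H v).Adj x t ∧
    I.repl H v x + (I.weight s(x, t) : ℕ) ≤ (D - 1 : ℕ)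
  tight : v = t ∨ I.Exceptional (H v) v t → D = distCode (I.repl H v t)

/-- The neighbour with code `q` precedes `t` on a shortest path, of length coded by `D`, after the failure
at `v`. -/
def Last (I : SourcedGraph n M) (H : Fin n → SimpleGraph (Fin n)) (t v : Fin n) (D q : ℕ) : Prop :=
  D = distCode (I.repl H v t) ∧ (D = 0 → q = 0) ∧ (D ≠ 0 → ∃ x : Fin n, q = x + 1 ∧
    (H v).Adj x t ∧ I.repl H v x + (I.weight s(x, t) : ℕ) = I.repl H v t)

theorem Last.good {H : Fin n → SimpleGraph (Fin n)} {t v : Fin n} {D q : ℕ}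
    (h : I.Last H t v D q) : I.Good H v t D q := by
  refine ⟨h.2.1, fun hD => ?_, fun _ => h.1⟩
  obtain ⟨x, hx, hadj, hd⟩ := h.2.2 hD
  refine ⟨x, hx, hadj, hd.le.trans ?_⟩
  rcases distCode_cases (I.repl H v t) with ⟨-, h'⟩ | ⟨k, h', h''⟩
  · exact absurd (h.1.trans h') hD
  · rw [h', h.1, h'']
    simp

/-- The last logged entry for `t`, whose logged failures are `l`, the most recent one first. -/
def Entry (I : SourcedGraph n M) (H : Fin n → SimpleGraph (Fin n)) (t : Fin n) :
    List (Fin n) → ℕ → ℕ → Prop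
  | [], D, q => D = 0 ∧ q = 0
  | v :: _, D, q => I.Last H t v D q

/-- Exceptional failures for `t`, upwards in the tree and with increasing distances, among the first
`i` vertices. -/
structure Chain (I : SourcedGraph n M) (H : Fin n → SimpleGraph (Fin n)) (pos : Fin n → ℕ) (i : ℕ)
    (t : Fin n) (l : List (Fin n)) : Prop where
  exc : ∀ v ∈ l, I.Exceptional (H v) v t ∧ (∃ p, I.tree v = some p) ∧ pos v < i
  pairwise : l.Pairwise fun v v' => I.Below v' v ∧ v' ≠ v ∧ I.repl H v t < I.repl H v' t

/-- A bound for the number of logged failures per vertex. -/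
def chainBound (n M : ℕ) : ℕ := min n (Nat.sqrt (64 * (M * n)))

theorem Chain.nil {H : Fin n → SimpleGraph (Fin n)} {pos : Fin n → ℕ} {i : ℕ} {t : Fin n} :
    I.Chain H pos i t [] :=
  ⟨by simp, .nil⟩

theorem Chain.mono {H : Fin n → SimpleGraph (Fin n)} {pos : Fin n → ℕ} {i i' : ℕ} {t : Fin n}
    {l : List (Fin n)} (h : I.Chain H pos i t l) (hi : i ≤ i') : I.Chain H pos i' t l :=
  ⟨fun v hv => ⟨(h.exc v hv).1, (h.exc v hv).2.1, (h.exc v hv).2.2.trans_le hi⟩, h.pairwise⟩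

/-- The list has the most recent, hence lowest, failure first; its reversal is the downward chain of
`exceptional_chain_bound`. A vertex without parent is never exceptional. -/
theorem Chain.length_le {H : Fin n → SimpleGraph (Fin n)} {table : Fin n → Fin n → ℕ}
    (hT : I.FailureTable H table) (hM : 1 ≤ M) {pos : Fin n → ℕ} {i : ℕ} {t : Fin n}
    {l : List (Fin n)} (h : I.Chain H pos i t l) : l.length ≤ chainBound n M := by
  cases hp : I.tree t with
  | none =>
    cases l with
    | nil => simp
    | cons v l =>
      have hE := (h.exc v (by simp)).1
      obtain ⟨p, hp', -⟩ := hE.below.exists_parent hE.ne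
      rw [hp] at hp'
      simp at hp'
  | some p =>
    have hrev : l.reverse.Pairwise fun v' v =>
        I.Below v' v ∧ v' ≠ v ∧ I.repl H v t < I.repl H v' t := by
      rw [List.pairwise_reverse]
      exact h.pairwise
    rw [List.pairwise_iff_get] at hrev
    have hexc : ∀ j : Fin l.reverse.length, _ := fun j =>
      h.exc (l.reverse.get j) (List.mem_reverse.1 (List.get_mem _ _))
    have := exceptional_chain_bound (I := I) hM hp (H := H) (v := l.reverse.get)
      (fun j => by
        obtain ⟨p, hp⟩ := (hexc j).2.1
        exact hT.fail _ p hp)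
      (fun j => by
        obtain ⟨p, hp⟩ := (hexc j).2.1
        exact ne_source_of_tree hp)
      (fun j => (hexc j).1)
      (fun j j' hj => ⟨(hrev j j' hj).1, (hrev j j' hj).2.1⟩)
      (fun j j' hj => (hrev j j' hj).2.2)
    rw [List.length_reverse] at this
    exact le_min this.1 (Nat.le_sqrt.2 this.2)

theorem OrderArray.lt_of_below {pos : Fin n → ℕ} {q : ℕ → ℕ} (h : I.OrderArray pos q)
    {a t : Fin n} (hat : I.Below a t) : a = t ∨ pos a < pos t := by
  induction hat with
  | refl => exact .inl rfl
  | tail _ hc ih =>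
    have := h.parent _ _ hc
    rcases ih with rfl | ih <;> right <;> omega

section

variable {H : Fin n → SimpleGraph (Fin n)} {table : Fin n → Fin n → ℕ} {pos : Fin n → ℕ}
  {q₀ : ℕ → ℕ} {v t p : Fin n} {l : List (Fin n)} {D q : ℕ}

/-- Two ancestors of `t` are comparable, and failures are processed parents first, so an earlier one
is the higher one. -/
theorem Chain.below_of_mem (h : I.Chain H pos (pos v) t l) (hpos : I.OrderArray pos q₀)
    (hvt : I.Below v t) {v' : Fin n} (hv' : v' ∈ l) : I.Below v' v ∧ v' ≠ v := by
  have hlt := (h.exc v' hv').2.2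
  refine ⟨((h.exc v' hv').1.below.total hvt).resolve_right fun hc => ?_, ?_⟩
  · rcases hpos.lt_of_below hc with rfl | h' <;> omega
  · rintro rfl
    omega

/-- If nothing needs to be logged, then the last entry is still good. -/
theorem Chain.good (h : I.Chain H pos (pos v) t l) (hT : I.FailureTable H table)
    (hpos : I.OrderArray pos q₀) (hv : I.tree v = some p) (hvt : I.Below v t) (hne : v ≠ t)
    (hE : I.Entry H t l D q)
    (hno : I.Exceptional (H v) v t → D = distCode (I.repl H v t)) : I.Good H v t D q := by
  cases l with
  | nil =>
    exact ⟨fun _ => hE.2, fun hD => absurd hE.1 hD, fun h' => hno (h'.resolve_left hne)⟩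
  | cons v' l =>
    obtain ⟨hexc, ⟨p', hp'⟩, hlt⟩ := h.exc v' (by simp)
    obtain ⟨hb, hne'⟩ := h.below_of_mem hpos hvt (v' := v') (by simp)
    refine ⟨hE.2.1, fun hD => ?_, fun h' => hno (h'.resolve_left hne)⟩
    obtain ⟨x, hx, hadj, hd⟩ := hE.2.2 hD
    obtain ⟨pt, hpt, hvpt⟩ := hvt.exists_parent hne
    obtain ⟨hadj', hle⟩ := hexc.transfer (hT.fail _ _ hp') (ne_source_of_tree hp') hpt
      (hT.fail _ _ hv) hb hvpt hadj hd
    refine ⟨x, hx, hadj', ?_⟩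
    obtain ⟨y, hy, hadjy, hdy⟩ := (Last.good hE).parent hD
    obtain rfl : x = y := Fin.ext (by omega)
    exact (add_le_add_left hle _).trans hdy

/-- Logging another failure. -/
theorem Chain.cons (h : I.Chain H pos (pos v) t l) (hT : I.FailureTable H table)
    (hpos : I.OrderArray pos q₀) (hv : I.tree v = some p) (hE : I.Entry H t l D q)
    (hexc : I.Exceptional (H v) v t) (hD : D ≠ distCode (I.repl H v t)) :
    I.Chain H pos (pos v + 1) t (v :: l) := by
  constructor
  · intro v' hv'
    rcases List.mem_cons.1 hv' with rfl | hv'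
    · exact ⟨hexc, ⟨p, hv⟩, Nat.lt_succ_self _⟩
    · exact (h.mono (Nat.le_succ _)).exc v' hv'
  · refine List.pairwise_cons.2 ⟨fun v' hv' => ?_, h.pairwise⟩
    obtain ⟨hb, hne⟩ := h.below_of_mem hpos hexc.below hv'
    refine ⟨hb, hne, ?_⟩
    obtain ⟨pt, hpt, hvpt⟩ := hexc.below.exists_parent hexc.ne
    have hle : ∀ v' ∈ l, I.repl H v t ≤ I.repl H v' t := fun v' hv' => by
      obtain ⟨hb, -⟩ := h.below_of_mem hpos hexc.below hv'
      obtain ⟨hexc', ⟨p', hp'⟩, -⟩ := h.exc v' hv'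
      exact hexc'.wdist_le (hT.fail _ _ hp') (ne_source_of_tree hp') hpt (hT.fail _ _ hv) hb hvpt
    cases l with
    | nil => simp at hv'
    | cons v₁ l =>
      have h1 : I.repl H v t < I.repl H v₁ t :=
        lt_of_le_of_ne (hle v₁ (by simp)) fun hc => hD (by rw [hc]; exact hE.1)
      rcases List.mem_cons.1 hv' with rfl | hv'
      · exact h1
      · exact h1.trans ((List.pairwise_cons.1 h.pairwise).1 v' hv').2.2

theorem Below.ne_source (hvt : I.Below v t) (hs : v ≠ I.source) : t ≠ I.source := by
  rintro rfl
  rcases below_iff.1 hvt with h | ⟨p, hp, -⟩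
  · exact hs h
  · simp [I.isTree.root] at hp

/-- The neighbours that the preprocessing accepts are the right ones. -/
theorem FailureTable.last_edge (hT : I.FailureTable H table) (hv : I.tree v = some p)
    (hvt : I.Below v t) {x : Fin n} (hadj : I.graph.Adj x t) (hx : table x v ≠ 0)
    (hd : table x v + I.weight s(x, t) = table t v) (hne : ¬ (t = v ∧ I.tree v = some x)) :
    (H v).Adj x t ∧ I.repl H v x + (I.weight s(x, t) : ℕ) = I.repl H v t := by
  rw [hT.dist _ _ _ hv] at hx hd
  rw [hT.dist _ _ _ hv] at hd
  rcases distCode_cases (I.repl H v x) with ⟨-, h⟩ | ⟨k, hk, hk'⟩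
  · exact absurd h hx
  rcases distCode_cases (I.repl H v t) with ⟨-, h⟩ | ⟨k', hk₁, hk₁'⟩
  · omega
  refine ⟨?_, ?_⟩
  · have hs := ne_source_of_tree hv
    rcases hT.fail v p hv with hF | hF
    · refine (hF x t).2 ⟨hadj, ?_, hne⟩
      rintro ⟨rfl, h⟩
      exact not_below_parent h hvt
    · have hiso : I.repl H v v = ⊤ :=
        wdist_eq_top_of_isolated hs fun y hy => ((hF y v).1 hy).2.2 rfl
      refine (hF x t).2 ⟨hadj, ?_, ?_⟩
      · rintro rfl
        rw [hiso] at hk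
        simp at hk
      · rintro rfl
        rw [hiso] at hk₁
        simp at hk₁
  · rw [hk, hk₁]
    norm_cast
    omega

/-- This guarantees that the neighbour search succeeds: the last edge of a shortest replacement path
passes its test. -/
theorem FailureTable.exists_last_edge (hT : I.FailureTable H table) (hv : I.tree v = some p)
    (hvt : I.Below v t) (hd : table t v ≠ 0) :
    ∃ x : Fin n, I.graph.Adj x t ∧ table x v ≠ 0 ∧ table x v + I.weight s(x, t) = table t v ∧
      ¬ (t = v ∧ I.tree v = some x) := by
  have hs := ne_source_of_tree hv
  have htop : I.repl H v t ≠ ⊤ := by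
    rwa [hT.dist _ _ _ hv, Ne, distCode_eq_zero] at hd
  obtain ⟨x, hx, hxd⟩ := _root_.exists_last_edge htop (hvt.ne_source hs)
  change I.repl H v x + (I.weight s(x, t) : ℕ) = I.repl H v t at hxd
  refine ⟨x, (hT.fail v p hv).le hx, ?_, ?_, ?_⟩
  · rw [hT.dist _ _ _ hv, Ne, distCode_eq_zero]
    intro hc
    rw [hc, top_add] at hxd
    exact htop hxd.symm
  · rw [hT.dist _ _ _ hv, hT.dist _ _ _ hv]
    rcases distCode_cases (I.repl H v x) with ⟨hc, -⟩ | ⟨k, hk, hk'⟩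
    · rw [hc, top_add] at hxd
      exact absurd hxd.symm htop
    rcases distCode_cases (I.repl H v t) with ⟨hc, -⟩ | ⟨k', hk₁, hk₁'⟩
    · exact absurd hc htop
    rw [hk, hk₁] at hxd
    norm_cast at hxd
    omega
  · rintro ⟨rfl, h⟩
    rcases hT.fail t p hv with hF | hF
    · exact ((hF x t).1 hx).2.2 ⟨rfl, h⟩
    · exact ((hF x t).1 hx).2.2 rfl

/-- The test for exceptional vertices by means of the table. -/
theorem FailureTable.exceptional_iff (hT : I.FailureTable H table) (hv : I.tree v = some p)
    (hvt : I.Below v t) (hne : v ≠ t) {pt : Fin n} (hpt : I.tree t = some pt) :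
    I.Exceptional (H v) v t ↔ table t v ≠ 0 ∧
      (table pt v = 0 ∨ table t v < table pt v + I.weight s(pt, t)) := by
  have h1 : I.Exceptional (H v) v t ↔
      I.repl H v t < I.repl H v pt + (I.weight s(pt, t) : ℕ) := by
    refine ⟨fun h => h.lt pt hpt, fun h => ⟨hvt, hne, fun p' hp' => ?_⟩⟩
    obtain rfl := Option.some.inj (hpt.symm.trans hp')
    exact h
  rw [h1, hT.dist _ _ _ hv, hT.dist _ _ _ hv]
  rcases distCode_cases (I.repl H v t) with ⟨h, h'⟩ | ⟨k, h, h'⟩ <;>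
    rcases distCode_cases (I.repl H v pt) with ⟨g, g'⟩ | ⟨k', g, g'⟩ <;> rw [h', g', h, g]
  · simp
  · simp
  · simp
  · norm_cast
    simp
    omega

end

/-- Replay the log entries `lo, …, lo + k - 1`: entry `e` concerns vertex `lt e`. The result is the
number of the last entry for vertex `t`, or `f t` if there is none. -/
def replay (f lt : ℕ → ℕ) (lo : ℕ) : ℕ → ℕ → ℕ
  | 0, t => f t
  | k + 1, t => if lt (lo + k) = t then lo + k else replay f lt lo k t

theorem replay_congr {f f' lt lt' : ℕ → ℕ} {lo k t : ℕ} (hf : f t = f' t)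
    (hlt : ∀ e, lo ≤ e → e < lo + k → lt e = lt' e) :
    replay f lt lo k t = replay f' lt' lo k t := by
  induction k with
  | zero => exact hf
  | succ k ih =>
    simp only [replay]
    rw [hlt (lo + k) (by omega) (by omega), ih fun e h h' => hlt e h (by omega)]

/-- The data structure, with log entries below `E` and snapshots up to address `off`, is correct for the
failure at `v`. -/
structure Answer (I : SourcedGraph n M) (H : Fin n → SimpleGraph (Fin n)) (E off : ℕ)
    (mem : ℕ → ℕ → ℕ) (v : Fin n) : Prop where
  lo_le : mem 9 v ≤ mem 10 v
  hi_le : mem 10 v ≤ E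
  short : mem 10 v ≤ mem 9 v + 2 * n
  off_le : mem 8 v ≤ off
  good : ∀ t : Fin n, I.Below v t → ∃ e < E, replay (fun x => mem 14 (mem 8 v + x)) (mem 11)
    (mem 9 v) (mem 10 v - mem 9 v) t = e ∧ I.Good H v t (mem 12 e) (mem 13 e)

/-- Later phases only append: new entries start at `E`, and new snapshots start at `off + n`.
Everything an answered failure refers to stays as it is. -/
theorem Answer.congr {H : Fin n → SimpleGraph (Fin n)} {E E' off off' : ℕ} {mem mem' : ℕ → ℕ → ℕ}
    {v : Fin n} (h : I.Answer H E off mem v) (hE : E ≤ E') (hoff : off ≤ off')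
    (h8 : mem' 8 v = mem 8 v) (h9 : mem' 9 v = mem 9 v) (h10 : mem' 10 v = mem 10 v)
    (h11 : ∀ e < E, mem' 11 e = mem 11 e) (h12 : ∀ e < E, mem' 12 e = mem 12 e)
    (h13 : ∀ e < E, mem' 13 e = mem 13 e) (h14 : ∀ x < off + n, mem' 14 x = mem 14 x) :
    I.Answer H E' off' mem' v := by
  have h1 := h.lo_le
  have h2 := h.hi_le
  have h3 := h.off_le
  refine ⟨by rw [h9, h10]; exact h1, by rw [h10]; omega, by rw [h9, h10]; exact h.short,
    by rw [h8]; omega, fun t ht => ?_⟩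
  obtain ⟨e, he, hre, hgood⟩ := h.good t ht
  refine ⟨e, he.trans_le hE, ?_, by rw [h12 e he, h13 e he]; exact hgood⟩
  rw [← hre, h8, h9, h10]
  have htn := t.2
  exact replay_congr (h14 _ (by omega)) fun e _ he => h11 e (by omega)

end SourcedGraph

/-! ## Preprocessing: the log -/

/-- Find a neighbour through which a shortest path to the vertex in register `37` arrives after the
failure at the vertex in register `35`; register `38` holds the code of the distance. -/
def searchParent : WordCmd :=
  block [
    .assign 41 0,
    .assign 43 (A 15 (R 37)),
    forLoop 42 0 43 (block [
      .assign 44 (A 16 (R 37 * R 20 + R 42)),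
      .assign 45 (A 4 (R 44 * R 0 + R 35)),
      .branch (R 45)
        (.branch (eqE (R 45 + A 17 (R 37 * R 20 + R 42)) (R 38))
          (.branch (eqE (R 37) (R 35))
            (.branch (eqE (A 3 (R 35)) (R 44 + 1)) .skip (.assign 41 (R 44 + 1)))
            (.assign 41 (R 44 + 1)))
          .skip)
        .skip])]

/-- Decide whether the failure at the vertex in register `35` must be logged for the vertex in
register `37`. -/
def testEvent : WordCmd :=
  block [
    .assign 38 (A 4 (R 37 * R 0 + R 35)),
    .assign 40 0,
    .branch (eqE (R 37) (R 35)) (.assign 40 1)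
      (.branch (R 38)
        (.branch (eqE (R 38) (A 12 (A 18 (R 37)))) .skip
          (block [
            .assign 39 (A 4 ((A 3 (R 37) - 1) * R 0 + R 35)),
            .branch (R 39) (.assign 40 (ltE (R 38) (R 39 + A 7 (R 37)))) (.assign 40 1)]))
        .skip)]

/-- Append an entry to the log. -/
def logEvent : WordCmd :=
  block [
    searchParent,
    .store 11 (R 31) (R 37),
    .store 12 (R 31) (R 38),
    .store 13 (R 31) (R 41),
    .store 18 (R 37) (R 31),
    .assign 31 (R 31 + 1)]

/-- Process one vertex for one failure. -/
def pairStep : WordCmd :=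
  block [
    .assign 37 (A 6 (R 36 + 1) - 1),
    .branch (eqE (R 37) (R 35)) (.store 19 (R 37 + 1) 1)
      (.store 19 (R 37 + 1) (A 19 (A 3 (R 37)))),
    .branch (A 19 (R 37 + 1)) (block [testEvent, .branch (R 40) logEvent .skip]) .skip]

namespace SourcedGraph

variable {n M : ℕ} {I : SourcedGraph n M}

/-- Words are long enough for all intermediate results. -/
structure Fits (I : SourcedGraph n M) (table : Fin n → Fin n → ℕ) (W : ℕ) : Prop where
  rows : n * (2 * I.edges.length) < 2 ^ W
  edges : 2 * I.edges.length < 2 ^ W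
  squares : 4 * (n * n) + 4 * n + 4 < 2 ^ W
  table : ∀ t v, table t v + M < 2 ^ W

/-- What does not change after the first two phases of the preprocessing. -/
structure Ctx (I : SourcedGraph n M) (table : Fin n → Fin n → ℕ) (pos deg : Fin n → ℕ)
    (σ : WordState) : Prop where
  size : σ.reg 0 = n
  stride : σ.reg 20 = 2 * I.edges.length
  par : ∀ x : Fin n, σ.mem 3 x = vertexCode (I.tree x)
  table : ∀ t v : Fin n, σ.mem 4 (t * n + v) = table t v
  adj : I.AdjacencyArrays σ.mem
  order : I.OrderArray pos (σ.mem 6)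
  deg : ∀ x : Fin n, σ.mem 15 x = deg x

theorem Ctx.congr {table : Fin n → Fin n → ℕ} {pos deg : Fin n → ℕ} {σ τ : WordState}
    (h : I.Ctx table pos deg σ) {rs as : List ℕ} (hs : SameOutside rs as σ τ)
    (hr : 0 ∉ rs ∧ 20 ∉ rs)
    (ha : 3 ∉ as ∧ 4 ∉ as ∧ 6 ∉ as ∧ 7 ∉ as ∧ 15 ∉ as ∧ 16 ∉ as ∧ 17 ∉ as) :
    I.Ctx table pos deg τ := by
  have e0 := hs.reg 0 hr.1
  have e20 := hs.reg 20 hr.2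
  have e3 := hs.mem 3 ha.1
  have e4 := hs.mem 4 ha.2.1
  have e6 := hs.mem 6 ha.2.2.1
  have e7 := hs.mem 7 ha.2.2.2.1
  have e15 := hs.mem 15 ha.2.2.2.2.1
  have e16 := hs.mem 16 ha.2.2.2.2.2.1
  have e17 := hs.mem 17 ha.2.2.2.2.2.2
  refine ⟨by rw [e0, h.size], by rw [e20, h.stride], by rw [e3]; exact h.par,
    by rw [e4]; exact h.table, ⟨?_, ?_, ?_, ?_⟩, by rw [e6]; exact h.order,
    by rw [e15]; exact h.deg⟩
  · rw [e15]; exact h.adj.count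
  · rw [e15, e16, e17]; exact h.adj.sound
  · rw [e15, e16]; exact h.adj.complete
  · rw [e7]; exact h.adj.treeWeight

section

variable {H : Fin n → SimpleGraph (Fin n)} {table : Fin n → Fin n → ℕ} {pos deg : Fin n → ℕ}
  {W : ℕ} {σ : WordState} {v t p : Fin n} {t₀ : ℕ}

theorem square_lt (hW : I.Fits table W) (x y : Fin n) : (x : ℕ) * n + y < 2 ^ W := by
  have := row_lt x.2 y.2
  have := hW.squares
  omega

theorem eval_square (hW : I.Fits table W) (x y : Fin n) :
    ((x : ℕ) * n % 2 ^ W + y) % 2 ^ W = x * n + y := by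
  have := square_lt hW x y
  rw [Nat.mod_eq_of_lt (a := (x : ℕ) * n) (by omega), Nat.mod_eq_of_lt this]

theorem eval_succ (hW : I.Fits table W) (x : Fin n) : ((x : ℕ) + 1) % 2 ^ W = x + 1 := by
  have := hW.squares
  have := x.2
  exact Nat.mod_eq_of_lt (by omega)

theorem Fits.one (hW : I.Fits table W) (ρ : WordState) : (1 : WordExpr).eval W ρ = 1 := by
  have := hW.squares
  exact WordExpr.eval_one (by omega)

theorem Ctx.deg_le (hC : I.Ctx table pos deg σ) (t : Fin n) : deg t ≤ 2 * I.edges.length := by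
  rw [← hC.adj.count, ← hC.deg]
  exact Finset.single_le_sum (f := fun a : Fin n => σ.mem 15 a) (fun _ _ => Nat.zero_le _)
    (Finset.mem_univ t)

/-- The scan looks for a neighbour whose replacement distance plus edge weight equals that of `t`.
The edge case `t = v` must skip the failed edge; for vertex failures this exclusion is vacuous
because `v` has infinite distance. -/
theorem wp_searchParent (hW : I.Fits table W) (hT : I.FailureTable H table)
    (hC : I.Ctx table pos deg σ) (hv : I.tree v = some p) (hvt : I.Below v t)
    (h35 : σ.reg 35 = v) (h37 : σ.reg 37 = t) (h38 : σ.reg 38 = table t v) :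
    Wp W searchParent σ t₀ fun τ t' => I.Last H t v (table t v) (τ.reg 41) ∧
      t' ≤ t₀ + 20 + 60 * deg t := by
  have hdeg := hC.deg_le t
  have hsmall := hW.edges
  set valid : Fin n → Prop := fun x => I.graph.Adj x t ∧ table x v ≠ 0 ∧
    table x v + I.weight s(x, t) = table t v ∧ ¬ (t = v ∧ I.tree v = some x) with hvalid
  rw [searchParent, wp_block_cons, wp_assign, wp_block_cons, wp_assign, wp_block_cons]
  refine wp_forLoop 0 (deg t) (by simp) (Nat.zero_le _) (by omega) ?_ (by decide) (by decide)
    (fun j τ t' => (τ.reg 41 = 0 ∧ (∀ j' < j, ∀ x : Fin n,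
        σ.mem 16 (t * (2 * I.edges.length) + j') = x → ¬ valid x) ∨
      ∃ x : Fin n, τ.reg 41 = x + 1 ∧ valid x) ∧ t' ≤ t₀ + 10 + 60 * j) ?_ ?_ ?_
  · simp [h37, hC.deg]
  · simp
  · rintro j τ t' - hj hs hreg hlim ⟨hinv, ht⟩
    have hCτ : I.Ctx table pos deg τ := by
      refine (hC.congr (τ := (σ.setReg 41 0).setReg 43 0) (rs := [41, 43]) (as := [])
        ⟨fun x hx => ?_, fun _ _ => rfl⟩ (by decide) (by decide)).congr (rs := [41, 42, 43, 44, 45])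
        (as := []) ⟨fun x hx => ?_, fun a ha => ?_⟩ (by decide) (by decide)
      · simp at hx; simp [hx]
      · simp at hx
        rw [hs.reg x (by simp [WordCmd.regs, block]; tauto)]
        simp [hx]
      · rw [hs.mem a (by simp [WordCmd.arrs, block])]; simp
    have e35 : τ.reg 35 = v := by rw [hs.reg 35 (by decide)]; simp [h35]
    have e37 : τ.reg 37 = t := by rw [hs.reg 37 (by decide)]; simp [h37]
    have e38 : τ.reg 38 = table t v := by rw [hs.reg 38 (by decide)]; simp [h38]
    have e16 : τ.mem 16 = σ.mem 16 := by rw [hs.mem 16 (by decide)]; simp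
    obtain ⟨x, hx, hadj, hwx⟩ := hCτ.adj.sound t j (by rw [hCτ.deg]; exact hj)
    have hrow : ((t : ℕ) * (2 * I.edges.length) % 2 ^ W + j) % 2 ^ W =
        t * (2 * I.edges.length) + j := by
      have h1 := row_lt t.2 (show j < 2 * I.edges.length by omega)
      have h2 := hW.rows
      rw [Nat.mod_eq_of_lt (a := (t : ℕ) * (2 * I.edges.length)) (by omega),
        Nat.mod_eq_of_lt (by omega)]
    have hxw : I.weight s(x, t) ≤ M := I.weight_le _ ((I.graph.mem_edgeSet).2 hadj)
    have hsum : (table x v + I.weight s(x, t)) % 2 ^ W = table x v + I.weight s(x, t) :=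
      Nat.mod_eq_of_lt (by have := hW.table x v; omega)
    have hx1 := eval_succ hW x
    -- All rejecting branches leave register `41` unchanged, and differ only in the reason for
    -- rejection.
    have hadv : ∀ (ρ : WordState) (t'' : ℕ), ¬ valid x → ρ.reg 41 = τ.reg 41 → t'' ≤ t' + 56 →
        (((ρ.setReg 42 (j + 1)).reg 41 = 0 ∧ (∀ j' < j + 1, ∀ x : Fin n,
          σ.mem 16 (t * (2 * I.edges.length) + j') = x → ¬ valid x) ∨
        ∃ x : Fin n, (ρ.setReg 42 (j + 1)).reg 41 = x + 1 ∧ valid x) ∧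
          t'' + 4 ≤ t₀ + 10 + 60 * (j + 1)) := by
      intro ρ t'' hnv hρ ht''
      refine ⟨?_, by omega⟩
      simp only [WordState.setReg_reg, hρ]
      refine hinv.imp (fun h => ⟨by simpa using h.1, fun j' hj' y hy => ?_⟩) (fun h => by simpa using h)
      rcases Nat.lt_succ_iff_lt_or_eq.1 hj' with h' | rfl
      · exact h.2 j' h' y hy
      · rw [← e16, hx] at hy
        rw [← Fin.ext hy]
        exact hnv
    simp only [wp_block_cons, wp_block_nil, wp_assign, wp_branch, wp_skip, WordExpr.eval_add,
      WordExpr.eval_mul, WordExpr.eval_reg, WordExpr.eval_load, WordExpr.eval_eq,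
      WordState.setReg_reg, WordState.setReg_mem, hreg, e35, e37, e38, hCτ.stride, hCτ.size, hrow,
      hx, eval_square hW, hCτ.table, hwx, hsum, hW.one, hx1, hCτ.par, if_true,
      Nat.reduceEqDiff, if_false, vertexCode_eq_succ, ne_eq, ite_eq_right_iff, one_ne_zero,
      imp_false, not_not, Fin.val_inj]
    refine ⟨fun h1 => ⟨fun h2 => ⟨fun h3 => ⟨fun h4 => ?_, fun h4 => ?_⟩, fun h3 => ?_⟩,
      fun h2 => ?_⟩, fun h1 => ?_⟩
    · refine hadv _ _ (fun h => h.2.2.2 ⟨h3, h4⟩) ?_ ?_ <;> simp [add_assoc]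
    · exact ⟨.inr ⟨x, rfl, hadj, h1, h2, fun h => h4 h.2⟩, by simp; omega⟩
    · exact ⟨.inr ⟨x, rfl, hadj, h1, h2, fun h => h3 h.1⟩, by simp; omega⟩
    · refine hadv _ _ (fun h => h2 h.2.2.1) ?_ ?_ <;> simp [add_assoc]
    · refine hadv _ _ (fun h => h.2.1 h1) ?_ ?_ <;> simp [add_assoc]
  · rintro τ t' hs hreg ⟨hinv, ht⟩
    rw [wp_block_nil]
    refine ⟨⟨hT.dist _ _ _ hv, ?_, ?_⟩, by omega⟩
    · intro h0
      rcases hinv with ⟨h, -⟩ | ⟨x, -, -, hx, hd, -⟩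
      · exact h
      · omega
    · intro h0
      rcases hinv with ⟨-, h⟩ | ⟨x, hx, hval⟩
      · obtain ⟨x, hval⟩ := hT.exists_last_edge hv hvt h0
        obtain ⟨j, hj, hjx⟩ := hC.adj.complete x t hval.1
        exact absurd hval (h j (by rwa [← hC.deg]) x hjx)
      · obtain ⟨h1, h2, h3, h4⟩ := hval
        exact ⟨x, hx, hT.last_edge hv hvt h1 h2 h3 h4⟩

end

end SourcedGraph

/-! ### The invariant of the log and a single logging step -/

namespace SourcedGraph

variable {n M : ℕ} {I : SourcedGraph n M} {H : Fin n → SimpleGraph (Fin n)}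
  {table : Fin n → Fin n → ℕ} {pos deg : Fin n → ℕ} {W : ℕ} {σ τ : WordState} {v t p : Fin n}
  {t₀ i k : ℕ} {ct : Fin n → ℕ}

/-- The comparisons are made between distance codes, where `0` means infinity and finite distances
are shifted by one. The shift occurs on both sides of the test for exceptional vertices, and
infinite values are handled by separate branches. -/
theorem wp_testEvent (hW : I.Fits table W) (hT : I.FailureTable H table)
    (hC : I.Ctx table pos deg σ) (hv : I.tree v = some p) (hvt : I.Below v t)
    (h35 : σ.reg 35 = v) (h37 : σ.reg 37 = t) :
    Wp W testEvent σ t₀ fun τ t' => τ.reg 38 = table t v ∧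
      (τ.reg 40 ≠ 0 ↔ v = t ∨ I.Exceptional (H v) v t ∧
        σ.mem 12 (σ.mem 18 t) ≠ table t v) ∧ t' ≤ t₀ + 70 := by
  have hone := hW.one
  simp only [testEvent, wp_block_cons, wp_block_nil, wp_assign, wp_branch, wp_skip,
    WordExpr.eval_add, WordExpr.eval_mul, WordExpr.eval_sub, WordExpr.eval_reg,
    WordExpr.eval_load, WordExpr.eval_eq, WordExpr.eval_lt, WordExpr.eval_zero, hone,
    WordState.setReg_reg, WordState.setReg_mem, h35, h37, hC.size, eval_square hW, hC.table,
    if_true, Nat.reduceEqDiff, if_false, ne_eq, ite_eq_right_iff, one_ne_zero, imp_false, not_not,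
    Fin.val_inj]
  refine ⟨fun h => ⟨trivial, by simp [h], by simp [add_assoc]⟩, fun hne => ?_⟩
  have hne' : v ≠ t := fun h => hne h.symm
  obtain ⟨pt, hpt, hvpt⟩ := hvt.exists_parent hne'
  have hiff := hT.exceptional_iff hv hvt hne' hpt
  have hpar : σ.mem 3 t = pt + 1 := by rw [hC.par, hpt]; rfl
  have hwt : σ.mem 7 t = I.weight s(pt, t) := hC.adj.treeWeight t pt hpt
  have hle : I.weight s(pt, t) ≤ M := I.weight_le _ ((I.graph.mem_edgeSet).2 (tree_spec hpt).1)
  have hsum : (table pt v + I.weight s(pt, t)) % 2 ^ W = table pt v + I.weight s(pt, t) :=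
    Nat.mod_eq_of_lt (by have := hW.table pt v; omega)
  simp only [hpar, Nat.add_sub_cancel, eval_square hW, hC.table, hwt, hsum]
  refine ⟨fun h0 => ⟨fun h1 => ?_, fun h1 => ⟨fun h2 => ?_, fun h2 => ?_⟩⟩, fun h0 => ?_⟩
  · refine ⟨trivial, ?_, by simp [add_assoc]⟩
    simp [hne', h1]
  · refine ⟨trivial, ?_, by simp [add_assoc]⟩
    rw [hiff]
    have h1' : ¬ σ.mem 12 (σ.mem 18 t) = table t v := fun h => h1 h.symm
    simp [hne', h1', h0, h2]
  · refine ⟨trivial, ?_, by simp [add_assoc]⟩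
    rw [hiff]
    have h1' : ¬ σ.mem 12 (σ.mem 18 t) = table t v := fun h => h1 h.symm
    simp [hne', h1', h0, h2]
  · refine ⟨trivial, ?_, by simp [add_assoc]⟩
    rw [hiff]
    simp [hne', h0]

/-- The invariant of the log, while the `i`-th failure is processed for the `k`-th vertex; `ct t` is the
number of entries for `t`. -/
structure LogInv (I : SourcedGraph n M) (H : Fin n → SimpleGraph (Fin n)) (pos : Fin n → ℕ)
    (i k : ℕ) (σ : WordState) (ct : Fin n → ℕ) : Prop where
  total : σ.reg 31 = 1 + ∑ t, ct t
  base_le : σ.reg 32 ≤ σ.reg 31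
  off_le : σ.reg 33 ≤ σ.reg 32
  cur_lt : ∀ t : Fin n, σ.mem 18 t < σ.reg 31
  cur_eq : ∀ t : Fin n, σ.mem 18 t = replay (fun x => σ.mem 14 (σ.reg 33 + x)) (σ.mem 11)
    (σ.reg 32) (σ.reg 31 - σ.reg 32) t
  ct_le : ∀ t, ct t ≤ chainBound n M + 1
  chain : ∀ t : Fin n, i < pos t ∨ pos t = i ∧ k ≤ i →
    ∃ l, I.Chain H pos (if pos t < k then i + 1 else i) t l ∧ ct t = l.length ∧
      I.Entry H t l (σ.mem 12 (σ.mem 18 t)) (σ.mem 13 (σ.mem 18 t))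
  answer : ∀ v p : Fin n, I.tree v = some p → pos v < i →
    I.Answer H (σ.reg 31) (σ.reg 33) σ.mem v
  zero : σ.mem 19 0 = 0

/-- The invariant of the loop over all vertices for the failure at `v`. -/
structure PairInv (I : SourcedGraph n M) (H : Fin n → SimpleGraph (Fin n)) (pos : Fin n → ℕ)
    (v : Fin n) (k : ℕ) (σ : WordState) (ct : Fin n → ℕ) : Prop
    extends I.LogInv H pos (pos v) k σ ct where
  flag : ∀ x : Fin n, pos x < k → (σ.mem 19 (x + 1) ≠ 0 ↔ I.Below v x)
  good : ∀ x : Fin n, pos x < k → I.Below v x →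
    I.Good H v x (σ.mem 12 (σ.mem 18 x)) (σ.mem 13 (σ.mem 18 x))
  short : σ.reg 31 ≤ σ.reg 32 + n + k

/-- This crude bound uses only `chainBound n M ≤ n`; it serves to rule out overflow of entry numbers
and addresses. -/
theorem LogInv.le_square (h : I.LogInv H pos i k σ ct) : σ.reg 31 ≤ 1 + n * (n + 1) := by
  rw [h.total]
  have : ∑ t, ct t ≤ ∑ _t : Fin n, (n + 1) := Finset.sum_le_sum fun t _ =>
    (h.ct_le t).trans (Nat.add_le_add_right (min_le_left _ _) _)
  simp at this
  omega

theorem LogInv.congr (h : I.LogInv H pos i k σ ct) {rs as : List ℕ}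
    (hs : SameOutside rs as σ τ) (hr : 31 ∉ rs ∧ 32 ∉ rs ∧ 33 ∉ rs)
    (ha : (8 ∉ as ∧ 9 ∉ as ∧ 10 ∉ as ∧ 11 ∉ as) ∧ 12 ∉ as ∧ 13 ∉ as ∧ 14 ∉ as ∧ 18 ∉ as)
    (h0 : τ.mem 19 0 = 0) : I.LogInv H pos i k τ ct := by
  obtain ⟨⟨a8, a9, a10, a11⟩, a12, a13, a14, a18⟩ := ha
  have e31 := hs.reg 31 hr.1
  have e32 := hs.reg 32 hr.2.1
  have e33 := hs.reg 33 hr.2.2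
  have e8 := hs.mem 8 a8
  have e9 := hs.mem 9 a9
  have e10 := hs.mem 10 a10
  have e11 := hs.mem 11 a11
  have e12 := hs.mem 12 a12
  have e13 := hs.mem 13 a13
  have e14 := hs.mem 14 a14
  have e18 := hs.mem 18 a18
  refine ⟨?_, ?_, ?_, ?_, ?_, h.ct_le, ?_, ?_, h0⟩
  · rw [e31]; exact h.total
  · rw [e31, e32]; exact h.base_le
  · rw [e32, e33]; exact h.off_le
  · rw [e18, e31]; exact h.cur_lt
  · rw [e18, e31, e32, e33, e14, e11]; exact h.cur_eq
  · rw [e12, e13, e18]; exact h.chain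
  · intro v p hp hv
    rw [e31, e33]
    exact (h.answer v p hp hv).congr le_rfl le_rfl (by rw [e8]) (by rw [e9]) (by rw [e10])
      (by simp [e11]) (by simp [e12]) (by simp [e13]) (by simp [e14])

theorem PairInv.congr (h : I.PairInv H pos v k σ ct) {rs as : List ℕ}
    (hs : SameOutside rs as σ τ) (hr : 31 ∉ rs ∧ 32 ∉ rs ∧ 33 ∉ rs)
    (ha : (8 ∉ as ∧ 9 ∉ as ∧ 10 ∉ as ∧ 11 ∉ as) ∧ 12 ∉ as ∧ 13 ∉ as ∧ 14 ∉ as ∧ 18 ∉ as)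
    (h0 : τ.mem 19 0 = 0) (hflag : ∀ x : Fin n, pos x < k → (τ.mem 19 (x + 1) ≠ 0 ↔ I.Below v x)) :
    I.PairInv H pos v k τ ct := by
  refine ⟨h.toLogInv.congr hs hr ha h0, hflag, ?_, ?_⟩
  · rw [hs.mem 12 ha.2.1, hs.mem 13 ha.2.2.1, hs.mem 18 ha.2.2.2.2]; exact h.good
  · rw [hs.reg 31 hr.1, hs.reg 32 hr.2.1]; exact h.short

/-- Nothing is logged for `t`. -/
theorem PairInv.skip (h : I.PairInv H pos v (pos t) σ ct)
    (hpos : ∀ x y, pos x = pos y → x = y)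
    (hflag : σ.mem 19 (t + 1) ≠ 0 ↔ I.Below v t)
    (hne : I.Below v t → v ≠ t ∧ I.Good H v t (σ.mem 12 (σ.mem 18 t)) (σ.mem 13 (σ.mem 18 t))) :
    I.PairInv H pos v (pos t + 1) σ ct := by
  refine ⟨⟨h.total, h.base_le, h.off_le, h.cur_lt, h.cur_eq, h.ct_le, ?_, h.answer, h.zero⟩,
    ?_, ?_, by have := h.short; omega⟩
  · intro x hx
    obtain ⟨l, hl, hct, hE⟩ := h.chain x (by omega)
    refine ⟨l, hl.mono ?_, hct, hE⟩
    split_ifs <;> omega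
  · intro x hx
    rcases Nat.lt_succ_iff_lt_or_eq.1 hx with hx | hx
    · exact h.flag x hx
    · rw [hpos _ _ hx]; exact hflag
  · intro x hx hb
    rcases Nat.lt_succ_iff_lt_or_eq.1 hx with hx | hx
    · exact h.good x hx hb
    · rw [hpos _ _ hx] at hb ⊢; exact (hne hb).2

/-- A new entry for `t`. -/
theorem PairInv.log (h : I.PairInv H pos v (pos t) σ ct) (hM : 1 ≤ M)
    (hT : I.FailureTable H table) {q₀ : ℕ → ℕ} (hpos : I.OrderArray pos q₀)
    (hv : I.tree v = some p) (hflag : σ.mem 19 (t + 1) ≠ 0 ↔ I.Below v t) (hvt : I.Below v t)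
    (hev : v = t ∨ I.Exceptional (H v) v t ∧ σ.mem 12 (σ.mem 18 t) ≠ table t v) {D q : ℕ}
    (hlast : I.Last H t v D q)
    (h31 : τ.reg 31 = σ.reg 31 + 1) (h32 : τ.reg 32 = σ.reg 32) (h33 : τ.reg 33 = σ.reg 33)
    (h8 : τ.mem 8 = σ.mem 8) (h9 : τ.mem 9 = σ.mem 9) (h10 : τ.mem 10 = σ.mem 10)
    (h14 : τ.mem 14 = σ.mem 14) (h19 : τ.mem 19 = σ.mem 19)
    (h11 : ∀ e, τ.mem 11 e = if e = σ.reg 31 then (t : ℕ) else σ.mem 11 e)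
    (h12 : ∀ e, τ.mem 12 e = if e = σ.reg 31 then D else σ.mem 12 e)
    (h13 : ∀ e, τ.mem 13 e = if e = σ.reg 31 then q else σ.mem 13 e)
    (h18 : ∀ x, τ.mem 18 x = if x = (t : ℕ) then σ.reg 31 else σ.mem 18 x) :
    I.PairInv H pos v (pos t + 1) τ (Function.update ct t (ct t + 1)) := by
  have hcur : ∀ x : Fin n, x ≠ t → τ.mem 18 x = σ.mem 18 x := fun x hx => by
    rw [h18, if_neg (by rwa [Fin.val_inj])]
  have hcurt : τ.mem 18 t = σ.reg 31 := by rw [h18, if_pos rfl]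
  have hold12 : ∀ x : Fin n, x ≠ t → τ.mem 12 (τ.mem 18 x) = σ.mem 12 (σ.mem 18 x) := fun x hx => by
    rw [hcur x hx, h12, if_neg (h.cur_lt x).ne]
  have hold13 : ∀ x : Fin n, x ≠ t → τ.mem 13 (τ.mem 18 x) = σ.mem 13 (σ.mem 18 x) := fun x hx => by
    rw [hcur x hx, h13, if_neg (h.cur_lt x).ne]
  have hnew12 : τ.mem 12 (τ.mem 18 t) = D := by rw [hcurt, h12, if_pos rfl]
  have hnew13 : τ.mem 13 (τ.mem 18 t) = q := by rw [hcurt, h13, if_pos rfl]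
  have hpvt := hpos.lt_of_below hvt
  -- the new chain
  have hchain : v ≠ t → ∃ l, I.Chain H pos (pos v + 1) t l ∧ ct t + 1 = l.length ∧
      I.Entry H t l D q := by
    intro hne
    obtain ⟨l, hl, hct, hE⟩ := h.chain t (.inl (hpvt.resolve_left hne))
    rw [if_neg (lt_irrefl _)] at hl
    obtain ⟨hexc, hD⟩ := hev.resolve_left hne
    rw [hT.dist _ _ _ hv] at hD
    exact ⟨v :: l, hl.cons hT hpos hv hE hexc hD, by simp [hct], hlast⟩
  have hb := h.base_le
  constructor
  · refine ⟨?_, ?_, ?_, ?_, ?_, ?_, ?_, ?_, ?_⟩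
    · rw [h31, h.total, Finset.sum_update_of_mem (Finset.mem_univ t),
        ← Finset.add_sum_erase _ _ (Finset.mem_univ t), Finset.sdiff_singleton_eq_erase]
      omega
    · omega
    · rw [h32, h33]; exact h.off_le
    · intro x
      rw [h18, h31]
      have := h.cur_lt x
      split_ifs <;> omega
    · intro x
      have hk : σ.reg 31 + 1 - σ.reg 32 = (σ.reg 31 - σ.reg 32) + 1 := by omega
      have he : σ.reg 32 + (σ.reg 31 - σ.reg 32) = σ.reg 31 := by omega
      rw [h31, h32, h33, h14, hk, replay, he, h11, if_pos rfl, h18]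
      by_cases hx : (t : ℕ) = x
      · rw [if_pos hx, if_pos hx.symm]
      · rw [if_neg hx, if_neg (Ne.symm hx), h.cur_eq x]
        refine replay_congr rfl fun e _ he' => ?_
        rw [h11, if_neg (by omega)]
    · intro x
      by_cases hx : x = t
      · subst hx
        rw [Function.update_self]
        -- The entry for the failure at `x` itself is not part of a chain; it is the `+ 1` in the
        -- bound. Later failures come after `x` in the order and are not above it, so its chain need
        -- not be followed any further.
        by_cases hne : v = x
        · subst hne
          obtain ⟨l, hl, hct, -⟩ := h.chain v (.inr ⟨rfl, le_rfl⟩)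
          have := hl.length_le hT hM
          omega
        · obtain ⟨l, hl, hct, -⟩ := hchain hne
          have := hl.length_le hT hM
          omega
      · rw [Function.update_of_ne hx]
        exact h.ct_le x
    · intro x hx
      by_cases hxt : x = t
      · subst hxt
        rw [if_pos (Nat.lt_succ_self _), Function.update_self, hnew12, hnew13]
        refine hchain ?_
        rintro rfl
        omega
      · rw [Function.update_of_ne hxt, hold12 x hxt, hold13 x hxt]
        have hne : pos x ≠ pos t := fun hc => hxt (hpos.inj _ _ hc)
        obtain ⟨l, hl, hct, hE⟩ := h.chain x (by omega)
        refine ⟨l, hl.mono ?_, hct, hE⟩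
        split_ifs <;> omega
    · intro v' p' hp' hv'
      rw [h31, h33]
      refine (h.answer v' p' hp' hv').congr (Nat.le_succ _) le_rfl (by rw [h8]) (by rw [h9])
        (by rw [h10]) ?_ ?_ ?_ (by simp [h14])
      · intro e he; rw [h11, if_neg he.ne]
      · intro e he; rw [h12, if_neg he.ne]
      · intro e he; rw [h13, if_neg he.ne]
    · rw [h19]; exact h.zero
  · intro x hx
    rw [h19]
    rcases Nat.lt_succ_iff_lt_or_eq.1 hx with hx | hx
    · exact h.flag x hx
    · rw [hpos.inj _ _ hx]; exact hflag
  · intro x hx hbx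
    by_cases hxt : x = t
    · subst hxt
      rw [hnew12, hnew13]
      exact hlast.good
    · rw [hold12 x hxt, hold13 x hxt]
      have hne : pos x ≠ pos t := fun hc => hxt (hpos.inj _ _ hc)
      exact h.good x (by omega) hbx
  · rw [h31, h32]
    have := h.short
    omega

theorem wp_logEvent (hW : I.Fits table W) (hM : 1 ≤ M) (hT : I.FailureTable H table)
    (hC : I.Ctx table pos deg σ) (hv : I.tree v = some p) (hvt : I.Below v t)
    (h : I.PairInv H pos v (pos t) σ ct) (hflag : σ.mem 19 (t + 1) ≠ 0 ↔ I.Below v t)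
    (hev : v = t ∨ I.Exceptional (H v) v t ∧ σ.mem 12 (σ.mem 18 t) ≠ table t v)
    (h35 : σ.reg 35 = v) (h37 : σ.reg 37 = t) (h38 : σ.reg 38 = table t v) :
    Wp W logEvent σ t₀ fun τ t' => I.PairInv H pos v (pos t + 1) τ
      (Function.update ct t (ct t + 1)) ∧ t' ≤ t₀ + 60 + 60 * deg t := by
  rw [logEvent, wp_block_cons]
  refine Wp.mono_frame (wp_searchParent hW hT hC hv hvt h35 h37 h38) fun τ t' hs ⟨hlast, ht⟩ => ?_
  have e31 : τ.reg 31 = σ.reg 31 := hs.reg 31 (by decide)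
  have e37 : τ.reg 37 = t := (hs.reg 37 (by decide)).trans h37
  have e38 : τ.reg 38 = table t v := (hs.reg 38 (by decide)).trans h38
  have hm : ∀ a, τ.mem a = σ.mem a := fun a => hs.mem a (by simp [searchParent, WordCmd.arrs, block, forLoop])
  have hE := h.toLogInv.le_square
  have hsq := hW.squares
  have hsucc : (σ.reg 31 + 1) % 2 ^ W = σ.reg 31 + 1 := Nat.mod_eq_of_lt (by nlinarith)
  simp only [wp_block_cons, wp_block_nil, wp_store, wp_assign, WordExpr.eval_add,
    WordExpr.eval_reg, WordState.setMem_reg, e31, e37, e38, hW.one, hsucc]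
  refine ⟨h.log hM hT hC.order hv hflag hvt hev hlast ?_ ?_ ?_ ?_ ?_ ?_ ?_ ?_ ?_ ?_ ?_ ?_, ?_⟩
  · simp
  · simp [hs.reg 32 (by decide)]
  · simp [hs.reg 33 (by decide)]
  all_goals first
    | (funext e; simp [hm])
    | (intro e; simp [hm])
    | skip
  simp
  omega

/-- The time bound is amortized. The sum over `ct` is a potential: constant work is paid for every
pair, and the neighbour scan for `t` is charged to the entry it creates. -/
theorem wp_pairStep (hW : I.Fits table W) (hM : 1 ≤ M) (hT : I.FailureTable H table)
    (hC : I.Ctx table pos deg σ) (hv : I.tree v = some p) (hk : k < n)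
    (h : I.PairInv H pos v k σ ct) (h35 : σ.reg 35 = v) (h36 : σ.reg 36 = k) :
    Wp W pairStep σ t₀ fun τ t' => ∃ ct', I.PairInv H pos v (k + 1) τ ct' ∧
      t' + ∑ x, ct x * (60 + 60 * deg x) ≤ t₀ + 140 + ∑ x, ct' x * (60 + 60 * deg x) := by
  obtain ⟨t, rfl, ht⟩ := hC.order.get k hk
  have hsq := hW.squares
  have hk1 : (pos t + 1) % 2 ^ W = pos t + 1 := Nat.mod_eq_of_lt (by omega)
  have hone := hW.one
  have htn := t.2
  -- after the flag of `t` has been set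
  have main : ∀ (τ : WordState) (t₁ : ℕ), SameOutside [37] [19] σ τ → τ.reg 37 = t →
      (∀ x, x ≠ (t + 1 : ℕ) → τ.mem 19 x = σ.mem 19 x) →
      (τ.mem 19 (t + 1) ≠ 0 ↔ I.Below v t) → t₁ ≤ t₀ + 40 →
      Wp W (block [.branch (A 19 (R 37 + 1)) (block [testEvent, .branch (R 40) logEvent .skip])
        .skip]) τ t₁ fun τ t' => ∃ ct', I.PairInv H pos v (pos t + 1) τ ct' ∧
      t' + ∑ x, ct x * (60 + 60 * deg x) ≤ t₀ + 140 + ∑ x, ct' x * (60 + 60 * deg x) := by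
    intro τ t₁ hs e37 e19 hflag ht₁
    have hCτ : I.Ctx table pos deg τ := hC.congr hs (by decide) (by decide)
    have hP : I.PairInv H pos v (pos t) τ ct := by
      refine h.congr hs (by decide) (by decide) ?_ fun x hx => ?_
      · rw [e19 0 (by omega)]; exact h.zero
      · rw [e19 (x + 1) ?_]
        · exact h.flag x hx
        · intro hc
          have : x = t := Fin.ext (by omega)
          subst this
          exact lt_irrefl _ hx
    have e35 : τ.reg 35 = v := (hs.reg 35 (by decide)).trans h35
    simp only [wp_block_cons, wp_block_nil, wp_branch, wp_skip, WordExpr.eval_load,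
      WordExpr.eval_add, WordExpr.eval_reg, e37, hone, eval_succ hW]
    refine ⟨fun h1 => ?_, fun h1 => ⟨ct, hP.skip hC.order.inj hflag fun h2 =>
      absurd h1 (hflag.2 h2), by simp; omega⟩⟩
    have hvt := hflag.1 h1
    refine Wp.mono_frame (wp_testEvent hW hT hCτ hv hvt e35 e37) fun ρ t₂ hsρ ⟨e38, e40, ht₂⟩ => ?_
    have hCρ : I.Ctx table pos deg ρ := hCτ.congr hsρ (by decide) (by decide)
    have hm19 : ρ.mem 19 = τ.mem 19 := hsρ.mem 19 (by decide)
    have hm12 : ρ.mem 12 = τ.mem 12 := hsρ.mem 12 (by decide)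
    have hm18 : ρ.mem 18 = τ.mem 18 := hsρ.mem 18 (by decide)
    have hPρ : I.PairInv H pos v (pos t) ρ ct :=
      hP.congr hsρ (by decide) (by decide) (by rw [hm19]; exact hP.zero)
        (by rw [hm19]; exact hP.flag)
    have hflagρ : ρ.mem 19 (t + 1) ≠ 0 ↔ I.Below v t := by rw [hm19]; exact hflag
    rw [← hm12, ← hm18] at e40
    simp only [WordExpr.cost_load, WordExpr.cost_add, WordExpr.cost_reg, WordExpr.cost_one] at ht₂
    refine ⟨fun h2 => ?_, fun h2 => ⟨ct, hPρ.skip hC.order.inj hflagρ fun _ => ?_, ?_⟩⟩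
    · refine Wp.mono (wp_logEvent hW hM hT hCρ hv hvt hPρ hflagρ (e40.1 h2)
        ((hsρ.reg 35 (by decide)).trans e35) ((hsρ.reg 37 (by decide)).trans e37) e38)
        fun ρ' t₃ ⟨hP', ht₃⟩ => ⟨_, hP', ?_⟩
      have hsum : ∑ x, Function.update ct t (ct t + 1) x * (60 + 60 * deg x) =
          ∑ x, ct x * (60 + 60 * deg x) + (60 + 60 * deg t) := by
        rw [← Finset.add_sum_erase _ _ (Finset.mem_univ t),
          ← Finset.add_sum_erase _ (fun x => ct x * (60 + 60 * deg x)) (Finset.mem_univ t),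
          Function.update_self, Finset.sum_congr rfl (g := fun x => ct x * (60 + 60 * deg x))]
        · ring
        · intro x hx
          rw [Function.update_of_ne (Finset.ne_of_mem_erase hx)]
      rw [hsum]
      simp at ht₃ ⊢
      omega
    · have hno : ¬ _ := fun hc => e40.2 hc h2
      rw [not_or, not_and, not_not] at hno
      refine ⟨hno.1, ?_⟩
      -- Nothing is logged because `t` is not exceptional or its distance is the one logged last;
      -- `Chain.good` says that the old entry still serves.
      obtain ⟨l, hl, -, hE⟩ := hPρ.chain t
        (.inl ((hC.order.lt_of_below hvt).resolve_left hno.1))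
      rw [if_neg (lt_irrefl _)] at hl
      exact hl.good hT hC.order hv hvt hno.1 hE fun hexc => by
        rw [hno.2 hexc, hT.dist _ _ _ hv]
    · simp
      omega
  rw [pairStep, wp_block_cons, wp_assign, wp_block_cons]
  simp only [wp_branch, wp_store, WordExpr.eval_add, WordExpr.eval_sub, WordExpr.eval_load,
    WordExpr.eval_reg, WordExpr.eval_eq, h36, hone, hk1, ht, Nat.add_sub_cancel,
    WordState.setReg_reg, WordState.setReg_mem, if_true, Nat.reduceEqDiff, if_false, h35, ne_eq,
    ite_eq_right_iff, one_ne_zero, imp_false, not_not, Fin.val_inj, eval_succ hW, hC.par]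
  have hsame : ∀ y, SameOutside [37] [19] σ ((σ.setReg 37 t).setMem 19 (t + 1) y) := by
    refine fun y => ⟨fun x hx => ?_, fun a ha => ?_⟩
    · simp at hx; simp [hx]
    · simp at ha; funext e; simp [ha]
  refine ⟨fun htv => ?_, fun htv => ?_⟩
  · refine main _ _ (hsame _) (by simp) (fun x hx => by simp [hx]) ?_ (by simp)
    simp [htv, Below.refl]
  · refine main _ _ (hsame _) (by simp) (fun x hx => by simp [hx]) ?_ (by simp)
    have htv' : v ≠ t := fun hc => htv hc.symm
    simp only [WordState.setMem_mem, and_self, if_true]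
    -- The flag is inherited from the parent, which comes earlier in the order. Flags are indexed by
    -- vertex codes, so a missing parent reads cell `0`, which stays `0`.
    cases hpt : I.tree t with
    | none =>
      simp only [vertexCode, h.zero, ne_eq, not_true, false_iff]
      intro hc
      obtain ⟨pt, hpt', -⟩ := hc.exists_parent htv'
      rw [hpt] at hpt'
      simp at hpt'
    | some pt =>
      have := h.flag pt (hC.order.parent t pt hpt)
      rw [vertexCode, this]
      exact ⟨fun hb => hb.step hpt, fun hb => hb.of_ne htv' hpt⟩

end SourcedGraph

/-- Store the current entries of all vertices, and begin a new block of the log. -/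
def newSnapshot : WordCmd :=
  block [
    .assign 33 (R 33 + R 0),
    forLoop 46 0 0 (.store 14 (R 33 + R 46) (A 18 (R 46))),
    .assign 32 (R 31)]

/-- Process the failure at a tree vertex. -/
def logFailure : WordCmd :=
  block [
    .store 8 (R 35) (R 33),
    .store 9 (R 35) (R 32),
    forLoop 36 0 0 pairStep,
    .store 10 (R 35) (R 31)]

/-- Process a failure. -/
def vertexStep : WordCmd :=
  block [
    .assign 35 (A 6 (R 34 + 1) - 1),
    .branch (A 3 (R 35))
      (block [.branch (ltE (R 31 - R 32) (R 0)) .skip newSnapshot, logFailure]) .skip]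

/-- Compute the log. -/
def buildLog : WordCmd :=
  block [.assign 31 1, .assign 32 1, .assign 33 0, forLoop 34 0 0 vertexStep]

/-! ### Snapshots and the loop over all failures -/

namespace SourcedGraph

variable {n M : ℕ} {I : SourcedGraph n M} {H : Fin n → SimpleGraph (Fin n)}
  {table : Fin n → Fin n → ℕ} {pos deg : Fin n → ℕ} {W : ℕ} {σ τ : WordState} {v t p : Fin n}
  {t₀ i k : ℕ} {ct : Fin n → ℕ}

/-- Overwriting the cells of `v` is safe while the failure at `v` is in progress, because its answer
is not yet part of the invariant. -/
theorem LogInv.write (h : I.LogInv H pos (pos v) k σ ct)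
    (hr : ∀ x, 31 ≤ x → x ≤ 33 → τ.reg x = σ.reg x)
    (hm : ∀ a, 11 ≤ a → τ.mem a = σ.mem a)
    (ha : ∀ a x, x ≠ (v : ℕ) → τ.mem a x = σ.mem a x) : I.LogInv H pos (pos v) k τ ct := by
  have e31 := hr 31 (by omega) (by omega)
  have e32 := hr 32 (by omega) (by omega)
  have e33 := hr 33 (by omega) (by omega)
  have e11 := hm 11 (by omega)
  have e12 := hm 12 (by omega)
  have e13 := hm 13 (by omega)
  have e14 := hm 14 (by omega)
  have e18 := hm 18 (by omega)
  have e19 := hm 19 (by omega)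
  refine ⟨?_, ?_, ?_, ?_, ?_, h.ct_le, ?_, ?_, by rw [e19]; exact h.zero⟩
  · rw [e31]; exact h.total
  · rw [e31, e32]; exact h.base_le
  · rw [e32, e33]; exact h.off_le
  · rw [e18, e31]; exact h.cur_lt
  · rw [e18, e31, e32, e33, e14, e11]; exact h.cur_eq
  · rw [e12, e13, e18]; exact h.chain
  · intro v' p' hp' hv'
    have hne : (v' : ℕ) ≠ v := fun hc => by
      rw [Fin.ext hc] at hv'
      exact lt_irrefl _ hv'
    rw [e31, e33]
    exact (h.answer v' p' hp' hv').congr le_rfl le_rfl (ha _ _ hne) (ha _ _ hne) (ha _ _ hne)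
      (by simp [e11]) (by simp [e12]) (by simp [e13]) (by simp [e14])

theorem LogInv.next (h : I.LogInv H pos i k σ ct)
    (hv : ∀ v p : Fin n, I.tree v = some p → pos v = i →
      I.Answer H (σ.reg 31) (σ.reg 33) σ.mem v) : I.LogInv H pos (i + 1) 0 σ ct := by
  refine ⟨h.total, h.base_le, h.off_le, h.cur_lt, h.cur_eq, h.ct_le, ?_, ?_, h.zero⟩
  · intro t ht
    obtain ⟨l, hl, hct, hE⟩ := h.chain t (by omega)
    refine ⟨l, hl.mono ?_, hct, hE⟩
    rw [if_neg (Nat.not_lt_zero _)]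
    split_ifs <;> omega
  · intro v p hp hlt
    rcases Nat.lt_succ_iff_lt_or_eq.1 hlt with hlt | hlt
    · exact h.answer v p hp hlt
    · exact hv v p hp hlt

/-- At least `n` entries separate the old base from the new one, while the snapshot offset grows by
exactly `n`. So the offset never exceeds the base, which bounds all snapshots by the length of the
log. -/
theorem wp_newSnapshot (hW : I.Fits table W) (hC : I.Ctx table pos deg σ)
    (h : I.LogInv H pos i 0 σ ct) (hfull : σ.reg 32 + n ≤ σ.reg 31) :
    Wp W newSnapshot σ t₀ fun τ t' => I.LogInv H pos i 0 τ ct ∧ τ.reg 31 ≤ τ.reg 32 + n ∧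
      t' ≤ t₀ + 20 + 20 * n := by
  have hsq := hW.squares
  have hE := h.le_square
  have hoff := h.off_le
  have hsum : ∀ x ≤ n, (σ.reg 33 + n + x) % 2 ^ W = σ.reg 33 + n + x := fun x hx =>
    Nat.mod_eq_of_lt (by nlinarith)
  rw [newSnapshot, wp_block_cons, wp_assign, wp_block_cons]
  simp only [WordExpr.eval_add, WordExpr.eval_reg, hC.size]
  rw [show (σ.reg 33 + n) % 2 ^ W = σ.reg 33 + n from hsum 0 (Nat.zero_le _)]
  refine wp_forLoop 0 n (by simp) (Nat.zero_le _) (by omega) (by simp [hC.size]) (by decide)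
    (by decide)
    (fun j τ t' => (∀ x < j, τ.mem 14 (σ.reg 33 + n + x) = σ.mem 18 x) ∧
      (∀ x < σ.reg 33 + n, τ.mem 14 x = σ.mem 14 x) ∧ t' ≤ t₀ + 10 + 20 * j) ?_ ?_ ?_
  · simp
  · rintro j τ t' - hj hs hreg hlim ⟨h1, h2, ht⟩
    have e33 : τ.reg 33 = σ.reg 33 + n := by rw [hs.reg 33 (by decide)]; simp
    have e18 : τ.mem 18 = σ.mem 18 := by rw [hs.mem 18 (by decide)]; simp
    simp only [wp_store, WordExpr.eval_add, WordExpr.eval_reg, WordExpr.eval_load, e33, hreg,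
      hsum j hj.le, e18]
    refine ⟨fun x hx => ?_, fun x hx => ?_, by simp; omega⟩
    · rcases Nat.lt_succ_iff_lt_or_eq.1 hx with hx | rfl
      · simp [h1 x hx, hx.ne]
      · simp
    · simp [h2 x hx]
      omega
  · rintro τ t' hs hreg ⟨h1, h2, ht⟩
    have e31 : τ.reg 31 = σ.reg 31 := by rw [hs.reg 31 (by decide)]; simp
    have e33 : τ.reg 33 = σ.reg 33 + n := by rw [hs.reg 33 (by decide)]; simp
    have hm : ∀ a, a ≠ 14 → τ.mem a = σ.mem a := fun a ha => by
      rw [hs.mem a (by simpa [WordCmd.arrs] using ha)]; simp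
    have e8 := hm 8 (by omega)
    have e9 := hm 9 (by omega)
    have e10 := hm 10 (by omega)
    have e11 := hm 11 (by omega)
    have e12 := hm 12 (by omega)
    have e13 := hm 13 (by omega)
    have e18 := hm 18 (by omega)
    simp only [wp_block_cons, wp_block_nil, wp_assign, WordExpr.eval_reg, e31]
    refine ⟨⟨?_, ?_, ?_, ?_, ?_, h.ct_le, ?_, ?_, ?_⟩, by simp [e31], by simp; omega⟩
    · simp [e31, h.total]
    · simp [e31]
    · simp [e33]
      omega
    · simpa [e18, e31] using h.cur_lt
    · intro x
      simp [e18, e31, e33, replay, h1 x x.2]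
    · simpa [e12, e13, e18] using h.chain
    · intro v p hp hv
      refine (h.answer v p hp hv).congr (by simp [e31]) (by simp [e33]) (by simp [e8])
        (by simp [e9]) (by simp [e10]) (by simp [e11]) (by simp [e12]) (by simp [e13]) ?_
      simpa using h2
    · simpa [hm 19 (by omega)] using h.zero

/-- At most `n` entries precede this failure in the current block and it adds at most `n` more. This
gives the replay length `2 * n`. -/
theorem wp_logFailure (hW : I.Fits table W) (hM : 1 ≤ M) (hT : I.FailureTable H table)
    (hC : I.Ctx table pos deg σ) (hv : I.tree v = some p) (h : I.LogInv H pos (pos v) 0 σ ct)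
    (hshort : σ.reg 31 ≤ σ.reg 32 + n) (h35 : σ.reg 35 = v) :
    Wp W logFailure σ t₀ fun τ t' => ∃ ct', I.LogInv H pos (pos v + 1) 0 τ ct' ∧
      t' + ∑ x, ct x * (60 + 60 * deg x) ≤
        t₀ + (30 + 160 * n) + ∑ x, ct' x * (60 + 60 * deg x) := by
  have hsq := hW.squares
  rw [logFailure, wp_block_cons, wp_store, wp_block_cons, wp_store, wp_block_cons]
  simp only [WordExpr.eval_reg, WordState.setMem_reg, h35]
  have hs₀ : SameOutside [] [8, 9] σ ((σ.setMem 8 v (σ.reg 33)).setMem 9 v (σ.reg 32)) := by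
    refine ⟨fun _ _ => rfl, fun a ha => ?_⟩
    simp at ha
    funext x
    simp [ha]
  have h₀ : I.LogInv H pos (pos v) 0 ((σ.setMem 8 v (σ.reg 33)).setMem 9 v (σ.reg 32)) ct := by
    refine h.write (fun _ _ _ => rfl) (fun a ha => hs₀.mem a ?_) (fun a x hx => by simp [hx])
    simp
    omega
  have hC₀ := hC.congr hs₀ (by decide) (by decide)
  have e8₀ : ((σ.setMem 8 v (σ.reg 33)).setMem 9 v (σ.reg 32)).mem 8 v = σ.reg 33 := by simp
  have e9₀ : ((σ.setMem 8 v (σ.reg 33)).setMem 9 v (σ.reg 32)).mem 9 v = σ.reg 32 := by simp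
  have r35 := hs₀.reg 35 (by decide)
  have r31 := hs₀.reg 31 (by decide)
  have r32 := hs₀.reg 32 (by decide)
  have r33 := hs₀.reg 33 (by decide)
  generalize ((σ.setMem 8 v (σ.reg 33)).setMem 9 v (σ.reg 32)) = σ₁ at *
  refine wp_forLoop 0 n (by simp) (Nat.zero_le _) (by omega) hC₀.size (by decide)
    (by decide)
    (fun k τ t' => ∃ ct', I.PairInv H pos v k τ ct' ∧ t' + ∑ x, ct x * (60 + 60 * deg x) ≤
      t₀ + 15 + 160 * k + ∑ x, ct' x * (60 + 60 * deg x)) ?_ ?_ ?_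
  · refine ⟨ct, ⟨?_, by simp, by simp, ?_⟩, by simp⟩
    · refine h₀.congr (rs := [36]) (as := []) ⟨fun x hx => ?_, fun _ _ => rfl⟩ (by decide)
        (by decide) h₀.zero
      simp at hx
      simp [hx]
    · simp [r31, r32]
      omega
  · rintro k τ t' - hk hs hreg hlim ⟨ct', hP, ht⟩
    have hCτ := hC₀.congr hs (by decide) (by decide)
    refine Wp.mono (wp_pairStep hW hM hT hCτ hv hk hP
      ((hs.reg 35 (by decide)).trans (r35.trans h35)) hreg) ?_
    rintro ρ t'' ⟨ct'', hP', ht''⟩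
    refine ⟨ct'', hP'.congr (rs := [36]) (as := []) ⟨fun x hx => ?_, fun _ _ => rfl⟩ (by decide)
        (by decide) hP'.zero hP'.flag, by omega⟩
    simp at hx
    simp [hx]
  · rintro τ t' hs hreg ⟨ct', hP, ht⟩
    simp only [wp_block_cons, wp_block_nil, wp_store, WordExpr.eval_reg,
      (hs.reg 35 (by decide)).trans (r35.trans h35)]
    refine ⟨ct', LogInv.next (i := pos v) (k := n) ?_ ?_, by simp; omega⟩
    · refine hP.toLogInv.write (fun _ _ _ => rfl) (fun a ha => ?_) (fun a x hx => by simp [hx])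
      exact WordState.setMem_mem_of_ne _ _ _ (by omega)
    · intro v' p' hp' hpv'
      obtain rfl := hC.order.inj _ _ hpv'
      have e8 : τ.mem 8 = σ₁.mem 8 := hs.mem 8 (by decide)
      have e9 : τ.mem 9 = σ₁.mem 9 := hs.mem 9 (by decide)
      have e32 : τ.reg 32 = σ₁.reg 32 := hs.reg 32 (by decide)
      have e33 : τ.reg 33 = σ₁.reg 33 := hs.reg 33 (by decide)
      have hb := hP.base_le
      have hsh := hP.short
      constructor
      · simp [e9, e9₀]
        omega
      · simp
      · simp [e9, e9₀]
        omega
      · simp [e8, e8₀, e33, r33]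
      · intro t ht
        refine ⟨τ.mem 18 t, by simpa using hP.cur_lt t, ?_, by
          simpa using hP.good t (hC.order.lt t) ht⟩
        -- The current entry number is by invariant the replay from the last snapshot up to now, and
        -- now is the recorded end of the failure.
        rw [hP.cur_eq t]
        simp only [e8, e8₀, e9, e9₀, e32, e33, r32, r33, WordState.setMem_mem, Nat.reduceEqDiff,
          false_and, if_false, true_and, if_true]
        exact replay_congr rfl fun e _ _ => by simp

theorem wp_vertexStep (hW : I.Fits table W) (hM : 1 ≤ M) (hT : I.FailureTable H table)
    (hC : I.Ctx table pos deg σ) (hi : i < n) (h : I.LogInv H pos i 0 σ ct)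
    (h34 : σ.reg 34 = i) :
    Wp W vertexStep σ t₀ fun τ t' => ∃ ct', I.LogInv H pos (i + 1) 0 τ ct' ∧
      t' + ∑ x, ct x * (60 + 60 * deg x) ≤
        t₀ + (80 + 180 * n) + ∑ x, ct' x * (60 + 60 * deg x) := by
  obtain ⟨v, rfl, hv⟩ := hC.order.get i hi
  have hsq := hW.squares
  have hi1 : (pos v + 1) % 2 ^ W = pos v + 1 := Nat.mod_eq_of_lt (by omega)
  simp only [vertexStep, wp_block_cons, wp_assign, wp_branch, WordExpr.eval_sub,
    WordExpr.eval_load, WordExpr.eval_add, WordExpr.eval_reg, h34, hW.one, hi1, hv,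
    Nat.add_sub_cancel, WordState.setReg_reg, WordState.setReg_mem, if_true, hC.par, wp_skip,
    wp_block_nil]
  have hs₀ : SameOutside [35] [] σ (σ.setReg 35 v) := by
    refine ⟨fun x hx => ?_, fun _ _ => rfl⟩
    simp at hx
    simp [hx]
  have hC₀ := hC.congr hs₀ (by decide) (by decide)
  have h₀ := h.congr hs₀ (by decide) (by decide) h.zero
  have r35 : (σ.setReg 35 v).reg 35 = v := by simp
  have r31 := hs₀.reg 31 (by decide)
  have r32 := hs₀.reg 32 (by decide)
  have r0 := hs₀.reg 0 (by decide)
  cases hp : I.tree v with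
  | none =>
    simp only [vertexCode, ne_eq, not_true, false_imp_iff, true_and, forall_const]
    refine ⟨ct, h₀.next fun v' p' hp' hpv' => ?_, by simp; omega⟩
    rw [hC.order.inj _ _ hpv', hp] at hp'
    simp at hp'
  | some p =>
    simp only [vertexCode, ne_eq, Nat.add_eq_zero_iff, one_ne_zero, and_false, not_false_iff,
      false_imp_iff, and_true, forall_const, WordExpr.eval_lt, WordExpr.eval_sub,
      WordExpr.eval_reg]
    generalize σ.setReg 35 v = σ₁ at *
    have hsize := hC₀.size
    refine ⟨fun hlt => ?_, fun hlt => ?_⟩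
    · refine Wp.mono (wp_logFailure hW hM hT hC₀ hp h₀ ?_ r35) ?_
      · simp [hsize] at hlt
        omega
      · rintro τ t' ⟨ct', h', ht'⟩
        simp at ht' ⊢
        exact ⟨ct', h', by omega⟩
    · have hb := h₀.base_le
      refine Wp.mono_frame (wp_newSnapshot hW hC₀ h₀ ?_) ?_
      · simp [hsize] at hlt
        omega
      rintro τ t' hs ⟨h', hsh, ht'⟩
      refine Wp.mono (wp_logFailure hW hM hT (hC₀.congr hs (by decide) (by decide)) hp h' hsh
        ((hs.reg 35 (by decide)).trans r35)) ?_
      rintro ρ t'' ⟨ct', h'', ht''⟩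
      simp at ht' ht'' ⊢
      exact ⟨ct', h'', by omega⟩

theorem wp_buildLog (hW : I.Fits table W) (hM : 1 ≤ M) (hT : I.FailureTable H table)
    (hC : I.Ctx table pos deg σ) (hz : ∀ a x, 8 ≤ a → a ≤ 19 → (a ≤ 14 ∨ 18 ≤ a) → σ.mem a x = 0) :
    Wp W buildLog σ t₀ fun τ t' => ∃ ct, I.LogInv H pos n 0 τ ct ∧
      t' ≤ t₀ + 20 + n * (100 + 180 * n) + ∑ x, ct x * (60 + 60 * deg x) := by
  have hsq := hW.squares
  rw [buildLog, wp_block_cons, wp_assign, wp_block_cons, wp_assign, wp_block_cons, wp_assign,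
    wp_block_cons]
  simp only [hW.one, WordExpr.eval_zero]
  have hs₀ : SameOutside [31, 32, 33] [] σ (((σ.setReg 31 1).setReg 32 1).setReg 33 0) := by
    refine ⟨fun x hx => ?_, fun _ _ => rfl⟩
    simp at hx
    simp [hx]
  have hC₀ := hC.congr hs₀ (by decide) (by decide)
  refine wp_forLoop 0 n (by simp) (Nat.zero_le _) (by omega) hC₀.size (by decide) (by decide)
    (fun i τ t' => ∃ ct, I.LogInv H pos i 0 τ ct ∧
      t' ≤ t₀ + 10 + i * (100 + 180 * n) + ∑ x, ct x * (60 + 60 * deg x)) ?_ ?_ ?_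
  -- Entry numbers start at 1. Entry 0 is never written and reads as "no candidate"; the initial
  -- snapshot is all zeros and refers to it.
  · refine ⟨fun _ => 0, ⟨by simp, by simp, by simp, ?_, ?_, by simp, ?_, by simp, ?_⟩, by simp⟩
    · simp [hz 18]
    · simp [hz 18, hz 14, replay]
    · intro t _
      exact ⟨[], .nil, rfl, by simp [Entry, hz 12, hz 13]⟩
    · simp [hz 19]
  · rintro i τ t' - hi hs hreg hlim ⟨ct, h, ht⟩
    refine Wp.mono (wp_vertexStep hW hM hT (hC₀.congr hs (by decide) (by decide)) hi h hreg) ?_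
    rintro ρ t'' ⟨ct', h', ht'⟩
    refine ⟨ct', h'.congr (rs := [34]) (as := []) ⟨fun x hx => ?_, fun _ _ => rfl⟩ (by decide)
        (by decide) h'.zero, ?_⟩
    · simp at hx
      simp [hx]
    · have : (i + 1) * (100 + 180 * n) = i * (100 + 180 * n) + (100 + 180 * n) := by ring
      omega
  · rintro τ t' hs hreg ⟨ct, h, ht⟩
    rw [wp_block_nil]
    exact ⟨ct, h, by omega⟩

end SourcedGraph

/-- Announce the sizes of the arrays of the data structure. -/
def announce : WordCmd :=
  block [
    .assign 14 (R 33 + R 0),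
    .assign 13 (R 31),
    .assign 12 (R 31),
    .assign 11 (R 31),
    .assign 10 (R 0),
    .assign 9 (R 0),
    .assign 8 (R 0),
    .assign 7 (R 0),
    .assign 6 (R 0 + 1),
    .assign 5 1,
    .store 5 0 (R 0),
    .assign 4 0,
    .assign 3 (R 0),
    .assign 2 0,
    .assign 1 0,
    .assign 0 0]

/-- The preprocessing, for edge failures as well as for vertex failures. -/
def preprocessing : WordCmd :=
  block [buildAdjacency, buildOrder, buildLog, announce]

/-! ### The finished data structure and the preprocessing bounds -/

namespace SourcedGraph

variable {n M : ℕ} {I : SourcedGraph n M} {H : Fin n → SimpleGraph (Fin n)}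
  {table : Fin n → Fin n → ℕ} {pos deg : Fin n → ℕ} {W : ℕ} {σ τ : WordState} {v t p : Fin n}
  {t₀ i k : ℕ} {ct : Fin n → ℕ}

/-- What the query relies on. -/
structure Oracle (I : SourcedGraph n M) (H : Fin n → SimpleGraph (Fin n)) (pos : Fin n → ℕ)
    (E off : ℕ) (mem : ℕ → ℕ → ℕ) : Prop where
  size : mem 5 0 = n
  par : ∀ t : Fin n, mem 3 t = vertexCode (I.tree t)
  order : I.OrderArray pos (mem 6)
  treeWeight : ∀ t p : Fin n, I.tree t = some p → mem 7 t = I.weight s(p, t)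
  answer : ∀ v p : Fin n, I.tree v = some p → I.Answer H E off mem v
  idle : mem 8 n = 0 ∧ mem 9 n = 0 ∧ mem 10 n = 0
  log_le : E ≤ 1 + n * (n + 1)
  off_le : off ≤ E

theorem OrderArray.congr {q q' : ℕ → ℕ} (h : I.OrderArray pos q)
    (hq : ∀ k < n, q' (k + 1) = q (k + 1)) : I.OrderArray pos q' :=
  ⟨h.lt, h.inj, fun k hk => by rw [hq k hk]; exact h.get k hk, h.parent⟩

/-- Registers do not survive into the query, so `n` is saved in an array cell, and register `0` is
cleared last since it is read until then. The order array needs `n + 1` cells because it starts with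
the code `0`. -/
theorem wp_announce (hW : I.Fits table W) (hC : I.Ctx table pos deg σ)
    (h : I.LogInv H pos n 0 σ ct) :
    Wp W announce σ t₀ fun τ t' => I.Oracle H pos (σ.reg 31) (σ.reg 33) (structureMem 15 τ) ∧
      structureWords 15 τ ≤ 7 * n + 2 + 4 * σ.reg 31 ∧ t' ≤ t₀ + 60 := by
  have hsq := hW.squares
  have hE := h.le_square
  have hb := h.base_le
  have hoff := h.off_le
  have h1 : (σ.reg 33 + n) % 2 ^ W = σ.reg 33 + n := Nat.mod_eq_of_lt (by nlinarith)
  have h2 : (n + 1) % 2 ^ W = n + 1 := Nat.mod_eq_of_lt (by omega)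
  simp only [announce, wp_block_cons, wp_block_nil, wp_assign, wp_store, WordExpr.eval_add,
    WordExpr.eval_reg, WordExpr.eval_zero, WordState.setReg_reg, WordState.setMem_reg, hW.one,
    Nat.reduceEqDiff, if_false, hC.size, h1, h2]
  refine ⟨?_, ?_, by simp⟩
  · constructor
    · simp [structureMem]
    · intro t
      simp [structureMem, hC.par]
    · refine hC.order.congr fun k hk => ?_
      simp [structureMem, hk]
    · intro t p hp
      simp [structureMem, hC.adj.treeWeight t p hp]
    · intro v p hp
      refine (h.answer v p hp (hC.order.lt v)).congr le_rfl le_rfl ?_ ?_ ?_ ?_ ?_ ?_ ?_ <;>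
        simp +contextual [structureMem]
    · simp [structureMem]
    · exact hE
    · exact hoff.trans hb
  · simp [structureWords, Finset.sum_range_succ]
    omega

/-- The scans cost the degree of `t` once per entry for `t`; a uniform bound on the entries and the
handshake identity turn this into a multiple of `n + m`. -/
theorem sum_entries_le (hct : ∀ x, ct x ≤ k) (hdeg : ∑ x, deg x = 2 * i) :
    ∑ x, ct x * (60 + 60 * deg x) ≤ k * (60 * n + 120 * i) := by
  calc ∑ x, ct x * (60 + 60 * deg x) ≤ ∑ x, k * (60 + 60 * deg x) :=
        Finset.sum_le_sum fun x _ => Nat.mul_le_mul_right _ (hct x)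
    _ = k * (60 * n + 120 * i) := by
        rw [← Finset.mul_sum, Finset.sum_add_distrib, ← Finset.mul_sum, hdeg]
        simp
        left
        ring

theorem wp_preprocessing (hW : I.Fits table W) (hM : 1 ≤ M) (hT : I.FailureTable H table) :
    Wp W preprocessing (I.input table) 0 fun τ t' => ∃ (pos : Fin n → ℕ) (E off : ℕ),
      I.Oracle H pos E off (structureMem 15 τ) ∧ E ≤ 1 + n * (chainBound n M + 1) ∧
      structureWords 15 τ ≤ 7 * n + 2 + 4 * E ∧
      t' ≤ 200 + 200 * I.edges.length + (n + 1) * (20 + 30 * n) + n * (100 + 180 * n) +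
        (chainBound n M + 1) * (60 * n + 120 * I.edges.length) := by
  have hsq := hW.squares
  have par₀ : ∀ x : Fin n, (I.input table).mem 3 x = vertexCode (I.tree x) := fun x => by
    simp [input, WordState.start, cells]
  have zero₀ : ∀ a x, 5 ≤ a → (I.input table).mem a x = 0 := fun a x ha => by
    simp only [input, WordState.start]
    split <;> first | omega | rfl
  rw [preprocessing, wp_block_cons]
  refine Wp.mono_frame (wp_buildAdjacency (I := I) hW.rows (by omega) hW.edges ?_ ?_ ?_ ?_ par₀
    (fun i => zero₀ _ _ (by omega))) fun σ₁ t₁ hs₁ ⟨hadj, h20, ht₁⟩ => ?_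
  · simp [input, WordState.start]
  · intro i hi
    simp [input, WordState.start, cells, hi]
  · intro i hi
    simp [input, WordState.start, cells, hi]
  · intro i hi
    simp [input, WordState.start, cells, hi]
  have size₁ : σ₁.reg 0 = n := by
    rw [hs₁.reg 0 (by decide)]
    simp [input, WordState.start]
  have par₁ : ∀ x : Fin n, σ₁.mem 3 x = vertexCode (I.tree x) := by
    rw [hs₁.mem 3 (by decide)]
    exact par₀
  rw [wp_block_cons]
  refine Wp.mono_frame (wp_buildOrder (I := I) (by omega) size₁ par₁ ?_)
    fun σ₂ t₂ hs₂ ⟨⟨pos, hpos⟩, ht₂⟩ => ?_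
  · rw [hs₁.mem 6 (by decide)]
    exact zero₀ _ _ (by omega)
  have hC : I.Ctx table pos (fun x => σ₂.mem 15 x) σ₂ := by
    have e7 := hs₂.mem 7 (by decide)
    have e15 := hs₂.mem 15 (by decide)
    have e16 := hs₂.mem 16 (by decide)
    have e17 := hs₂.mem 17 (by decide)
    refine ⟨(hs₂.reg 0 (by decide)).trans size₁, (hs₂.reg 20 (by decide)).trans h20, ?_, ?_,
      ⟨?_, ?_, ?_, ?_⟩, hpos, fun _ => rfl⟩
    · rw [hs₂.mem 3 (by decide)]; exact par₁
    · intro t v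
      rw [hs₂.mem 4 (by decide), hs₁.mem 4 (by decide)]
      have hlt : (t : ℕ) * n + v < n * n := row_lt t.2 v.2
      have hv := v.2
      simp only [input, WordState.start, cells, hlt, dif_pos]
      congr 1 <;> apply Fin.ext
      · simp only [Fin.divNat]
        rw [mul_comm, Nat.mul_add_div (by omega), Nat.div_eq_of_lt hv, add_zero]
      · simp only [Fin.modNat]
        rw [mul_comm, Nat.mul_add_mod, Nat.mod_eq_of_lt hv]
    · rw [e15]; exact hadj.count
    · rw [e15, e16, e17]; exact hadj.sound
    · rw [e15, e16]; exact hadj.complete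
    · rw [e7]; exact hadj.treeWeight
  have zero₂ : ∀ a x, 8 ≤ a → a ≤ 19 → (a ≤ 14 ∨ 18 ≤ a) → σ₂.mem a x = 0 := by
    intro a x h1 h2 h3
    rw [hs₂.mem a ?_, hs₁.mem a ?_]
    · exact zero₀ _ _ (by omega)
    · simp [buildAdjacency, addArc, WordCmd.arrs, block, forLoop]
      omega
    · simp [buildOrder, WordCmd.arrs, block, forLoop]
      omega
  rw [wp_block_cons]
  refine Wp.mono_frame (wp_buildLog hW hM hT hC zero₂) fun σ₃ t₃ hs₃ ⟨ct, hL, ht₃⟩ => ?_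
  rw [wp_block_cons]
  refine Wp.mono (wp_announce hW (hC.congr hs₃ (by decide) (by decide)) hL)
    fun τ t₄ ⟨hO, hwords, ht₄⟩ => ?_
  rw [wp_block_nil]
  refine ⟨pos, _, _, hO, ?_, hwords, ?_⟩
  · rw [hL.total]
    have : ∑ x, ct x ≤ ∑ _x : Fin n, (chainBound n M + 1) :=
      Finset.sum_le_sum fun x _ => hL.ct_le x
    simpa using this
  · have := sum_entries_le hL.ct_le hC.adj.count
    omega

end SourcedGraph

/-! ## The query -/

/-- Restore the numbers of the log entries of all vertices from the snapshot and the log. -/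
def restore : WordCmd :=
  block [
    .assign 21 (A 8 (R 35)),
    .assign 22 (A 9 (R 35)),
    .assign 23 (A 10 (R 35)),
    forLoop 24 0 20 (.store 16 (R 24) (A 14 (R 21 + R 24))),
    forLoop 24 (R 22) 23 (.store 16 (A 11 (R 24)) (R 24))]

/-- Choose between the last log entry and the parent in the tree. -/
def chooseParent : WordCmd :=
  block [
    .assign 26 (A 16 (R 25)),
    .assign 27 (A 12 (R 26)),
    .assign 28 (A 13 (R 26)),
    .branch (eqE (R 25) (R 35)) .skip
      (block [
        .assign 29 (A 18 (A 3 (R 25) - 1)),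
        .branch (R 29)
          (block [
            .assign 29 (R 29 + A 7 (R 25)),
            .branch (R 27)
              (.branch (ltE (R 27) (R 29)) .skip
                (block [.assign 27 (R 29), .assign 28 (A 3 (R 25))]))
              (block [.assign 27 (R 29), .assign 28 (A 3 (R 25))])])
          .skip]),
    .store 18 (R 25) (R 27),
    .store 15 (R 25) (R 28)]

/-- Decide whether the next vertex is below the failure. -/
def markVertex : WordCmd :=
  block [
    .assign 25 (A 6 (R 24 + 1) - 1),
    .branch (eqE (R 25) (R 35)) (.store 17 (R 25 + 1) 1)
      (.store 17 (R 25 + 1) (A 17 (A 3 (R 25))))]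

/-- Find the parent of the next vertex. -/
def answerStep : WordCmd :=
  block [
    markVertex,
    .branch (A 17 (R 25 + 1)) chooseParent (.store 15 (R 25) (A 3 (R 25)))]

/-- Write the shortest-path tree for the failure at the vertex in register `35`, or the given tree if
register `35` holds `n`. -/
def answerTree : WordCmd :=
  block [.assign 20 (A 5 0), restore, forLoop 24 0 20 answerStep]

/-- Find the failing tree vertex in a query for vertex failures. -/
def selectVertex : WordCmd :=
  .branch (A 3 (R 0)) (.assign 35 (R 0)) (.assign 35 (A 5 0))

/-- Find the lower endpoint of the failing tree edge in a query for edge failures. -/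
def selectEdge : WordCmd :=
  .branch (eqE (A 3 (R 1)) (R 0 + 1)) (.assign 35 (R 1))
    (.branch (eqE (A 3 (R 0)) (R 1 + 1)) (.assign 35 (R 0)) (.assign 35 (A 5 0)))

/-! ### Combining the logged candidate with the tree edge -/

namespace SourcedGraph

variable {n M : ℕ} {I : SourcedGraph n M} {H : Fin n → SimpleGraph (Fin n)}
  {table : Fin n → Fin n → ℕ} {pos : Fin n → ℕ} {W E off : ℕ} {σ τ : WordState} {v t p : Fin n}
  {t₀ f : ℕ}

/-- The tree edge is used unless the logged bound is better. -/
theorem Good.last (hF : I.IsFailure v (H v)) (hs : v ≠ I.source) (hvt : I.Below v t) (hne : v ≠ t)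
    (hp : I.tree t = some p) {D q : ℕ} (hG : I.Good H v t D q) :
    I.Last H t v
      (if distCode (I.repl H v p) ≠ 0 ∧
          (D = 0 ∨ distCode (I.repl H v p) + I.weight s(p, t) ≤ D)
        then distCode (I.repl H v p) + I.weight s(p, t) else D)
      (if distCode (I.repl H v p) ≠ 0 ∧
          (D = 0 ∨ distCode (I.repl H v p) + I.weight s(p, t) ≤ D)
        then p + 1 else q) := by
  have hadj : I.repl H v p ≠ ⊤ → (H v).Adj p t := fun htop => by
    refine (hF.adj_child hp hne.symm).resolve_right ?_
    rintro ⟨rfl, hiso⟩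
    exact htop (wdist_eq_top_of_isolated hs hiso)
  have hexc : I.repl H v t < I.repl H v p + (I.weight s(p, t) : ℕ) → D = distCode (I.repl H v t) :=
    fun hlt => hG.tight <| .inr ⟨hvt, hne, fun p' hp' => by
      obtain rfl := Option.some.inj (hp.symm.trans hp')
      exact hlt⟩
  -- If `p` is unreachable, or the tree edge is strictly too long, then a reachable `t` is
  -- exceptional and the logged bound is tight. Otherwise the tree edge attains the distance and no
  -- valid logged bound is smaller. If `t` itself is unreachable, no candidate can exist and `D =
  -- 0`.
  rcases distCode_cases (I.repl H v p) with ⟨hk, hk'⟩ | ⟨k, hk, hk'⟩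
  · rw [hk', if_neg (by simp), if_neg (by simp)]
    rcases distCode_cases (I.repl H v t) with ⟨hj, hj'⟩ | ⟨j, hj, hj'⟩
    · have hD : D = 0 := by
        by_contra hD
        obtain ⟨x, -, hx, hd⟩ := hG.parent hD
        have h1 := wdist_adj_le (w := I.weight) (u := I.source) hx
        change I.repl H v t ≤ _ at h1
        rw [hj] at h1
        have := h1.trans hd
        simp at this
      exact ⟨by rw [hj', hD], hG.zero, fun h => absurd hD h⟩
    · have hD := hexc (by rw [hj, hk]; simp)
      refine ⟨hD, hG.zero, fun h => ?_⟩
      obtain ⟨x, hx, hxt, hd⟩ := hG.parent h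
      refine ⟨x, hx, hxt, le_antisymm ?_ (wdist_adj_le hxt)⟩
      rw [hD, hj'] at hd
      rw [hj]
      simpa using hd
  · have hpt := hadj (by rw [hk]; simp)
    have hle := wdist_adj_le (w := I.weight) (u := I.source) hpt
    change I.repl H v t ≤ I.repl H v p + _ at hle
    rw [hk] at hle
    rcases distCode_cases (I.repl H v t) with ⟨hj, hj'⟩ | ⟨j, hj, hj'⟩
    · rw [hj, ← Nat.cast_add] at hle
      simp at hle
    rw [hj] at hle
    norm_cast at hle
    by_cases hlt : j < k + I.weight s(p, t)
    · have hD := hexc (by rw [hj, hk]; exact_mod_cast hlt)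
      rw [hj'] at hD
      rw [hk', hD, if_neg (by omega), if_neg (by omega)]
      subst hD
      refine ⟨hj'.symm, fun h => by omega, fun h => ?_⟩
      obtain ⟨x, hx, hxt, hd⟩ := hG.parent h
      refine ⟨x, hx, hxt, le_antisymm ?_ (wdist_adj_le hxt)⟩
      rw [hj]
      simpa using hd
    · have hjk : j = k + I.weight s(p, t) := by omega
      have hD : D = 0 ∨ k + 1 + I.weight s(p, t) ≤ D := by
        by_contra! hD
        obtain ⟨x, hx, hxt, hd⟩ := hG.parent hD.1
        have h1 := (wdist_adj_le (w := I.weight) (u := I.source) hxt).trans hd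
        change I.repl H v t ≤ _ at h1
        rw [hj] at h1
        norm_cast at h1
        omega
      rw [hk', if_pos ⟨by omega, hD⟩, if_pos ⟨by omega, hD⟩]
      refine ⟨by rw [hj']; omega, by omega, fun _ => ⟨p, rfl, hpt, ?_⟩⟩
      rw [hk, hj, hjk]
      simp

end SourcedGraph

/-! ### Correctness of the query program -/

namespace SourcedGraph

variable {n M : ℕ} {I : SourcedGraph n M} {H : Fin n → SimpleGraph (Fin n)}
  {table : Fin n → Fin n → ℕ} {pos : Fin n → ℕ} {W E off : ℕ} {σ τ : WordState} {v t p : Fin n}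
  {t₀ f k : ℕ}

theorem Oracle.congr {mem mem' : ℕ → ℕ → ℕ} (h : I.Oracle H pos E off mem)
    (hm : ∀ a < 15, mem' a = mem a) : I.Oracle H pos E off mem' := by
  refine ⟨?_, ?_, ?_, ?_, fun v p hp => ?_, ?_, h.log_le, h.off_le⟩
  · rw [hm 5 (by omega)]; exact h.size
  · rw [hm 3 (by omega)]; exact h.par
  · rw [hm 6 (by omega)]; exact h.order
  · rw [hm 7 (by omega)]; exact h.treeWeight
  · exact (h.answer v p hp).congr le_rfl le_rfl (by rw [hm 8 (by omega)]) (by rw [hm 9 (by omega)])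
      (by rw [hm 10 (by omega)]) (by simp [hm 11]) (by simp [hm 12]) (by simp [hm 13])
      (by simp [hm 14])
  · rw [hm 8 (by omega), hm 9 (by omega), hm 10 (by omega)]; exact h.idle

/-- The state in which the query for the failure `f` works. -/
structure Ready (I : SourcedGraph n M) (H : Fin n → SimpleGraph (Fin n)) (pos : Fin n → ℕ)
    (E off f : ℕ) (σ : WordState) : Prop where
  oracle : I.Oracle H pos E off σ.mem
  size : σ.reg 20 = n
  fail : σ.reg 35 = f
  cases : f = n ∨ ∃ v p : Fin n, f = v ∧ I.tree v = some p

theorem Ready.congr (h : I.Ready H pos E off f σ) {rs as : List ℕ} (hs : SameOutside rs as σ τ)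
    (hr : 20 ∉ rs ∧ 35 ∉ rs) (ha : ∀ a ∈ as, 15 ≤ a) : I.Ready H pos E off f τ :=
  ⟨h.oracle.congr fun a hlt => hs.mem a fun hc => by have := ha a hc; omega,
    (hs.reg 20 hr.1).trans h.size, (hs.reg 35 hr.2).trans h.fail, h.cases⟩

/-- Copying the snapshot and then storing each entry number at its vertex performs exactly the
recursion of `replay`. The time is linear because the recorded range has at most `2 * n` entries. -/
theorem wp_restore (hW : I.Fits table W) (hR : I.Ready H pos E off f σ) :
    Wp W restore σ t₀ fun τ t' => (∀ v t : Fin n, f = v → I.Below v t →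
      I.Good H v t (τ.mem 12 (τ.mem 16 t)) (τ.mem 13 (τ.mem 16 t))) ∧ t' ≤ t₀ + 60 + 60 * n := by
  have hsq := hW.squares
  have hE := hR.oracle.log_le
  have hEoff := hR.oracle.off_le
  have hnn : n * (n + 1) = n * n + n := by ring
  have hbounds : σ.mem 8 f ≤ off ∧ σ.mem 9 f ≤ σ.mem 10 f ∧
      σ.mem 10 f < 2 ^ W ∧ σ.mem 10 f ≤ σ.mem 9 f + 2 * n := by
    rcases hR.cases with rfl | ⟨v, p, rfl, hp⟩
    -- The value `n` stands for "no tree element failed". Cell `n` lies behind the announced length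
    -- and reads `0`, so the range to replay is empty.
    · obtain ⟨h1, h2, h3⟩ := hR.oracle.idle
      omega
    · obtain ⟨h1, h2, h3, h4, -⟩ := hR.oracle.answer v p hp
      exact ⟨h4, h1, by omega, h3⟩
  obtain ⟨hb1, hb2, hb3, hb4⟩ := hbounds
  have hsum : ∀ x < n, (σ.mem 8 f + x) % 2 ^ W = σ.mem 8 f + x := fun x hx =>
    Nat.mod_eq_of_lt (by omega)
  rw [restore, wp_block_cons, wp_assign, wp_block_cons, wp_assign, wp_block_cons, wp_assign,
    wp_block_cons]
  simp only [WordExpr.eval_reg, WordExpr.eval_load, WordState.setReg_reg, WordState.setReg_mem,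
    hR.fail, Nat.reduceEqDiff, if_false]
  refine wp_forLoop 0 n (by simp) (Nat.zero_le _) (by omega) (by simp [hR.size]) (by decide)
    (by decide) (fun j τ t' => (∀ x < j, τ.mem 16 x = σ.mem 14 (σ.mem 8 f + x)) ∧
      t' ≤ t₀ + 30 + 20 * j) ?_ ?_ ?_
  · simp
  · rintro j τ t' - hj hs hreg hlim ⟨h1, ht⟩
    have e21 : τ.reg 21 = σ.mem 8 f := by rw [hs.reg 21 (by decide)]; simp
    have e14 : τ.mem 14 = σ.mem 14 := by rw [hs.mem 14 (by decide)]; simp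
    simp only [wp_store, WordExpr.eval_add, WordExpr.eval_reg, WordExpr.eval_load, e21, hreg,
      hsum j hj, e14]
    refine ⟨fun x hx => ?_, by simp; omega⟩
    rcases Nat.lt_succ_iff_lt_or_eq.1 hx with hx | rfl
    · simp [h1 x hx, hx.ne]
    · simp
  · rintro τ t' hs hreg ⟨h1, ht⟩
    have e22 : τ.reg 22 = σ.mem 9 f := by rw [hs.reg 22 (by decide)]; simp
    have e23 : τ.reg 23 = σ.mem 10 f := by rw [hs.reg 23 (by decide)]; simp
    have e11 : τ.mem 11 = σ.mem 11 := by rw [hs.mem 11 (by decide)]; simp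
    have e12 : τ.mem 12 = σ.mem 12 := by rw [hs.mem 12 (by decide)]; simp
    have e13 : τ.mem 13 = σ.mem 13 := by rw [hs.mem 13 (by decide)]; simp
    rw [wp_block_cons]
    refine wp_forLoop (σ.mem 9 f) (σ.mem 10 f) (by simp [e22]) hb2 hb3 e23 (by decide)
      (by decide) (fun j ρ t'' => (∀ x < n, ρ.mem 16 x =
        replay (fun x => σ.mem 14 (σ.mem 8 f + x)) (σ.mem 11) (σ.mem 9 f) (j - σ.mem 9 f) x) ∧
        t'' ≤ t₀ + 40 + 20 * n + 20 * (j - σ.mem 9 f)) ?_ ?_ ?_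
    · simp [replay]
      exact ⟨h1, by omega⟩
    · rintro j ρ t'' hlo hj hs' hreg' hlim' ⟨h2, ht'⟩
      have e11' : ρ.mem 11 = σ.mem 11 := by rw [hs'.mem 11 (by decide), e11]
      simp only [wp_store, WordExpr.eval_reg, WordExpr.eval_load, hreg', e11']
      refine ⟨fun x hx => ?_, by simp; omega⟩
      rw [show j + 1 - σ.mem 9 f = j - σ.mem 9 f + 1 by omega, replay,
        show σ.mem 9 f + (j - σ.mem 9 f) = j by omega, ← h2 x hx]
      simp [eq_comm]
    · rintro ρ t'' hs' hreg' ⟨h2, ht'⟩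
      rw [wp_block_nil]
      refine ⟨fun v t hv hvt => ?_, by omega⟩
      rcases hR.cases with hc | ⟨v', p, hv', hp⟩
      · have := v.2
        omega
      · obtain rfl : v = v' := Fin.ext (by omega)
        obtain ⟨e, -, he, hG⟩ := (hR.oracle.answer v p hp).good t hvt
        rw [h2 t t.2, hv, he, hs'.mem 12 (by decide), hs'.mem 13 (by decide), e12, e13]
        exact hG

/-- For `t = v` the tree edge is unusable and the entry is taken as it is; such an entry is always
tight. Below, the distance of the tree parent has already been computed and `Good.last` decides. -/
theorem wp_chooseParent (hW : I.Fits table W) (hT : I.FailureTable H table)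
    (hR : I.Ready H pos E off v σ) {pv : Fin n} (hv : I.tree v = some pv) (hvt : I.Below v t)
    (h25 : σ.reg 25 = t) (hG : I.Good H v t (σ.mem 12 (σ.mem 16 t)) (σ.mem 13 (σ.mem 16 t)))
    (hd : ∀ p, I.tree t = some p → I.Below v p → σ.mem 18 p = distCode (I.repl H v p)) :
    Wp W chooseParent σ t₀ fun τ t' => I.Last H t v (τ.mem 18 t) (τ.mem 15 t) ∧
      (∀ x : Fin n, x ≠ t → τ.mem 18 x = σ.mem 18 x ∧ τ.mem 15 x = σ.mem 15 x) ∧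
      t' ≤ t₀ + 60 := by
  have hF := hT.fail v pv hv
  have hs := ne_source_of_tree hv
  simp only [chooseParent, wp_block_cons, wp_block_nil, wp_assign, wp_branch, wp_skip, wp_store,
    WordExpr.eval_add, WordExpr.eval_sub, WordExpr.eval_reg, WordExpr.eval_load,
    WordExpr.eval_eq, WordExpr.eval_lt, hW.one, WordState.setReg_reg, WordState.setReg_mem, h25,
    hR.fail, if_true, Nat.reduceEqDiff, if_false, ne_eq, ite_eq_right_iff, one_ne_zero, imp_false,
    not_not, Fin.val_inj]
  refine ⟨?_, fun hne => ?_⟩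
  · rintro rfl
    refine ⟨?_, fun x hx => by simp [Fin.val_inj, hx, h25], by simp [add_assoc]⟩
    simp only [WordState.setMem_mem, WordState.setMem_reg, WordState.setReg_reg, h25,
      Nat.reduceEqDiff, false_and, if_false, true_and, if_true]
    have hD := hG.tight (.inl rfl)
    refine ⟨hD, hG.zero, fun h => ?_⟩
    obtain ⟨x, hx, hxt, hdx⟩ := hG.parent h
    refine ⟨x, hx, hxt, le_antisymm ?_ (wdist_adj_le hxt)⟩
    rcases distCode_cases (I.repl H t t) with ⟨hj, hj'⟩ | ⟨j, hj, hj'⟩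
    · exact absurd (hD.trans hj') h
    · rw [hD, hj'] at hdx
      rw [hj]
      simpa using hdx
  · have hne' : v ≠ t := fun h => hne h.symm
    obtain ⟨p, hp, hvp⟩ := hvt.exists_parent hne'
    have hL := hG.last hF hs hvt hne' hp
    have hpar : σ.mem 3 t = p + 1 := by rw [hR.oracle.par, hp]; rfl
    have hwt : σ.mem 7 t = I.weight s(p, t) := hR.oracle.treeWeight t p hp
    have hle : I.weight s(p, t) ≤ M := I.weight_le _ ((I.graph.mem_edgeSet).2 (tree_spec hp).1)
    have hsum : (distCode (I.repl H v p) + I.weight s(p, t)) % 2 ^ W =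
        distCode (I.repl H v p) + I.weight s(p, t) :=
      Nat.mod_eq_of_lt (by rw [← hT.dist _ _ _ hv]; have := hW.table p v; omega)
    simp only [hpar, Nat.add_sub_cancel, hd p hp hvp, hwt, hsum, not_lt]
    generalize distCode (I.repl H v p) = dp at *
    generalize σ.mem 12 (σ.mem 16 t) = D at *
    generalize σ.mem 13 (σ.mem 16 t) = q at *
    refine ⟨fun h1 => ⟨fun h2 => ⟨fun h3 => ?_, fun h3 => ?_⟩, fun h2 => ?_⟩, fun h1 => ?_⟩
    · rw [if_neg (by omega), if_neg (by omega)] at hL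
      exact ⟨by simpa [h25] using hL, fun x hx => by simp [Fin.val_inj, hx, h25], by simp [add_assoc]⟩
    · rw [if_pos ⟨h1, .inr h3⟩, if_pos ⟨h1, .inr h3⟩] at hL
      exact ⟨by simpa [h25] using hL, fun x hx => by simp [Fin.val_inj, hx, h25], by simp [add_assoc]⟩
    · rw [if_pos ⟨h1, .inl h2⟩, if_pos ⟨h1, .inl h2⟩] at hL
      exact ⟨by simpa [h25] using hL, fun x hx => by simp [Fin.val_inj, hx, h25], by simp [add_assoc]⟩
    · rw [if_neg (by omega), if_neg (by omega)] at hL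
      exact ⟨by simpa [h25] using hL, fun x hx => by simp [Fin.val_inj, hx, h25], by simp [add_assoc]⟩

/-- The first `k` vertices have been answered. -/
structure AnswerInv (I : SourcedGraph n M) (H : Fin n → SimpleGraph (Fin n)) (pos : Fin n → ℕ)
    (f k : ℕ) (σ : WordState) : Prop where
  zero : σ.mem 17 0 = 0
  flag : ∀ t : Fin n, pos t < k → (σ.mem 17 (t + 1) ≠ 0 ↔ ∃ v : Fin n, f = v ∧ I.Below v t)
  good : ∀ v t : Fin n, f = v → I.Below v t →
    I.Good H v t (σ.mem 12 (σ.mem 16 t)) (σ.mem 13 (σ.mem 16 t))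
  last : ∀ v t : Fin n, pos t < k → f = v → I.Below v t →
    I.Last H t v (σ.mem 18 t) (σ.mem 15 t)
  par : ∀ t : Fin n, pos t < k → (¬ ∃ v : Fin n, f = v ∧ I.Below v t) →
    σ.mem 15 t = vertexCode (I.tree t)

theorem wp_markVertex (hW : I.Fits table W) (hR : I.Ready H pos E off f σ)
    (h24 : σ.reg 24 = pos t) (h : I.AnswerInv H pos f (pos t) σ) :
    Wp W markVertex σ t₀ fun τ t' => τ.reg 25 = t ∧
      (τ.mem 17 (t + 1) ≠ 0 ↔ ∃ v : Fin n, f = v ∧ I.Below v t) ∧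
      (∀ x : ℕ, x ≠ t + 1 → τ.mem 17 x = σ.mem 17 x) ∧ t' ≤ t₀ + 30 := by
  obtain ⟨t', ht', hq⟩ := hR.oracle.order.get (pos t) (hR.oracle.order.lt t)
  obtain rfl := hR.oracle.order.inj _ _ ht'
  have hsq := hW.squares
  have hk1 : (pos t' + 1) % 2 ^ W = pos t' + 1 :=
    Nat.mod_eq_of_lt (by have := hR.oracle.order.lt t'; omega)
  have hpar := hR.oracle.par t'
  simp only [markVertex, wp_block_cons, wp_block_nil, wp_assign, wp_branch, wp_store,
    WordExpr.eval_sub, WordExpr.eval_load, WordExpr.eval_add, WordExpr.eval_reg, WordExpr.eval_eq,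
    h24, hW.one, hk1, hq, Nat.add_sub_cancel, WordState.setReg_reg, WordState.setReg_mem, if_true,
    Nat.reduceEqDiff, if_false, hR.fail, hpar, eval_succ hW, ne_eq, ite_eq_right_iff, one_ne_zero,
    imp_false, not_not]
  refine ⟨fun hf => ⟨by simp, ?_, fun x hx => by simp [hx], by simp [add_assoc]⟩,
    fun hf => ⟨by simp, ?_, fun x hx => by simp [hx], by simp [add_assoc]⟩⟩
  · simp
    exact ⟨t', hf.symm, .refl _⟩
  · simp only [WordState.setMem_mem, WordState.setReg_mem, true_and, if_true]
    have hiff : (∃ v : Fin n, f = v ∧ I.Below v t') ↔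
        ∃ p, I.tree t' = some p ∧ ∃ v : Fin n, f = v ∧ I.Below v p := by
      constructor
      · rintro ⟨v, hv, hvt⟩
        obtain ⟨p, hp, hvp⟩ := hvt.exists_parent fun hc => hf (by rw [hv, hc])
        exact ⟨p, hp, v, hv, hvp⟩
      · rintro ⟨p, hp, v, hv, hvp⟩
        exact ⟨v, hv, hvp.step hp⟩
    rw [hiff]
    cases hp : I.tree t' with
    | none => simp [vertexCode, h.zero]
    | some p =>
      simpa [vertexCode] using h.flag p (hR.oracle.order.parent _ _ hp)

theorem wp_answerStep (hW : I.Fits table W) (hT : I.FailureTable H table)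
    (hR : I.Ready H pos E off f σ) (hk : k < n) (h24 : σ.reg 24 = k)
    (h : I.AnswerInv H pos f k σ) :
    Wp W answerStep σ t₀ fun τ t' => I.AnswerInv H pos f (k + 1) τ ∧ t' ≤ t₀ + 110 := by
  obtain ⟨t, rfl, -⟩ := hR.oracle.order.get k hk
  have hpos : ∀ x, pos x < pos t + 1 → x ≠ t → pos x < pos t := fun x hx hne =>
    lt_of_le_of_ne (Nat.lt_succ_iff.1 hx) fun hc => hne (hR.oracle.order.inj _ _ hc)
  rw [answerStep, wp_block_cons]
  refine Wp.mono_frame (wp_markVertex hW hR h24 h) ?_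
  rintro ρ t₁ hs ⟨h25, hflag, hframe, ht₁⟩
  have hRρ := hR.congr hs (by decide) (by decide)
  have e12 := hs.mem 12 (by decide)
  have e13 := hs.mem 13 (by decide)
  have e15 := hs.mem 15 (by decide)
  have e16 := hs.mem 16 (by decide)
  have e18 := hs.mem 18 (by decide)
  have hzero : ρ.mem 17 0 = 0 := (hframe 0 (by omega)).trans h.zero
  have hflags : ∀ x : Fin n, pos x < pos t + 1 →
      (ρ.mem 17 (x + 1) ≠ 0 ↔ ∃ v : Fin n, f = v ∧ I.Below v x) := by
    intro x hx
    by_cases hxt : x = t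
    · rw [hxt]; exact hflag
    · rw [hframe (x + 1) (by simpa [Fin.val_inj] using hxt)]
      exact h.flag x (hpos x hx hxt)
  simp only [wp_block_cons, wp_block_nil, wp_branch, WordExpr.eval_load, WordExpr.eval_add,
    WordExpr.eval_reg, hW.one, h25, eval_succ hW]
  refine ⟨fun hb => ?_, fun hb => ?_⟩
  · obtain ⟨v, rfl, hvt⟩ := hflag.1 hb
    rcases hR.cases with hc | ⟨v', pv, hv', hpv⟩
    · have := v.2
      omega
    obtain rfl := Fin.ext hv'
    refine Wp.mono_frame (wp_chooseParent hW hT hRρ hpv hvt h25 ?_ ?_) ?_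
    · rw [e12, e13, e16]
      exact h.good v t rfl hvt
    · intro p hp hvp
      rw [e18]
      exact (h.last v p (hR.oracle.order.parent _ _ hp) rfl hvp).1
    · rintro τ t₂ hs' ⟨hlast, hother, ht₂⟩
      have e17' := hs'.mem 17 (by decide)
      have e16' := hs'.mem 16 (by decide)
      have e12' := hs'.mem 12 (by decide)
      have e13' := hs'.mem 13 (by decide)
      refine ⟨⟨by rw [e17']; exact hzero, by rw [e17']; exact hflags, ?_, ?_, ?_⟩, ?_⟩
      · rw [e12', e13', e16', e12, e13, e16]
        exact h.good
      · intro v' x hx hv' hvx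
        obtain rfl := Fin.ext hv'
        by_cases hxt : x = t
        · rw [hxt]; exact hlast
        · rw [(hother x hxt).1, (hother x hxt).2, e15, e18]
          exact h.last v x (hpos x hx hxt) rfl hvx
      · intro x hx hvx
        by_cases hxt : x = t
        · rw [hxt] at hvx
          exact absurd ⟨v, rfl, hvt⟩ hvx
        · rw [(hother x hxt).2, e15]
          exact h.par x (hpos x hx hxt) hvx
      · simp at ht₂
        omega
  · have hnb : ¬ ∃ v : Fin n, f = v ∧ I.Below v t := fun hc => hflag.2 hc hb
    simp only [wp_store, WordExpr.eval_load, WordExpr.eval_reg, h25, hRρ.oracle.par]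
    refine ⟨⟨by simpa using hzero, by simpa using hflags, ?_, ?_, ?_⟩, by simp; omega⟩
    · simpa [e12, e13, e16] using h.good
    · intro v x hx hv hvx
      have hxt : x ≠ t := by
        rintro rfl
        exact hnb ⟨v, hv, hvx⟩
      simpa [e15, e18, Fin.val_inj, hxt] using h.last v x (hpos x hx hxt) hv hvx
    · intro x hx hvx
      by_cases hxt : x = t
      · simp [hxt]
      · simpa [e15, Fin.val_inj, hxt] using h.par x (hpos x hx hxt) hvx

theorem wp_answerTree (hW : I.Fits table W) (hT : I.FailureTable H table)
    (hO : I.Oracle H pos E off σ.mem) (h35 : σ.reg 35 = f)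
    (hf : f = n ∨ ∃ v p : Fin n, f = v ∧ I.tree v = some p) (h0 : σ.mem 17 0 = 0) :
    Wp W answerTree σ t₀ fun τ t' =>
      (∀ v t : Fin n, f = v → I.Below v t → ∃ D, I.Last H t v D (τ.mem 15 t)) ∧
      (∀ t : Fin n, (¬ ∃ v : Fin n, f = v ∧ I.Below v t) → τ.mem 15 t = vertexCode (I.tree t)) ∧
      t' ≤ t₀ + 100 + 200 * n := by
  have hsq := hW.squares
  have hR : I.Ready H pos E off f (σ.setReg 20 n) := ⟨hO, by simp, by simp [h35], hf⟩
  rw [answerTree, wp_block_cons, wp_assign, wp_block_cons]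
  simp only [WordExpr.eval_load, WordExpr.eval_zero, hO.size]
  refine Wp.mono_frame (wp_restore hW hR) ?_
  rintro ρ t₁ hs ⟨hG, ht₁⟩
  have hRρ := hR.congr hs (by decide) (by decide)
  rw [wp_block_cons]
  refine wp_forLoop 0 n (by simp) (Nat.zero_le _) (by omega) hRρ.size (by decide) (by decide)
    (fun k τ t' => I.AnswerInv H pos f k τ ∧ t' ≤ t₁ + 10 + 120 * k) ?_ ?_ ?_
  · refine ⟨⟨?_, by simp, by simpa using hG, by simp, by simp⟩, by simp⟩
    simpa [hs.mem 17 (by decide)] using h0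
  · rintro k τ t' - hk hs' hreg hlim ⟨hinv, ht'⟩
    refine Wp.mono (wp_answerStep hW hT (hRρ.congr hs' (by decide) (by decide)) hk hreg hinv) ?_
    rintro ρ' t'' ⟨h1, ht''⟩
    exact ⟨⟨h1.zero, h1.flag, h1.good, h1.last, h1.par⟩, by omega⟩
  · rintro τ t' hs' hreg ⟨hinv, ht'⟩
    rw [wp_block_nil]
    refine ⟨fun v t hv hvt => ⟨_, hinv.last v t (hO.order.lt t) hv hvt⟩, fun t ht =>
      hinv.par t (hO.order.lt t) ht, ?_⟩
    simp at ht₁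
    omega

end SourcedGraph

/-! ## From the answer to the shortest-path tree -/

section

variable {V : Type*} {G H : SimpleGraph V} {w : Sym2 V → ℕ} {s : V} {par : V → Option V}

/-- Since weights are at least 1, every pointer leads to a strictly smaller distance. The pointers
thus form no cycle, and induction on the distance builds the parent path. -/
theorem isShortestPathTree_of_last_edge (hw : ∀ e ∈ H.edgeSet, 1 ≤ w e) (root : par s = none)
    (hpar : ∀ t, t ≠ s → H.Reachable s t → ∃ x, par t = some x ∧ H.Adj x t ∧
      wdist H w s x + (w s(x, t) : ℕ) = wdist H w s t)
    (unreachable : ∀ t, ¬ H.Reachable s t → par t = none) : IsShortestPathTree H w s par := by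
  have key : ∀ (d : ℕ) (t : V), wdist H w s t = d → ParentPath H w par s t d := by
    intro d
    induction d using Nat.strong_induction_on with
    | _ d ih =>
      intro t hd
      by_cases hts : t = s
      · subst hts
        rw [wdist_self] at hd
        obtain rfl : 0 = d := by exact_mod_cast hd
        exact .root
      · have hr : H.Reachable s t := by
          by_contra hc
          rw [← wdist_eq_top_iff (w := w), hd] at hc
          simp at hc
        obtain ⟨x, hx, hadj, hdx⟩ := hpar t hts hr
        have hne : wdist H w s x ≠ ⊤ := by
          intro hc
          rw [hc, hd] at hdx
          simp at hdx
        obtain ⟨d', hd'⟩ := ENat.ne_top_iff_exists.1 hne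
        rw [hd, ← hd'] at hdx
        have hdx' : d' + w s(x, t) = d := by exact_mod_cast hdx
        have := hw _ (H.mem_edgeSet.2 hadj)
        subst hdx'
        exact .step hx hadj (ih d' (by omega) x hd'.symm)
  refine ⟨root, fun t ht => ?_, unreachable⟩
  have hne : wdist H w s t ≠ ⊤ := fun hc => wdist_eq_top_iff.1 hc ht
  obtain ⟨d, hd⟩ := ENat.ne_top_iff_exists.1 hne
  exact ⟨d, key d t hd.symm, hd⟩

theorem ParentPath.transfer {t : V} {d : ℕ} (h : ParentPath G w par s t d)
    (hadj : ∀ t p, par t = some p → H.Adj p t) :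
    ParentPath H w par s t d ∧ wdist H w s t ≤ d := by
  induction h with
  | root => exact ⟨.root, by simp [wdist_self]⟩
  | step hp _ _ ih =>
    refine ⟨.step hp (hadj _ _ hp) ih.1, (wdist_adj_le (hadj _ _ hp)).trans ?_⟩
    push_cast
    gcongr
    exact ih.2

/-- If no tree edge is lost, the old tree paths survive, and they remain shortest because deletions
do not decrease distances. This covers the failures that do not touch the tree. -/
theorem IsShortestPathTree.transfer (h : IsShortestPathTree G w s par) (hle : H ≤ G)
    (hadj : ∀ t p, par t = some p → H.Adj p t) : IsShortestPathTree H w s par := by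
  have key : ∀ t, G.Reachable s t → ∃ d : ℕ, ParentPath H w par s t d ∧ (d : ℕ∞) = wdist H w s t := by
    intro t ht
    obtain ⟨d, hd, hdw⟩ := h.reachable t ht
    obtain ⟨h1, h2⟩ := hd.transfer hadj
    exact ⟨d, h1, le_antisymm (hdw.le.trans (wdist_mono hle s t)) h2⟩
  refine ⟨h.root, fun t ht => key t (ht.mono hle), fun t ht => h.unreachable t fun hc => ht ?_⟩
  obtain ⟨d, -, hd⟩ := key t hc
  by_contra hr
  rw [← wdist_eq_top_iff (w := w), ← hd] at hr
  simp at hr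

end

namespace SourcedGraph

variable {n M : ℕ} {I : SourcedGraph n M} {H : Fin n → SimpleGraph (Fin n)}
  {table : Fin n → Fin n → ℕ} {pos : Fin n → ℕ} {W E off : ℕ} {σ τ : WordState} {v t p : Fin n}
  {t₀ f k : ℕ}

/-- Vertices not below `v` keep their distances and parents, and their parents are not below `v`
either. The other vertices have a logged or tree edge that ends a shortest path, or are unreachable.
-/
theorem IsFailure.exists_tree (hF : I.IsFailure v (H v)) (hs : v ≠ I.source) {out : ℕ → ℕ}
    (hb : ∀ t : Fin n, I.Below v t → ∃ D, I.Last H t v D (out t))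
    (hnb : ∀ t : Fin n, ¬ I.Below v t → out t = vertexCode (I.tree t)) :
    ∃ par : Fin n → Option (Fin n), IsShortestPathTree (H v) I.weight I.source par ∧
      ∀ t : Fin n, out t = vertexCode (par t) := by
  have hex : ∀ t : Fin n, ∃ o : Option (Fin n), out t = vertexCode o ∧
      (t = I.source → o = none) ∧
      (t ≠ I.source → (H v).Reachable I.source t → ∃ x, o = some x ∧ (H v).Adj x t ∧
        I.repl H v x + (I.weight s(x, t) : ℕ) = I.repl H v t) ∧
      (¬ (H v).Reachable I.source t → o = none) := by
    intro t
    by_cases hvt : I.Below v t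
    · obtain ⟨D, hD, h0, h1⟩ := hb t hvt
      have hts := hvt.ne_source hs
      by_cases hr : (H v).Reachable I.source t
      · have hD0 : D ≠ 0 := by
          rw [hD, Ne, distCode_eq_zero, repl, wdist_eq_top_iff, not_not]
          exact hr
        obtain ⟨x, hx, hadj, hd⟩ := h1 hD0
        exact ⟨some x, hx, fun h => absurd h hts, fun _ _ => ⟨x, rfl, hadj, hd⟩,
          fun h => absurd hr h⟩
      · have hD0 : D = 0 := by
          rw [hD, distCode_eq_zero, repl, wdist_eq_top_iff]
          exact hr
        exact ⟨none, h0 hD0, fun _ => rfl, fun _ h => absurd h hr, fun _ => rfl⟩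
    · refine ⟨I.tree t, hnb t hvt, fun h => h ▸ I.isTree.root, fun hts hr => ?_, fun hr => ?_⟩
      · obtain ⟨p, hp⟩ := exists_parent (hr.mono hF.le) hts
        obtain ⟨hadj, hpr, htr, hd⟩ := tree_spec hp
        have hvp : ¬ I.Below v p := fun h => hvt (h.step hp)
        refine ⟨p, hp, hF.adj_of_ne hadj ?_ ?_, ?_⟩
        · rintro rfl; exact hvp (.refl _)
        · rintro rfl; exact hvt (.refl _)
        · rw [repl, repl, hF.wdist_of_not_below hvp hpr, hF.wdist_of_not_below hvt htr, hd]
          push_cast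
          rfl
      · refine I.isTree.unreachable t fun hc => hr ?_
        have := hF.wdist_of_not_below hvt hc
        by_contra hr
        rw [wdist_eq_top_iff.2 hr] at this
        simp at this
  choose par h1 h2 h3 h4 using hex
  refine ⟨par, isShortestPathTree_of_last_edge (fun e he => I.one_le_weight e ?_)
    (h2 _ rfl) h3 h4, h1⟩
  exact SimpleGraph.edgeSet_mono hF.le he

/-- A failure found by `sel` is answered correctly. -/
theorem Oracle.answersTree (hO : I.Oracle H pos E off (structureMem 15 σ))
    (hW : I.Fits table W) (hT : I.FailureTable H table) {sel : WordCmd} {args : List ℕ}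
    {H' : SimpleGraph (Fin n)} (hle : H' ≤ I.graph) (harrs : sel.arrs = [])
    (hsel : Wp W sel (WordState.start args (structureMem 15 σ)) 0 fun ρ t' => t' ≤ 30 ∧
      (ρ.reg 35 = n ∧ (∀ t p, I.tree t = some p → H'.Adj p t) ∨
        ∃ v p : Fin n, ρ.reg 35 = v ∧ I.tree v = some p ∧ H' = H v)) :
    AnswersTree W 15 (block [sel, answerTree]) args σ H' I.weight I.source (2000 * n) := by
  have hn := I.source.pos
  have hrun : Wp W (block [sel, answerTree]) (WordState.start args (structureMem 15 σ)) 0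
      fun τ t' => t' ≤ 2000 * n ∧ ∃ par : Fin n → Option (Fin n),
        IsShortestPathTree H' I.weight I.source par ∧
          ∀ t : Fin n, τ.mem 15 t = vertexCode (par t) := by
    rw [wp_block_cons]
    refine Wp.mono_frame hsel ?_
    rintro ρ t₁ hs ⟨ht₁, hcases⟩
    have hmem : ρ.mem = structureMem 15 σ := by
      funext a
      rw [hs.mem a (by simp [harrs])]
      rfl
    rw [wp_block_cons]
    refine Wp.mono (wp_answerTree (f := ρ.reg 35) hW hT (by rwa [hmem]) rfl ?_ ?_) ?_
    · exact hcases.imp (·.1) fun ⟨v, p, h, hp, _⟩ => ⟨v, p, h, hp⟩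
    · rw [hmem]; simp [structureMem]
    · rintro τ t' ⟨hb, hnb, ht'⟩
      rw [wp_block_nil]
      refine ⟨by omega, ?_⟩
      rcases hcases with ⟨h35, hadj⟩ | ⟨v, p, h35, hp, rfl⟩
      · refine ⟨I.tree, I.isTree.transfer hle hadj, fun t => hnb t ?_⟩
        rintro ⟨v, hv, -⟩
        have := v.2
        omega
      · refine (hT.fail v p hp).exists_tree (ne_source_of_tree hp) (fun t => hb v t h35)
          fun t hvt => hnb t ?_
        rintro ⟨v', hv', h⟩
        obtain rfl : v = v' := Fin.ext (by omega)
        exact hvt h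
  obtain ⟨τ, T, hr, hT', hpar⟩ := hrun
  refine ⟨τ, T, hr, by omega, fun j hj => ?_, hpar⟩
  rw [hr.sameOutside.mem j]
  · rfl
  · simp [WordCmd.arrs, block, harrs, answerTree, restore, answerStep, markVertex, chooseParent,
      forLoop]
    omega

end SourcedGraph

/-! ## The two kinds of failures -/

namespace SourcedGraph

variable {n M : ℕ} {I : SourcedGraph n M} {H : Fin n → SimpleGraph (Fin n)}
  {table : Fin n → Fin n → ℕ} {pos : Fin n → ℕ} {W E off : ℕ} {σ τ : WordState} {v t p : Fin n}

/-- The graph without the tree edge above `v`. -/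
def edgeFailure (I : SourcedGraph n M) (v : Fin n) : SimpleGraph (Fin n) :=
  match I.tree v with
  | none => I.graph
  | some p => I.deleteEdge s(p, v)

theorem edgeFailure_of_tree (hv : I.tree v = some p) : I.edgeFailure v = I.deleteEdge s(p, v) := by
  simp [edgeFailure, hv]

theorem isFailure_deleteEdge (hv : I.tree v = some p) : I.IsFailure v (I.deleteEdge s(p, v)) := by
  refine .inl fun x y => ?_
  simp only [deleteEdge, SimpleGraph.deleteEdges_adj, Set.mem_singleton_iff, Sym2.eq_iff, hv,
    Option.some.injEq]
  constructor
  · rintro ⟨h, hne⟩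
    exact ⟨h, fun h' => hne (.inr ⟨h'.1, h'.2.symm⟩), fun h' => hne (.inl ⟨h'.2.symm, h'.1⟩)⟩
  · rintro ⟨h, h1, h2⟩
    refine ⟨h, ?_⟩
    rintro (⟨hx, hy⟩ | ⟨hx, hy⟩)
    · exact h2 ⟨hy, hx.symm⟩
    · exact h1 ⟨hx, hy.symm⟩

theorem isFailure_deleteVertex : I.IsFailure v (I.deleteVertex v) :=
  .inr fun _ _ => SimpleGraph.deleteIncidenceSet_adj

theorem failureTable_edge : I.FailureTable I.edgeFailure I.edgeReplacement := by
  refine ⟨fun v p hv => ?_, fun t v p hv => ?_⟩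
  · rw [edgeFailure_of_tree hv]
    exact isFailure_deleteEdge hv
  · rw [repl, edgeFailure_of_tree hv]
    simp [edgeReplacement, hv]

theorem failureTable_vertex : I.FailureTable I.deleteVertex I.vertexReplacement :=
  ⟨fun _ _ _ => isFailure_deleteVertex, fun _ v p hv => by
    rw [vertexReplacement, if_neg (ne_source_of_tree hv)]⟩

theorem distCode_wdist_le {H : SimpleGraph (Fin n)} (hle : H ≤ I.graph) (u t : Fin n) :
    distCode (wdist H I.weight u t) ≤ n * M + 1 := by
  rcases distCode_cases (wdist H I.weight u t) with ⟨-, h⟩ | ⟨k, hk, h⟩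
  · omega
  · have := wdist_le_card_mul (w := I.weight)
      (fun e he => I.weight_le e (SimpleGraph.edgeSet_mono hle he)) (u := u) (v := t)
      (by rw [hk]; simp)
    rw [hk, Fintype.card_fin] at this
    have : k ≤ n * M := by exact_mod_cast this
    omega

theorem deleteEdge_le (e : Sym2 (Fin n)) : I.deleteEdge e ≤ I.graph :=
  SimpleGraph.deleteEdges_le _

theorem deleteVertex_le (v : Fin n) : I.deleteVertex v ≤ I.graph :=
  SimpleGraph.deleteIncidenceSet_le _ _

theorem edgeReplacement_le (t v : Fin n) : I.edgeReplacement t v ≤ n * M + 1 := by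
  rw [edgeReplacement]
  split
  · omega
  · exact distCode_wdist_le (deleteEdge_le _) _ _

theorem vertexReplacement_le (t v : Fin n) : I.vertexReplacement t v ≤ n * M + 1 := by
  rw [vertexReplacement]
  split_ifs
  · omega
  · exact distCode_wdist_le (deleteVertex_le _) _ _

/-! ### Word length and the asymptotic bounds -/

theorem length_edges_le (I : SourcedGraph n M) : I.edges.length ≤ n * n := by
  simpa using (I.edges_nodup.of_map _).length_le_card

theorem numEdges_eq (I : SourcedGraph n M) : I.numEdges = I.edges.length := by
  classical
  have h : I.graph.edgeSet = ((I.edges.map fun p => s(p.1, p.2)).toFinset : Set (Sym2 (Fin n))) := by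
    ext e
    rw [← I.mem_edges e]
    simp
  rw [numEdges, h, Set.ncard_coe_finset, List.toFinset_card_of_nodup I.edges_nodup, List.length_map]

/-- With `N = n + M ≥ 2`, the largest address is of order `n * m ≤ N ^ 3`, and all other quantities
are a small multiple of `N ^ 2`. The exponent 6 absorbs the constants, because `N ^ 3 ≥ 8` and `N ^
4 ≥ 16`. -/
theorem fits (hM : 1 ≤ M) (hW : (n + M) ^ 6 ≤ 2 ^ W) (htab : ∀ t v, table t v ≤ n * M + 1) :
    I.Fits table W := by
  have hn : 1 ≤ n := I.source.pos
  have hm := I.length_edges_le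
  obtain ⟨N, hN⟩ : ∃ N, N = n + M := ⟨_, rfl⟩
  have hN2 : 2 ≤ N := by omega
  rw [← hN] at hW
  have h16 : 16 ≤ N ^ 4 := by
    calc 16 = 2 ^ 4 := by norm_num
      _ ≤ N ^ 4 := Nat.pow_le_pow_left hN2 4
  have hbig : 16 * N ^ 2 ≤ N ^ 6 := by
    calc 16 * N ^ 2 ≤ N ^ 4 * N ^ 2 := Nat.mul_le_mul_right _ h16
      _ = N ^ 6 := by ring
  have hcube : 8 * N ^ 3 ≤ N ^ 6 := by
    calc 8 * N ^ 3 = 2 ^ 3 * N ^ 3 := by norm_num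
      _ ≤ N ^ 3 * N ^ 3 := Nat.mul_le_mul_right _ (Nat.pow_le_pow_left hN2 3)
      _ = N ^ 6 := by ring
  have hNN : 4 ≤ N ^ 2 := by nlinarith
  have hnn : n * n ≤ N ^ 2 := by nlinarith
  have hnM : n * M ≤ N ^ 2 := by nlinarith
  have hNsq : N ≤ N ^ 2 := by nlinarith
  have hN3 : N ^ 3 = N * N ^ 2 := by ring
  have hrow : n * (2 * I.edges.length) ≤ 2 * N ^ 3 := by
    calc n * (2 * I.edges.length) ≤ N * (2 * N ^ 2) :=
          Nat.mul_le_mul (by omega) (Nat.mul_le_mul_left _ (hm.trans hnn))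
      _ = 2 * N ^ 3 := by ring
  have hpos : 0 < N ^ 3 := by positivity
  exact ⟨by omega, by omega, by omega, fun t v => by have := htab t v; omega⟩

theorem mul_rpow_eq (hM : 1 ≤ M) (hn : 1 ≤ n) :
    ((M : ℝ) ^ (1 / 2 : ℝ) * (n : ℝ) ^ (3 / 2 : ℝ)) = n * √((M : ℝ) * n) := by
  have hn' : (0 : ℝ) < n := by exact_mod_cast hn
  rw [show (3 / 2 : ℝ) = 1 / 2 + 1 by norm_num, Real.rpow_add hn', Real.rpow_one,
    Real.sqrt_eq_rpow, Real.mul_rpow (by positivity) (by positivity)]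
  ring

/-- The factor 8 is `√64` from the chain bound; the extra entry for `v = t` is absorbed since the
minimum is at least 1. -/
theorem chainBound_succ_le (hM : 1 ≤ M) (hn : 1 ≤ n) :
    (chainBound n M : ℝ) + 1 ≤ 9 * min √((M : ℝ) * n) n ∧ 1 ≤ min √((M : ℝ) * n) n := by
  have hn' : (1 : ℝ) ≤ n := by exact_mod_cast hn
  have hM' : (1 : ℝ) ≤ M := by exact_mod_cast hM
  have h1 : 1 ≤ √((M : ℝ) * n) := by
    rw [Real.one_le_sqrt]
    nlinarith
  have h2 : (chainBound n M : ℝ) ≤ n := by exact_mod_cast min_le_left _ _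
  have h3 : (chainBound n M : ℝ) ≤ 8 * √((M : ℝ) * n) := by
    have h4 : (chainBound n M : ℝ) ≤ Nat.sqrt (64 * (M * n)) := by exact_mod_cast min_le_right _ _
    refine h4.trans (Real.nat_sqrt_le_real_sqrt.trans ?_)
    rw [show ((64 * (M * n) : ℕ) : ℝ) = 8 ^ 2 * ((M : ℝ) * n) by push_cast; ring,
      Real.sqrt_mul (by positivity), Real.sqrt_sq (by norm_num)]
  refine ⟨?_, le_min h1 hn'⟩
  rw [mul_min_of_nonneg _ _ (by norm_num)]
  exact le_min (by linarith) (by linarith)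

/-- With `μ = min √(M n) n`, the scans cost `O(μ n + μ m)`. Here `μ n ≤ n ^ 2`, and reading the
edges is absorbed by `m ≤ m μ`. The space is `O(n μ)`. -/
theorem exists_preprocessing (hM : 1 ≤ M) (hW : (n + M) ^ 6 ≤ 2 ^ W)
    (hT : I.FailureTable H table) (htab : ∀ t v, table t v ≤ n * M + 1) :
    ∃ (σ : WordState) (T : ℕ), WordRun W preprocessing (I.input table) σ T ∧
      (T : ℝ) ≤ 2000 * (min (I.numEdges * √((M : ℝ) * n)) ((I.numEdges : ℝ) * n) + (n : ℝ) ^ 2) ∧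
      (structureWords 15 σ : ℝ) ≤
        2000 * min ((M : ℝ) ^ (1 / 2 : ℝ) * (n : ℝ) ^ (3 / 2 : ℝ)) ((n : ℝ) ^ 2) ∧
      ∃ pos E off, I.Oracle H pos E off (structureMem 15 σ) := by
  obtain ⟨σ, T, hr, pos, E, off, hO, hE, hwords, hT⟩ :=
    wp_preprocessing (fits hM hW htab) hM hT
  have hn : 1 ≤ n := I.source.pos
  obtain ⟨hk, hμ⟩ := chainBound_succ_le hM hn
  have hn' : (1 : ℝ) ≤ n := by exact_mod_cast hn
  refine ⟨σ, T, hr, ?_, ?_, pos, E, off, hO⟩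
  · rw [numEdges_eq, ← mul_min_of_nonneg _ _ (Nat.cast_nonneg _)]
    have hT' : (T : ℝ) ≤ 200 + 200 * I.edges.length + (n + 1) * (20 + 30 * n) +
        n * (100 + 180 * n) + (chainBound n M + 1) * (60 * n + 120 * I.edges.length) := by
      rw [zero_add] at hT
      exact_mod_cast hT
    have hμn : min √((M : ℝ) * n) n ≤ n := min_le_right _ _
    generalize min √((M : ℝ) * n) n = μ at *
    have hm : (0 : ℝ) ≤ I.edges.length := Nat.cast_nonneg _
    generalize (I.edges.length : ℝ) = m at *
    have h1 : ((chainBound n M : ℝ) + 1) * (60 * n + 120 * m) ≤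
        540 * (μ * n) + 1080 * (m * μ) :=
      (mul_le_mul_of_nonneg_right hk (by positivity)).trans_eq (by ring)
    have h2 : μ * n ≤ n * n := mul_le_mul_of_nonneg_right hμn (by positivity)
    have h3 : m ≤ m * μ := le_mul_of_one_le_right hm hμ
    have h4 : (n : ℝ) ≤ n * n := le_mul_of_one_le_right (by positivity) hn'
    have h5 : ((n : ℝ) + 1) * (20 + 30 * n) = 20 + 50 * n + 30 * (n * n) := by ring
    have h6 : (n : ℝ) * (100 + 180 * n) = 100 * n + 180 * (n * n) := by ring
    rw [h5, h6] at hT'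
    rw [sq]
    linarith
  · rw [mul_rpow_eq hM hn, sq, ← mul_min_of_nonneg _ _ (Nat.cast_nonneg _)]
    have hE' : (E : ℝ) ≤ 1 + n * (chainBound n M + 1) := by exact_mod_cast hE
    have hwords' : (structureWords 15 σ : ℝ) ≤ 7 * n + 2 + 4 * E := by exact_mod_cast hwords
    generalize min √((M : ℝ) * n) n = μ at *
    have h1 : (n : ℝ) * (chainBound n M + 1) ≤ n * (9 * μ) :=
      mul_le_mul_of_nonneg_left hk (by positivity)
    have h2 : (n : ℝ) ≤ n * μ := le_mul_of_one_le_right (by positivity) hμ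
    linarith

/-- An edge lies in the tree exactly when one endpoint is the parent of the other, which two lookups
detect. Otherwise the given tree is returned unchanged. -/
theorem answersTree_deleteEdge (hW : I.Fits I.edgeReplacement W)
    (hO : I.Oracle I.edgeFailure pos E off (structureMem 15 σ)) (u v : Fin n) :
    AnswersTree W 15 (block [selectEdge, answerTree]) [u, v] σ (I.deleteEdge s(u, v)) I.weight
      I.source (2000 * n) := by
  refine hO.answersTree hW failureTable_edge (deleteEdge_le _) rfl ?_
  simp only [selectEdge, wp_branch, wp_assign, WordExpr.eval_eq, WordExpr.eval_load,
    WordExpr.eval_reg, WordExpr.eval_add, hW.one, WordState.start, List.getD_cons_zero,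
    List.getD_cons_succ, hO.par, eval_succ hW, vertexCode_eq_succ, WordState.setReg_reg, if_true,
    ne_eq, ite_eq_right_iff, one_ne_zero, imp_false, not_not, WordExpr.eval_zero, hO.size]
  refine ⟨fun h => ⟨by simp, .inr ⟨v, u, rfl, h, (edgeFailure_of_tree h).symm⟩⟩, fun h => ⟨fun h' =>
    ⟨by simp, .inr ⟨u, v, rfl, h', ?_⟩⟩, fun h' => ⟨by simp, .inl ⟨trivial, fun t p hp => ?_⟩⟩⟩⟩
  · rw [edgeFailure_of_tree h', Sym2.eq_swap]
  · rw [deleteEdge, SimpleGraph.deleteEdges_adj]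
    refine ⟨(tree_spec hp).1, ?_⟩
    rw [Set.mem_singleton_iff, Sym2.eq_iff]
    rintro (⟨rfl, rfl⟩ | ⟨rfl, rfl⟩)
    · exact h hp
    · exact h' hp

/-- A vertex other than the source without parent is unreachable, so no tree edge is incident to it
and the given tree remains valid. -/
theorem answersTree_deleteVertex (hW : I.Fits I.vertexReplacement W)
    (hO : I.Oracle I.deleteVertex pos E off (structureMem 15 σ)) (hv : v ≠ I.source) :
    AnswersTree W 15 (block [selectVertex, answerTree]) [v] σ (I.deleteVertex v) I.weight
      I.source (2000 * n) := by
  refine hO.answersTree hW failureTable_vertex (deleteVertex_le _) rfl ?_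
  simp only [selectVertex, wp_branch, wp_assign, WordExpr.eval_load,
    WordExpr.eval_reg, WordState.start, List.getD_cons_zero, hO.par, WordState.setReg_reg, if_true,
    WordExpr.eval_zero, hO.size]
  cases hp : I.tree v with
  | some p => exact ⟨fun _ => ⟨by simp, .inr ⟨v, p, rfl, hp, rfl⟩⟩, fun h => by simp [vertexCode] at h⟩
  | none =>
    refine ⟨fun h => absurd rfl h, fun _ => ⟨by simp, .inl ⟨trivial, fun t p ht => ?_⟩⟩⟩
    obtain ⟨hadj, hr, -, -⟩ := tree_spec ht
    refine SimpleGraph.deleteIncidenceSet_adj.2 ⟨hadj, ?_, ?_⟩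
    · rintro rfl
      obtain ⟨p', hp'⟩ := exists_parent hr hv
      rw [hp] at hp'
      simp at hp'
    · rintro rfl
      rw [hp] at ht
      simp at ht

end SourcedGraph

theorem mainTheorem10 :
    -- edge failures
    (∃ (preprocess query : WordCmd) (K C c : ℕ),
      ∀ (n M : ℕ) (I : SourcedGraph n M) (W : ℕ), 1 ≤ M → (n + M) ^ c ≤ 2 ^ W →
        ∃ (σ : WordState) (T : ℕ), WordRun W preprocess (I.input I.edgeReplacement) σ T ∧
          (T : ℝ) ≤ C * (min (I.numEdges * √((M : ℝ) * n)) ((I.numEdges : ℝ) * n) + (n : ℝ) ^ 2) ∧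
          (structureWords K σ : ℝ) ≤
            C * min ((M : ℝ) ^ (1 / 2 : ℝ) * (n : ℝ) ^ (3 / 2 : ℝ)) ((n : ℝ) ^ 2) ∧
          ∀ u v : Fin n, I.graph.Adj u v →
            AnswersTree W K query [u, v] σ (I.deleteEdge s(u, v)) I.weight I.source (C * n)) ∧
    -- vertex failures
    (∃ (preprocess query : WordCmd) (K C c : ℕ),
      ∀ (n M : ℕ) (I : SourcedGraph n M) (W : ℕ), 1 ≤ M → (n + M) ^ c ≤ 2 ^ W →
        ∃ (σ : WordState) (T : ℕ), WordRun W preprocess (I.input I.vertexReplacement) σ T ∧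
          (T : ℝ) ≤ C * (min (I.numEdges * √((M : ℝ) * n)) ((I.numEdges : ℝ) * n) + (n : ℝ) ^ 2) ∧
          (structureWords K σ : ℝ) ≤
            C * min ((M : ℝ) ^ (1 / 2 : ℝ) * (n : ℝ) ^ (3 / 2 : ℝ)) ((n : ℝ) ^ 2) ∧
          ∀ v : Fin n, v ≠ I.source →
            AnswersTree W K query [v] σ (I.deleteVertex v) I.weight I.source (C * n)) := by

  constructor
  · refine ⟨preprocessing, block [selectEdge, answerTree], 15, 2000, 6, ?_⟩
    intro n M I W hM hW
    obtain ⟨σ, T, hr, hT, hwords, pos, E, off, hO⟩ :=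
      SourcedGraph.exists_preprocessing (I := I) hM hW SourcedGraph.failureTable_edge
        SourcedGraph.edgeReplacement_le
    exact ⟨σ, T, hr, by exact_mod_cast hT, by exact_mod_cast hwords, fun u v _ =>
      SourcedGraph.answersTree_deleteEdge
        (SourcedGraph.fits hM hW SourcedGraph.edgeReplacement_le) hO u v⟩
  · refine ⟨preprocessing, block [selectVertex, answerTree], 15, 2000, 6, ?_⟩
    intro n M I W hM hW
    obtain ⟨σ, T, hr, hT, hwords, pos, E, off, hO⟩ :=
      SourcedGraph.exists_preprocessing (I := I) hM hW SourcedGraph.failureTable_vertex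
        SourcedGraph.vertexReplacement_le
    exact ⟨σ, T, hr, by exact_mod_cast hT, by exact_mod_cast hwords, fun v hv =>
      SourcedGraph.answersTree_deleteVertex
        (SourcedGraph.fits hM hW SourcedGraph.vertexReplacement_le) hO hv⟩
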